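/- Let $K=\mathbf F_q$ be a finite field and $V\cong K^n$ a $K$-vector space of dimension $n\ge 2$. A transvection is an element $t\in\mathrm{SL}(V)$ such that $t-1$ has rank one; equivalently $t=1+v\otimes\phi$ (i.e. $t(x)=x+\phi(x)v$) with $0\ne v\in V$, $0\ne\phi\in V^*$, $\phi(v)=0$. For a set $T$ of transvections put $V(T)=\sum_{t\in T}\operatorname{im}(t-1)\le V$ and $V^*(T)=\sum_{t\in T}\ker(t-1)^{\perp}\le V^*$. Call $T$ *dense* if for all nonzero $u\in V$ and $\psi\in V^*$ there is $1+v\otimes\phi\in T$ with $\psi(v)\ne0$ and $\phi(u)\neq 0$. Call $T$ *nondegenerate* if the natural pairing $V(T)\times V^*(T)\to K$ has zero left kernel and zero right kernel, and *weakly nondegenerate* if it has zero left kernel or zero right kernel. For a group $G\le\mathrm{GL}(V)$ let $[V,G]$ be the span of all $gv-v$ with $g\in G$, $v\in V$; for a $G$-invariant subspace $W$ let $G|W$ be the induced group in $\mathrm{GL}(W)$. Let $W$ be a $K$-vector space of finite dimension $d\geq 2$ and $H\le\mathrm{GL}(W)$. We say that $H$ has *monomial type* if $q$ is even and there are a divisor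 $a>1$ of $q-1$ and a basis of $W$ such that $H$ is the group $M_d(a)\cong C_a^{d-1}\rtimes S_d$ of all elements of $\mathrm{SL}(W)$ represented in this basis by monomial matrices whose nonzero entries are $a$-th roots of unity. We say that $H$ has *odd symmetric type* if $q$ is even, $d=m-1$ with $m$ odd, and $W$ can be identified with the hyperplane $\{x\in K^m:\sum_i x_i=0\}$ in such a way that $H$ is the group of all permutations $S_m$ of the coordinates. Let $T$ be a dense set of transvections in $\mathrm{SL}(V)$ and $G=\langle T\rangle$, and suppose that $G$ preserves no symplectic form (nondegenerate alternating bilinear form) on $V$. Then the following are equivalent: 1. $G$ has monomial type; 2. for every subset $T_0\subseteq T$ with $|T_0|\le 1000$: (a) if $T_0$ is weakly nondegenerate then it is nondegenerate, and (b) if $G_0=\langle T_0\rangle$ acts irreducibly on $V_0=[V,G_0]$ and $\dim V_0\ge2$, then $G_0|V_0$ has monomial type or odd symmetric type. -/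

import Mathlib

open Module

namespace TransvectionGroups

variable {K V : Type*} [Field K] [AddCommGroup V] [Module K V]

/-- The linear map `g - 1`. -/
def subOne (g : V ≃ₗ[K] V) : V →ₗ[K] V := (g : V →ₗ[K] V) - LinearMap.id

/-- A transvection is an element `t` of `SL(V)` such that `t - 1` has rank one. -/
def IsTransvection (t : V ≃ₗ[K] V) : Prop :=
  LinearMap.det (t : V →ₗ[K] V) = 1 ∧ finrank K (LinearMap.range (subOne t)) = 1

/-- `T` is dense if for all nonzero `v` in `V` and nonzero `φ` in `V*` there is
`t = 1 + u ⊗ ψ` in `T` with `φ(u) ≠ 0` and `ψ(v) ≠ 0`. -/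
def IsDense (T : Set (V ≃ₗ[K] V)) : Prop :=
  ∀ v : V, v ≠ 0 → ∀ φ : Dual K V, φ ≠ 0 →
    ∃ t ∈ T, ∃ (u : V) (ψ : Dual K V), (∀ x, t x = x + ψ x • u) ∧ φ u ≠ 0 ∧ ψ v ≠ 0

/-- The subspace `V(T)` of `V`, the sum of the images of `t - 1` for `t` in `T`. -/
def vecSpan (T : Set (V ≃ₗ[K] V)) : Submodule K V :=
  ⨆ t ∈ T, LinearMap.range (subOne t)

/-- The subspace `V*(T)` of `V*`, the sum of the annihilators of `ker (t - 1)` for `t` in `T`. -/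
def covecSpan (T : Set (V ≃ₗ[K] V)) : Submodule K (Dual K V) :=
  ⨆ t ∈ T, (LinearMap.ker (subOne t)).dualAnnihilator

/-- The pairing `V(T) × V*(T) → K` has zero left kernel. -/
def ZeroLeftKernel (T : Set (V ≃ₗ[K] V)) : Prop :=
  ∀ v ∈ vecSpan T, (∀ φ ∈ covecSpan T, φ v = 0) → v = 0

/-- The pairing `V(T) × V*(T) → K` has zero right kernel. -/
def ZeroRightKernel (T : Set (V ≃ₗ[K] V)) : Prop :=
  ∀ φ ∈ covecSpan T, (∀ v ∈ vecSpan T, φ v = 0) → φ = 0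

def IsNondegenerate (T : Set (V ≃ₗ[K] V)) : Prop :=
  ZeroLeftKernel T ∧ ZeroRightKernel T

def IsWeaklyNondegenerate (T : Set (V ≃ₗ[K] V)) : Prop :=
  ZeroLeftKernel T ∨ ZeroRightKernel T

/-- `G` preserves a symplectic (nondegenerate alternating bilinear) form on `V`. -/
def PreservesSymplecticForm (G : Subgroup (V ≃ₗ[K] V)) : Prop :=
  ∃ B : LinearMap.BilinForm K V, B.IsAlt ∧ B.Nondegenerate ∧
    ∀ g ∈ G, ∀ x y, B (g x) (g y) = B x y

/-- The commutator space `[V, G]`, spanned by the vectors `g v - v`. -/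
def commutatorSpace (G : Subgroup (V ≃ₗ[K] V)) : Submodule K V :=
  Submodule.span K {w | ∃ g ∈ G, ∃ v : V, w = g v - v}

/-- For a `G`-invariant subspace `W`, the group `G | W` of linear automorphisms of `W`
induced by the elements of `G`. -/
def restrict (G : Subgroup (V ≃ₗ[K] V)) (W : Submodule K V) : Subgroup (W ≃ₗ[K] W) where
  carrier := {h | ∃ g ∈ G, ∀ w : W, (h w : V) = g w}
  one_mem' := ⟨1, G.one_mem, fun _ => rfl⟩
  mul_mem' := by
    rintro h h' ⟨g, hg, hgh⟩ ⟨g', hg', hgh'⟩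
    exact ⟨g * g', G.mul_mem hg hg', fun w => by
      rw [LinearEquiv.mul_apply, LinearEquiv.mul_apply, hgh, hgh']⟩
  inv_mem' := by
    rintro h ⟨g, hg, hgh⟩
    refine ⟨g⁻¹, G.inv_mem hg, fun w => ?_⟩
    have h1 := hgh (h⁻¹ w)
    have h2 : h (h⁻¹ w) = w := h.apply_symm_apply w
    rw [h2] at h1
    rw [h1]
    exact (g.symm_apply_apply _).symm

/-- `G` acts irreducibly on `V`. -/
def IsIrreducibleGroup (G : Subgroup (V ≃ₗ[K] V)) : Prop :=
  Nontrivial V ∧ ∀ W : Submodule K V, (∀ g ∈ G, ∀ w ∈ W, g w ∈ W) → W = ⊥ ∨ W = ⊤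

/-- `g` lies in `SL(V)` and is represented in the basis `b` by a monomial matrix whose nonzero
entries are `a`-th roots of unity; for the standard basis of `K ^ n` these elements form `M_n(a)`. -/
def IsMonomialElement {n : ℕ} (b : Basis (Fin n) K V) (a : ℕ) (g : V ≃ₗ[K] V) : Prop :=
  LinearMap.det (g : V →ₗ[K] V) = 1 ∧
    ∃ (σ : Equiv.Perm (Fin n)) (c : Fin n → K),
      (∀ i, c i ^ a = 1) ∧ ∀ i, g (b i) = c i • b (σ i)

/-- `G` has monomial type: `K` has characteristic `2` and, with respect to some basis of `V`, `G`
is the group `M_n(a) ≅ C_a ^ (n - 1) ⋊ S_n`, for some `n ≥ 2` and some divisor `a > 1` of `q - 1`,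
where `q = |K|`. -/
def HasMonomialType (G : Subgroup (V ≃ₗ[K] V)) : Prop :=
  CharP K 2 ∧ ∃ n : ℕ, 2 ≤ n ∧ ∃ a : ℕ, 1 < a ∧ a ∣ Nat.card K - 1 ∧
    ∃ b : Basis (Fin n) K V, ∀ g : V ≃ₗ[K] V, g ∈ G ↔ IsMonomialElement b a g

/-- The hyperplane of vectors with zero coordinate sum in the permutation module `K ^ m`. -/
def sumZero (K : Type*) [Field K] (m : ℕ) : Submodule K (Fin m → K) :=
  LinearMap.ker (∑ i : Fin m, (LinearMap.proj i : (Fin m → K) →ₗ[K] K))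

/-- `G` has odd symmetric type: `K` has characteristic `2` and `V` can be identified with the
zero-sum hyperplane of `K ^ m`, with `m ≥ 3` odd, in such a way that `G` is the image of `S_m`.
(This is the scalar extension to `K` of the same module over the field with two elements.) -/
def HasOddSymmetricType (G : Subgroup (V ≃ₗ[K] V)) : Prop :=
  CharP K 2 ∧ ∃ m : ℕ, 3 ≤ m ∧ Odd m ∧ ∃ e : V ≃ₗ[K] sumZero K m,
    ∀ g : V ≃ₗ[K] V, g ∈ G ↔ ∃ σ : Equiv.Perm (Fin m), ∀ (x : V) (i : Fin m),
      (e (g x) : Fin m → K) (σ i) = (e x : Fin m → K) i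

end TransvectionGroups

/-!
In characteristic two the transvections of a monomial group are the *edges*
`1 + (e i + c e j) ⊗ (f i + c⁻¹ f j)` of a frame, where `e` is a basis and `f` its dual basis: such
an element interchanges two of the lines `K e i` up to scalars, and `c` is its gain.

*From local to global.* Density allows one to enlarge a nonempty set of transvections by boundedly
many elements of `T` to an irreducible system, and by (a) such a system is nondegenerate. Odd
symmetric groups preserve the symplectic form induced by the dot product. Whether `T` preserves a
symplectic form is a question of skew-symmetrizability, decided by five elements of `T`. Hence some
system of bounded size, and every larger irreducible one within the given bound, acts with monomial
type. Such a group contains two edges with the same ends and different gains; they have the same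
ends in every frame, because this is expressed by numerical invariants such as `ψ v * φ u`, and the
product of the two determines their common ends. Therefore all local frames share a vertex, and the
local frames at triples of elements of `T` glue to a frame of `V`. The gains along the edges of this
frame form a subgroup of `Kˣ`, which yields `M_n(a)`.

*From global to local.* If `T` consists of edges of a basis of `V`, then inverting coordinates is a
(nonlinear) bijection between the annihilators of `V(T₀)` and of `V*(T₀)`. As `K` is finite, these
two spaces have the same dimension, so a zero kernel on one side forces a zero kernel on the other.
An irreducible set of edges is connected, and after rescaling the basis its gains form a subgroup
`H` of `Kˣ`. If `H` is trivial, then the group is a symmetric group, of odd degree because in even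
degree the all-ones vector is fixed and has zero coordinate sum. Otherwise it is `M_m(|H|)`.
-/

namespace TransvectionGroups

variable {K V : Type*} [Field K] [AddCommGroup V] [Module K V]

section Presentations

/-- `t` is the transvection `1 + v ⊗ φ`. -/
structure IsTransvectionAlong (t : V ≃ₗ[K] V) (v : V) (φ : Dual K V) : Prop where
  apply_self : φ v = 0
  vec_ne : v ≠ 0
  covec_ne : φ ≠ 0
  apply : ∀ x, t x = x + φ x • v

theorem subOne_apply (t : V ≃ₗ[K] V) (x : V) : subOne t x = t x - x := by
  simp [subOne]

theorem IsTransvection.exists_isTransvectionAlong [FiniteDimensional K V] {t : V ≃ₗ[K] V}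
    (ht : IsTransvection t) : ∃ v φ, IsTransvectionAlong t v φ := by
  obtain ⟨hdet, hrank⟩ := ht
  obtain ⟨φ, v, hφv⟩ := (LinearEquiv.mem_dilatransvections_iff_finrank).2 hrank.le
  have happ : ∀ x, t x = x + φ x • v := fun x => by
    rw [← LinearEquiv.coe_coe, hφv, LinearMap.transvection.apply]
  have hne : ¬ ∀ x, φ x • v = 0 := fun h0 => by
    have : subOne t = 0 := LinearMap.ext fun x => by
      rw [subOne_apply, happ, h0, add_zero, sub_self, LinearMap.zero_apply]
    rw [this, LinearMap.range_zero, finrank_bot] at hrank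
    exact zero_ne_one hrank
  refine ⟨v, φ, ?_, fun h => hne (by simp [h]), fun h => hne (by simp [h]), happ⟩
  rw [hφv, LinearMap.transvection.det] at hdet
  simpa using hdet

/-- The rank one maps `x ⊗ φ` and `y ⊗ ψ` are equal. A transvection determines its pair of a vector
and a covector only up to this relation, and so does a frame its vertices. -/
def IsRescaling (x : V) (φ : Dual K V) (y : V) (ψ : Dual K V) : Prop :=
  ∃ a : K, a ≠ 0 ∧ y = a • x ∧ ψ = a⁻¹ • φ

namespace IsRescaling

variable {x x' y y' z z' : V} {φ φ' ψ ψ' χ χ' : Dual K V}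

theorem refl (x : V) (φ : Dual K V) : IsRescaling x φ x φ :=
  ⟨1, one_ne_zero, by simp, by simp⟩

theorem symm (h : IsRescaling x φ y ψ) : IsRescaling y ψ x φ := by
  obtain ⟨a, ha, rfl, rfl⟩ := h
  exact ⟨a⁻¹, inv_ne_zero ha, by simp [smul_smul, ha], by simp [smul_smul, ha]⟩

theorem trans (h : IsRescaling x φ y ψ) (h' : IsRescaling y ψ z χ) : IsRescaling x φ z χ := by
  obtain ⟨a, ha, rfl, rfl⟩ := h
  obtain ⟨b, hb, rfl, rfl⟩ := h'
  exact ⟨b * a, mul_ne_zero hb ha, by rw [smul_smul], by rw [smul_smul, mul_inv]⟩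

theorem apply_self (h : IsRescaling x φ y ψ) : ψ y = φ x := by
  obtain ⟨a, ha, rfl, rfl⟩ := h
  simp [ha]

theorem apply_eq_zero_iff (h : IsRescaling x φ x' φ') (h' : IsRescaling y ψ y' ψ') :
    φ' y' = 0 ↔ φ y = 0 := by
  obtain ⟨a, ha, rfl, rfl⟩ := h
  obtain ⟨b, hb, rfl, rfl⟩ := h'
  simp [ha, hb]

theorem apply_mul_apply (h : IsRescaling x φ x' φ') (h' : IsRescaling y ψ y' ψ') :
    φ' y' * ψ' x' = φ y * ψ x := by
  obtain ⟨a, ha, rfl, rfl⟩ := h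
  obtain ⟨b, hb, rfl, rfl⟩ := h'
  simp only [LinearMap.smul_apply, map_smul, smul_eq_mul]
  field_simp

theorem apply_mul_apply_mul_apply (h : IsRescaling x φ x' φ') (h' : IsRescaling y ψ y' ψ')
    (h'' : IsRescaling z χ z' χ') : φ' y' * ψ' z' * χ' x' = φ y * ψ z * χ x := by
  obtain ⟨a, ha, rfl, rfl⟩ := h
  obtain ⟨b, hb, rfl, rfl⟩ := h'
  obtain ⟨c, hc, rfl, rfl⟩ := h''
  simp only [LinearMap.smul_apply, map_smul, smul_eq_mul]
  field_simp

end IsRescaling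

namespace IsTransvectionAlong

variable {t : V ≃ₗ[K] V} {v v' : V} {φ φ' : Dual K V}

theorem exists_apply_eq_one (h : IsTransvectionAlong t v φ) : ∃ x, φ x = 1 :=
  LinearMap.surjective h.covec_ne 1

theorem apply_sub_self (h : IsTransvectionAlong t v φ) (x : V) : t x - x = φ x • v := by
  rw [h.apply, add_sub_cancel_left]

theorem range_subOne (h : IsTransvectionAlong t v φ) :
    LinearMap.range (subOne t) = K ∙ v := by
  ext x
  simp only [LinearMap.mem_range, subOne_apply, h.apply_sub_self, Submodule.mem_span_singleton]
  exact (LinearMap.surjective h.covec_ne).exists (p := fun c => c • v = x).symm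

theorem ker_subOne (h : IsTransvectionAlong t v φ) :
    LinearMap.ker (subOne t) = LinearMap.ker φ := by
  ext x
  rw [LinearMap.mem_ker, LinearMap.mem_ker, subOne_apply, h.apply_sub_self, smul_eq_zero,
    or_iff_left h.vec_ne]

theorem dualAnnihilator_ker (h : IsTransvectionAlong t v φ) :
    (LinearMap.ker (subOne t)).dualAnnihilator = K ∙ φ := by
  have hker : LinearMap.ker φ = (K ∙ φ).dualCoannihilator :=
    SetLike.ext' (by ext; simp [Submodule.coe_dualCoannihilator_span])
  rw [h.ker_subOne, hker, Subspace.dualCoannihilator_dualAnnihilator_eq]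

theorem apply_eq_self_iff (h : IsTransvectionAlong t v φ) {x : V} : t x = x ↔ φ x = 0 := by
  rw [h.apply, add_eq_left, smul_eq_zero, or_iff_left h.vec_ne]

theorem rescale (h : IsTransvectionAlong t v φ) (hr : IsRescaling v φ v' φ') :
    IsTransvectionAlong t v' φ' := by
  obtain ⟨a, ha, rfl, rfl⟩ := hr
  refine ⟨by simp [h.apply_self], smul_ne_zero ha h.vec_ne,
    smul_ne_zero (inv_ne_zero ha) h.covec_ne, fun x => ?_⟩
  rw [h.apply, LinearMap.smul_apply, smul_smul, smul_eq_mul, mul_right_comm,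
    inv_mul_cancel₀ ha, one_mul]

theorem isRescaling (h : IsTransvectionAlong t v φ) (hap : ∀ x, t x = x + φ' x • v') :
    IsRescaling v φ v' φ' := by
  have hmul : ∀ x, φ x • v = φ' x • v' := fun x => by
    rw [← h.apply_sub_self, hap, add_sub_cancel_left]
  obtain ⟨y, hy⟩ := h.exists_apply_eq_one
  have hv : v = φ' y • v' := by rw [← hmul, hy, one_smul]
  have hφ' : φ' y ≠ 0 := fun h0 => h.vec_ne (by rw [hv, h0, zero_smul])
  have hv' : v' = (φ' y)⁻¹ • v := by rw [hv, inv_smul_smul₀ hφ']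
  refine ⟨(φ' y)⁻¹, inv_ne_zero hφ', hv', LinearMap.ext fun x => ?_⟩
  have hx := hmul x
  rw [hv', smul_smul] at hx
  have := smul_left_injective K h.vec_ne hx
  simp only [LinearMap.smul_apply, inv_inv, smul_eq_mul, this]
  field_simp

end IsTransvectionAlong

theorem commutatorSpace_closure_le {S : Set (V ≃ₗ[K] V)} {U : Submodule K V}
    (hU : ∀ t ∈ S, ∀ x, t x - x ∈ U) : commutatorSpace (Subgroup.closure S) ≤ U := by
  rw [commutatorSpace, Submodule.span_le]
  rintro _ ⟨g, hg, x, rfl⟩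
  rw [SetLike.mem_coe]
  induction hg using Subgroup.closure_induction generalizing x with
  | mem t ht => exact hU t ht x
  | one => simp
  | mul a b _ _ ha hb =>
    rw [LinearEquiv.mul_apply, ← sub_add_sub_cancel _ (b x)]
    exact U.add_mem (ha _) (hb _)
  | inv a _ ha =>
    have hax : a (a⁻¹ x) = x := a.apply_symm_apply x
    rw [← Submodule.neg_mem_iff, neg_sub]
    simpa only [hax] using ha (a⁻¹ x)

/-- `v` and `φ` present every element `t` of `T` as the transvection `1 + v t ⊗ φ t`. -/
def IsPresentation (T : Set (V ≃ₗ[K] V)) (v : (V ≃ₗ[K] V) → V) (φ : (V ≃ₗ[K] V) → Dual K V) :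
    Prop :=
  ∀ t ∈ T, IsTransvectionAlong t (v t) (φ t)

theorem exists_isPresentation [FiniteDimensional K V] {T : Set (V ≃ₗ[K] V)}
    (hT : ∀ t ∈ T, IsTransvection t) : ∃ v φ, IsPresentation T v φ := by
  choose! v φ h using fun t ht => (hT t ht).exists_isTransvectionAlong
  exact ⟨v, φ, h⟩

variable {S T : Set (V ≃ₗ[K] V)} {v : (V ≃ₗ[K] V) → V} {φ : (V ≃ₗ[K] V) → Dual K V}

namespace IsPresentation

theorem mono (h : IsPresentation T v φ) (hS : S ⊆ T) : IsPresentation S v φ :=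
  fun t ht => h t (hS ht)

theorem vecSpan_eq (h : IsPresentation T v φ) : vecSpan T = Submodule.span K (v '' T) := by
  rw [vecSpan, Submodule.span_eq_iSup_of_singleton_spans, iSup_image]
  exact iSup_congr fun t => iSup_congr fun ht => (h t ht).range_subOne

theorem covecSpan_eq (h : IsPresentation T v φ) : covecSpan T = Submodule.span K (φ '' T) := by
  rw [covecSpan, Submodule.span_eq_iSup_of_singleton_spans, iSup_image]
  exact iSup_congr fun t => iSup_congr fun ht => (h t ht).dualAnnihilator_ker

theorem vec_mem (h : IsPresentation T v φ) {t} (ht : t ∈ T) : v t ∈ vecSpan T := by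
  rw [h.vecSpan_eq]; exact Submodule.subset_span ⟨t, ht, rfl⟩

theorem covec_mem (h : IsPresentation T v φ) {t} (ht : t ∈ T) : φ t ∈ covecSpan T := by
  rw [h.covecSpan_eq]; exact Submodule.subset_span ⟨t, ht, rfl⟩

theorem forall_covecSpan_iff (h : IsPresentation T v φ) (x : V) :
    (∀ ψ ∈ covecSpan T, ψ x = 0) ↔ ∀ t ∈ T, φ t x = 0 := by
  rw [← Submodule.mem_dualCoannihilator, ← SetLike.mem_coe, h.covecSpan_eq,
    Submodule.coe_dualCoannihilator_span]
  exact Set.forall_mem_image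

theorem forall_vecSpan_iff (h : IsPresentation T v φ) (ψ : Dual K V) :
    (∀ x ∈ vecSpan T, ψ x = 0) ↔ ∀ t ∈ T, ψ (v t) = 0 := by
  rw [← Submodule.mem_dualAnnihilator, ← SetLike.mem_coe, h.vecSpan_eq,
    Submodule.coe_dualAnnihilator_span]
  exact Set.image_subset_iff

theorem vec_mem_of_covec_ne (h : IsPresentation T v φ) {t} (ht : t ∈ T) {W : Submodule K V}
    (hW : ∀ x ∈ W, t x ∈ W) {x : V} (hx : x ∈ W) (hφ : φ t x ≠ 0) : v t ∈ W := by
  rw [← W.smul_mem_iff hφ, ← (h t ht).apply_sub_self]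
  exact W.sub_mem (hW x hx) hx

theorem commutatorSpace_eq (h : IsPresentation T v φ) :
    commutatorSpace (Subgroup.closure T) = vecSpan T := by
  apply le_antisymm
  · refine commutatorSpace_closure_le fun t ht x => ?_
    rw [(h t ht).apply_sub_self]
    exact Submodule.smul_mem _ _ (h.vec_mem ht)
  · rw [h.vecSpan_eq, Submodule.span_le]
    rintro _ ⟨t, ht, rfl⟩
    obtain ⟨y, hy⟩ := (h t ht).exists_apply_eq_one
    exact Submodule.subset_span ⟨t, Subgroup.subset_closure ht, y, by
      rw [(h t ht).apply_sub_self, hy, one_smul]⟩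

theorem exists_covec_ne_and_apply_vec_ne (h : IsPresentation T v φ) (hd : IsDense T) {x : V}
    (hx : x ≠ 0) {ψ : Dual K V} (hψ : ψ ≠ 0) : ∃ t ∈ T, φ t x ≠ 0 ∧ ψ (v t) ≠ 0 := by
  obtain ⟨t, ht, u, χ, hap, hu, hχ⟩ := hd x hx ψ hψ
  obtain ⟨α, -, rfl, rfl⟩ := (h t ht).isRescaling hap
  refine ⟨t, ht, ?_, ?_⟩
  · exact right_ne_zero_of_mul (by simpa using hχ)
  · exact right_ne_zero_of_mul (by simpa using hu)

theorem exists_link (h : IsPresentation T v φ) (hd : IsDense T) {s t}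
    (hs : s ∈ T) (ht : t ∈ T) : ∃ r ∈ T, φ r (v s) ≠ 0 ∧ φ t (v r) ≠ 0 :=
  h.exists_covec_ne_and_apply_vec_ne hd (h s hs).vec_ne (h t ht).covec_ne

end IsPresentation

/-- The arrows of the digraph on `S` attached to a presentation: they run from `s` to those `t` in
`S` for which `φ t (v s) ≠ 0`. -/
def Arrow (S : Set (V ≃ₗ[K] V)) (v : (V ≃ₗ[K] V) → V) (φ : (V ≃ₗ[K] V) → Dual K V)
    (s t : V ≃ₗ[K] V) : Prop :=
  t ∈ S ∧ φ t (v s) ≠ 0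

theorem Arrow.mono (hST : S ⊆ T) {s t : V ≃ₗ[K] V} (h : Arrow S v φ s t) : Arrow T v φ s t :=
  ⟨hST h.1, h.2⟩

/-- Strong connectivity of the digraph on `S` attached to a presentation. -/
def IsStronglyConnected (S : Set (V ≃ₗ[K] V)) (v : (V ≃ₗ[K] V) → V)
    (φ : (V ≃ₗ[K] V) → Dual K V) : Prop :=
  ∀ s ∈ S, ∀ t ∈ S, Relation.ReflTransGen (Arrow S v φ) s t

theorem isStronglyConnected_singleton (t : V ≃ₗ[K] V) : IsStronglyConnected {t} v φ := by
  rintro s rfl r rfl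
  exact .refl

theorem IsStronglyConnected.extend (h : IsStronglyConnected S v φ) (hST : S ⊆ T)
    (h_from : ∀ t ∈ T, ∃ s ∈ S, Relation.ReflTransGen (Arrow T v φ) s t)
    (h_to : ∀ t ∈ T, ∃ s ∈ S, Relation.ReflTransGen (Arrow T v φ) t s) :
    IsStronglyConnected T v φ := by
  intro a ha b hb
  obtain ⟨s, hs, has⟩ := h_to a ha
  obtain ⟨t, ht, htb⟩ := h_from b hb
  exact has.trans ((Relation.ReflTransGen.mono (fun _ _ => .mono hST) _ _ (h s hs t ht)).trans htb)

theorem IsStronglyConnected.insert_vertex (h : IsStronglyConnected S v φ) {s s' t : V ≃ₗ[K] V}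
    (hs : s ∈ S) (hs' : s' ∈ S) (hst : φ t (v s) ≠ 0) (hts' : φ s' (v t) ≠ 0) :
    IsStronglyConnected (insert t S) v φ := by
  refine h.extend (Set.subset_insert t S) ?_ ?_
  · rintro r (rfl | hr)
    · exact ⟨s, hs, .single ⟨.inl rfl, hst⟩⟩
    · exact ⟨r, hr, .refl⟩
  · rintro r (rfl | hr)
    · exact ⟨s', hs', .single ⟨.inr hs', hts'⟩⟩
    · exact ⟨r, hr, .refl⟩

theorem IsStronglyConnected.insert_path (h : IsStronglyConnected S v φ) {s t r r' : V ≃ₗ[K] V}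
    (hs : s ∈ S) (hsr : φ r (v s) ≠ 0) (hrt : φ t (v r) ≠ 0) (htr' : φ r' (v t) ≠ 0)
    (hr's : φ s (v r') ≠ 0) : IsStronglyConnected (insert t (insert r (insert r' S))) v φ := by
  have hST : S ⊆ insert t (insert r (insert r' S)) :=
    ((Set.subset_insert _ _).trans (Set.subset_insert _ _)).trans (Set.subset_insert _ _)
  have arrow_sr : Arrow (insert t (insert r (insert r' S))) v φ s r := ⟨.inr (.inl rfl), hsr⟩
  have arrow_rt : Arrow (insert t (insert r (insert r' S))) v φ r t := ⟨.inl rfl, hrt⟩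
  have arrow_tr' : Arrow (insert t (insert r (insert r' S))) v φ t r' :=
    ⟨.inr (.inr (.inl rfl)), htr'⟩
  have arrow_r's : Arrow (insert t (insert r (insert r' S))) v φ r' s := ⟨hST hs, hr's⟩
  refine h.extend hST ?_ ?_
  · rintro a (rfl | rfl | rfl | ha)
    exacts [⟨s, hs, .head arrow_sr (.single arrow_rt)⟩, ⟨s, hs, .single arrow_sr⟩,
      ⟨s, hs, .head arrow_sr (.head arrow_rt (.single arrow_tr'))⟩, ⟨a, ha, .refl⟩]
  · rintro a (rfl | rfl | rfl | ha)
    exacts [⟨s, hs, .head arrow_tr' (.single arrow_r's)⟩,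
      ⟨s, hs, .head arrow_rt (.head arrow_tr' (.single arrow_r's))⟩,
      ⟨s, hs, .single arrow_r's⟩, ⟨a, ha, .refl⟩]

/-- The left kernel of the pairing of `V(S)` and `V*(S)`. -/
def leftKernel (S : Set (V ≃ₗ[K] V)) : Submodule K V :=
  vecSpan S ⊓ (covecSpan S).dualCoannihilator

theorem zeroLeftKernel_iff : ZeroLeftKernel S ↔ leftKernel S = ⊥ := by
  simp [Submodule.eq_bot_iff, leftKernel, ZeroLeftKernel, Submodule.mem_dualCoannihilator]

theorem IsPresentation.mem_leftKernel_iff (h : IsPresentation S v φ) {x : V} :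
    x ∈ leftKernel S ↔ x ∈ vecSpan S ∧ ∀ t ∈ S, φ t x = 0 := by
  rw [leftKernel, Submodule.mem_inf, Submodule.mem_dualCoannihilator, h.forall_covecSpan_iff]

theorem finrank_sup_span_singleton_inf_le [FiniteDimensional K V] (A B : Submodule K V) (u : V) :
    finrank K ((A ⊔ K ∙ u) ⊓ B : Submodule K V) ≤ finrank K (A ⊓ B : Submodule K V) + 1 := by
  set C := (A ⊔ K ∙ u) ⊓ B with hC
  have hAC : A ⊓ C = A ⊓ B := by
    rw [hC, ← inf_assoc, inf_of_le_left (le_sup_left : A ≤ A ⊔ K ∙ u)]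
  have hsup : finrank K (A ⊔ C : Submodule K V) ≤ finrank K A + 1 :=
    calc finrank K (A ⊔ C : Submodule K V)
        ≤ finrank K (A ⊔ K ∙ u : Submodule K V) :=
          Submodule.finrank_mono (sup_le le_sup_left inf_le_left)
      _ ≤ finrank K A + finrank K (K ∙ u) := Submodule.finrank_add_le_finrank_add_finrank _ _
      _ ≤ finrank K A + 1 := by gcongr; exact (finrank_span_le_card {u}).trans (by simp)
  have := Submodule.finrank_sup_add_finrank_inf_eq A C
  rw [hAC] at this
  omega

theorem vecSpan_mono (h : S ⊆ T) : vecSpan S ≤ vecSpan T := biSup_mono h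

theorem covecSpan_mono (h : S ⊆ T) : covecSpan S ≤ covecSpan T := biSup_mono h

theorem IsPresentation.vecSpan_insert {t : V ≃ₗ[K] V} (h : IsPresentation (insert t S) v φ) :
    vecSpan (insert t S) = vecSpan S ⊔ K ∙ v t := by
  rw [h.vecSpan_eq, (h.mono (Set.subset_insert t S)).vecSpan_eq, Set.image_insert_eq,
    Submodule.span_insert, sup_comm]

theorem IsPresentation.finrank_leftKernel_insert_le [FiniteDimensional K V] {t : V ≃ₗ[K] V}
    (h : IsPresentation (insert t S) v φ) :
    finrank K (leftKernel (insert t S)) ≤ finrank K (leftKernel S) + 1 := by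
  refine le_trans (Submodule.finrank_mono ?_)
    (finrank_sup_span_singleton_inf_le (vecSpan S) (covecSpan S).dualCoannihilator (v t))
  rw [leftKernel, h.vecSpan_insert]
  exact inf_le_inf_left _
    (Submodule.dualCoannihilator_anti (covecSpan_mono (Set.subset_insert t S)))

theorem IsPresentation.leftKernel_insert_lt {t : V ≃ₗ[K] V} (h : IsPresentation (insert t S) v φ)
    {x : V} (hx : x ∈ leftKernel S) (htx : φ t x ≠ 0) {ψ : Dual K V} (hψ : ψ ∈ covecSpan S)
    (hψS : ∀ y ∈ vecSpan S, ψ y = 0) (hψt : ψ (v t) ≠ 0) :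
    leftKernel (insert t S) < leftKernel S := by
  have hS := h.mono (Set.subset_insert t S)
  refine SetLike.lt_iff_le_and_exists.2 ⟨fun y hy => ?_, x, hx, fun hx' =>
    htx ((h.mem_leftKernel_iff.1 hx').2 t (.inl rfl))⟩
  obtain ⟨hy, hφy⟩ := h.mem_leftKernel_iff.1 hy
  have hφSy : ∀ r ∈ S, φ r y = 0 := fun r hr => hφy r (.inr hr)
  rw [h.vecSpan_insert, Submodule.mem_sup] at hy
  obtain ⟨z, hz, w, hw, rfl⟩ := hy
  obtain ⟨c, rfl⟩ := Submodule.mem_span_singleton.1 hw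
  have hψy : ψ (z + c • v t) = 0 := (hS.forall_covecSpan_iff _).2 hφSy ψ hψ
  have hc : c = 0 := by simpa [hψS z hz, hψt] using hψy
  rw [hS.mem_leftKernel_iff]
  exact ⟨by simpa [hc] using hz, hφSy⟩

theorem IsPresentation.finrank_leftKernel_singleton_le [FiniteDimensional K V] {t : V ≃ₗ[K] V}
    (h : IsPresentation {t} v φ) : finrank K (leftKernel {t}) ≤ 1 := by
  refine (Submodule.finrank_mono inf_le_left).trans ?_
  rw [h.vecSpan_eq, Set.image_singleton]
  exact (finrank_span_singleton (h t rfl).vec_ne).le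

/-- Condition (a) of the theorem for the subsets of `T` with at most `N` elements. -/
def IsLocallyNondegenerate (T : Set (V ≃ₗ[K] V)) (N : ℕ) : Prop :=
  ∀ S ⊆ T, S.encard ≤ N → IsWeaklyNondegenerate S → IsNondegenerate S

/-- A nonempty set `S` of transvections, presented by `v` and `φ`, which is nondegenerate and
strongly connected. Such a set generates a group acting irreducibly on `V(S)`. -/
structure IsIrreducibleSystem (S : Set (V ≃ₗ[K] V)) (v : (V ≃ₗ[K] V) → V)
    (φ : (V ≃ₗ[K] V) → Dual K V) : Prop where
  presentation : IsPresentation S v φ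
  nonempty : S.Nonempty
  connected : IsStronglyConnected S v φ
  nondegenerate : IsNondegenerate S

section Extension

variable [FiniteDimensional K V] {N : ℕ}

theorem exists_isIrreducibleSystem_of_finrank_leftKernel_le (hv : IsPresentation T v φ)
    (hd : IsDense T) (hN : IsLocallyNondegenerate T N) (m : ℕ) {S} (hS : S ⊆ T) (hne : S.Nonempty)
    (hconn : IsStronglyConnected S v φ) (hker : finrank K (leftKernel S) ≤ m)
    (hcard : S.encard + m ≤ N) :
    ∃ S' ⊆ T, S ⊆ S' ∧ IsIrreducibleSystem S' v φ ∧ S'.encard ≤ S.encard + m := by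
  have hSN : S.encard ≤ N := le_self_add.trans hcard
  by_cases hw : IsWeaklyNondegenerate S
  · exact ⟨S, hS, le_rfl, ⟨hv.mono hS, hne, hconn, hN S hS hSN hw⟩, le_self_add⟩
  obtain ⟨hleft, hright⟩ := not_or.1 hw
  simp only [ZeroLeftKernel, ZeroRightKernel, not_forall] at hleft hright
  obtain ⟨x, hx, hφx, hx0⟩ := hleft
  obtain ⟨ψ, hψ, hψS, hψ0⟩ := hright
  have hvS := hv.mono hS
  obtain ⟨t, ht, htx, hψt⟩ := hv.exists_covec_ne_and_apply_vec_ne hd hx0 hψ0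
  have htS : insert t S ⊆ T := Set.insert_subset ht hS
  obtain ⟨s, hs, hst⟩ : ∃ s ∈ S, φ t (v s) ≠ 0 := by
    by_contra! hc
    exact htx ((hvS.forall_vecSpan_iff (φ t)).2 hc x hx)
  obtain ⟨s', hs', hts'⟩ : ∃ s ∈ S, φ s (v t) ≠ 0 := by
    by_contra! hc
    exact hψt ((hvS.forall_covecSpan_iff (v t)).2 hc ψ hψ)
  have hlt := Submodule.finrank_lt_finrank_of_lt ((hv.mono htS).leftKernel_insert_lt
    ⟨hx, (Submodule.mem_dualCoannihilator x).2 hφx⟩ htx hψ hψS hψt)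
  obtain ⟨m, rfl⟩ : ∃ m', m = m' + 1 := ⟨m - 1, by omega⟩
  have hins : (insert t S).encard + m ≤ S.encard + (m + 1 : ℕ) := by
    push_cast
    rw [add_comm (m : ℕ∞), ← add_assoc]
    gcongr
    exact Set.encard_insert_le S t
  obtain ⟨S', hS'T, hSS', hS', hcard'⟩ := exists_isIrreducibleSystem_of_finrank_leftKernel_le hv hd
    hN m htS ⟨t, .inl rfl⟩ (hconn.insert_vertex hs hs' hst hts') (by omega) (hins.trans hcard)
  exact ⟨S', hS'T, (Set.subset_insert t S).trans hSS', hS', hcard'.trans hins⟩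

theorem exists_isIrreducibleSystem_mem (hv : IsPresentation T v φ) (hd : IsDense T)
    (hN : IsLocallyNondegenerate T N) (h2N : 2 ≤ N) {t : V ≃ₗ[K] V} (ht : t ∈ T) :
    ∃ S ⊆ T, t ∈ S ∧ IsIrreducibleSystem S v φ ∧ S.encard ≤ 2 := by
  have htT : {t} ⊆ T := Set.singleton_subset_iff.2 ht
  have hcard : Set.encard {t} + (1 : ℕ) = 2 := by rw [Set.encard_singleton]; norm_num
  obtain ⟨S, hST, htS, hS, hS2⟩ := exists_isIrreducibleSystem_of_finrank_leftKernel_le hv hd hN 1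
    htT ⟨t, rfl⟩ (isStronglyConnected_singleton t) (hv.mono htT).finrank_leftKernel_singleton_le
    (by rw [hcard]; exact_mod_cast h2N)
  exact ⟨S, hST, htS rfl, hS, hcard ▸ hS2⟩

theorem IsIrreducibleSystem.exists_extend_mem (hS : IsIrreducibleSystem S v φ)
    (hv : IsPresentation T v φ) (hd : IsDense T) (hN : IsLocallyNondegenerate T N) (hST : S ⊆ T)
    {t : V ≃ₗ[K] V} (ht : t ∈ T) (hcard : S.encard + 6 ≤ N) :
    ∃ S' ⊆ T, S ⊆ S' ∧ t ∈ S' ∧ IsIrreducibleSystem S' v φ ∧ S'.encard ≤ S.encard + 6 := by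
  obtain ⟨s, hs⟩ := hS.nonempty
  obtain ⟨r, hr, hsr, hrt⟩ := hv.exists_link hd (hST hs) ht
  obtain ⟨r', hr', htr', hr's⟩ := hv.exists_link hd ht (hST hs)
  have h₁T : insert r' S ⊆ T := Set.insert_subset hr' hST
  have h₂T : insert r (insert r' S) ⊆ T := Set.insert_subset hr h₁T
  have h₃T : insert t (insert r (insert r' S)) ⊆ T := Set.insert_subset ht h₂T
  have hker : finrank K (leftKernel (insert t (insert r (insert r' S)))) ≤ 3 := by
    have h₀ : finrank K (leftKernel S) = 0 := by
      rw [zeroLeftKernel_iff.1 hS.nondegenerate.1, finrank_bot]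
    have h₁ := (hv.mono h₁T).finrank_leftKernel_insert_le
    have h₂ := (hv.mono h₂T).finrank_leftKernel_insert_le
    have h₃ := (hv.mono h₃T).finrank_leftKernel_insert_le
    omega
  have hins : (insert t (insert r (insert r' S))).encard + (3 : ℕ) ≤ S.encard + 6 := by
    have h₁ := Set.encard_insert_le S r'
    have h₂ := (Set.encard_insert_le (insert r' S) r).trans (add_le_add_left h₁ 1)
    have h₃ := (Set.encard_insert_le (insert r (insert r' S)) t).trans (add_le_add_left h₂ 1)
    calc _ ≤ S.encard + 1 + 1 + 1 + (3 : ℕ) := by gcongr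
      _ = S.encard + 6 := by push_cast; ring
  obtain ⟨S', hS'T, hSS', hS', hcard'⟩ := exists_isIrreducibleSystem_of_finrank_leftKernel_le hv hd
    hN 3 h₃T ⟨t, .inl rfl⟩ (hS.connected.insert_path hs hsr hrt htr' hr's) hker
    (hins.trans hcard)
  exact ⟨S', hS'T, fun a ha => hSS' (.inr (.inr (.inr ha))), hSS' (.inl rfl), hS',
    hcard'.trans hins⟩

theorem IsIrreducibleSystem.exists_extend (hS : IsIrreducibleSystem S v φ)
    (hv : IsPresentation T v φ) (hd : IsDense T) (hN : IsLocallyNondegenerate T N) (hST : S ⊆ T)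
    (A : Finset (V ≃ₗ[K] V)) (hA : (A : Set (V ≃ₗ[K] V)) ⊆ T)
    (hcard : S.encard + (6 * A.card : ℕ) ≤ N) :
    ∃ S' ⊆ T, S ⊆ S' ∧ ↑A ⊆ S' ∧ IsIrreducibleSystem S' v φ ∧
      S'.encard ≤ S.encard + (6 * A.card : ℕ) := by
  classical
  induction A using Finset.induction_on with
  | empty => exact ⟨S, hST, le_rfl, by simp, hS, by simp⟩
  | insert t A htA ih =>
    rw [Finset.card_insert_of_notMem htA, mul_add_one, Nat.cast_add, ← add_assoc] at hcard ⊢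
    rw [Finset.coe_insert, Set.insert_subset_iff] at hA
    obtain ⟨S₁, hS₁T, hSS₁, hAS₁, hS₁, hcard₁⟩ := ih hA.2 (le_self_add.trans hcard)
    have hcard₁' : S₁.encard + 6 ≤ S.encard + (6 * A.card : ℕ) + (6 : ℕ) := by
      gcongr; rfl
    obtain ⟨S₂, hS₂T, hS₁S₂, htS₂, hS₂, hcard₂⟩ :=
      hS₁.exists_extend_mem hv hd hN hS₁T hA.1 (hcard₁'.trans hcard)
    refine ⟨S₂, hS₂T, hSS₁.trans hS₁S₂, ?_, hS₂, hcard₂.trans hcard₁'⟩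
    rw [Finset.coe_insert]
    exact Set.insert_subset htS₂ (hAS₁.trans hS₁S₂)

end Extension

end Presentations

section SymplecticForms

section CommutatorAction

variable {G : Subgroup (V ≃ₗ[K] V)}

/-- The group `G | [V, G]`. -/
abbrev commutatorAction (G : Subgroup (V ≃ₗ[K] V)) :
    Subgroup (commutatorSpace G ≃ₗ[K] commutatorSpace G) :=
  restrict G (commutatorSpace G)

theorem apply_sub_mem_commutatorSpace {g : V ≃ₗ[K] V} (hg : g ∈ G) (x : V) :
    g x - x ∈ commutatorSpace G :=
  Submodule.subset_span ⟨g, hg, x, rfl⟩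

theorem apply_mem_commutatorSpace {g : V ≃ₗ[K] V} (hg : g ∈ G) {x : V}
    (hx : x ∈ commutatorSpace G) : g x ∈ commutatorSpace G := by
  rw [← sub_add_cancel (g x) x]
  exact Submodule.add_mem _ (apply_sub_mem_commutatorSpace hg x) hx

theorem exists_mem_commutatorAction {g : V ≃ₗ[K] V} (hg : g ∈ G) :
    ∃ h ∈ commutatorAction G, ∀ w, (h w : V) = g w := by
  let A : commutatorSpace G →ₗ[K] commutatorSpace G :=
    (g : V →ₗ[K] V).restrict fun x hx => apply_mem_commutatorSpace hg hx
  let B : commutatorSpace G →ₗ[K] commutatorSpace G :=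
    ((g⁻¹ : V ≃ₗ[K] V) : V →ₗ[K] V).restrict
      fun x hx => apply_mem_commutatorSpace (G.inv_mem hg) hx
  have hAB : A ∘ₗ B = LinearMap.id := by ext x; exact g.apply_symm_apply x
  have hBA : B ∘ₗ A = LinearMap.id := by ext x; exact g.symm_apply_apply x
  exact ⟨LinearEquiv.ofLinearMap A B hAB hBA, ⟨g, hg, fun w => rfl⟩, fun w => rfl⟩

theorem isIrreducibleGroup_commutatorAction (hne : commutatorSpace G ≠ ⊥)
    (h : ∀ W ≤ commutatorSpace G, W ≠ ⊥ → (∀ g ∈ G, ∀ x ∈ W, g x ∈ W) → commutatorSpace G ≤ W) :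
    IsIrreducibleGroup (commutatorAction G) := by
  refine ⟨Submodule.nontrivial_iff_ne_bot.2 hne, fun W hW => or_iff_not_imp_left.2 fun hW0 => ?_⟩
  have hinv : ∀ g ∈ G, ∀ x ∈ W.map (commutatorSpace G).subtype,
      g x ∈ W.map (commutatorSpace G).subtype := by
    rintro g hg _ ⟨w, hw, rfl⟩
    obtain ⟨g', hg', hgg'⟩ := exists_mem_commutatorAction hg
    exact ⟨g' w, hW g' hg' w hw, hgg' w⟩
  have hle := h _ (Submodule.map_subtype_le _ W)
    (by simpa using (Submodule.map_injective_of_injective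
      (commutatorSpace G).injective_subtype).ne hW0) hinv
  rw [eq_top_iff]
  rintro y -
  obtain ⟨z, hz, hzy⟩ := hle y.2
  rwa [← Subtype.ext hzy]

end CommutatorAction

variable {S T : Set (V ≃ₗ[K] V)} {v : (V ≃ₗ[K] V) → V} {φ : (V ≃ₗ[K] V) → Dual K V}

namespace IsIrreducibleSystem

theorem exists_covec_ne (hS : IsIrreducibleSystem S v φ) {x : V} (hx : x ∈ vecSpan S)
    (hx0 : x ≠ 0) : ∃ t ∈ S, φ t x ≠ 0 := by
  by_contra! hc
  exact hx0 (hS.nondegenerate.1 x hx ((hS.presentation.forall_covecSpan_iff x).2 hc))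

theorem exists_apply_vec_ne (hS : IsIrreducibleSystem S v φ) {s : V ≃ₗ[K] V} (hs : s ∈ S) :
    ∃ t ∈ S, φ s (v t) ≠ 0 := by
  by_contra! hc
  exact (hS.presentation s hs).covec_ne (hS.nondegenerate.2 _ (hS.presentation.covec_mem hs)
    ((hS.presentation.forall_vecSpan_iff _).2 hc))

theorem two_le_finrank [FiniteDimensional K V] (hS : IsIrreducibleSystem S v φ) :
    2 ≤ finrank K (commutatorSpace (Subgroup.closure S)) := by
  obtain ⟨s, hs⟩ := hS.nonempty
  obtain ⟨t, ht, hst⟩ := hS.exists_apply_vec_ne hs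
  have hli : LinearIndependent K ![v s, v t] := by
    rw [LinearIndependent.pair_iff]
    intro a b hab
    have hb : b = 0 := by
      simpa [(hS.presentation s hs).apply_self, hst] using congrArg (φ s) hab
    exact ⟨by simpa [hb, (hS.presentation s hs).vec_ne] using hab, hb⟩
  have hle : Submodule.span K (Set.range ![v s, v t]) ≤ vecSpan S := by
    rw [Submodule.span_le, Set.range_subset_iff, Fin.forall_fin_two]
    exact ⟨hS.presentation.vec_mem hs, hS.presentation.vec_mem ht⟩
  rw [hS.presentation.commutatorSpace_eq]
  simpa [finrank_span_eq_card hli] using Submodule.finrank_mono hle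

theorem isIrreducibleGroup (hS : IsIrreducibleSystem S v φ) :
    IsIrreducibleGroup (commutatorAction (Subgroup.closure S)) := by
  have hv := hS.presentation
  obtain ⟨s, hs⟩ := hS.nonempty
  apply isIrreducibleGroup_commutatorAction <;> rw [hv.commutatorSpace_eq]
  · exact Submodule.ne_bot_iff _ |>.2 ⟨v s, hv.vec_mem hs, (hv s hs).vec_ne⟩
  intro W hW hW0 hinv
  have hstep : ∀ t ∈ S, ∀ x ∈ W, φ t x ≠ 0 → v t ∈ W := fun t ht _ =>
    hv.vec_mem_of_covec_ne ht (hinv t (Subgroup.subset_closure ht))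
  obtain ⟨x, hx, hx0⟩ := Submodule.exists_mem_ne_zero_of_ne_bot hW0
  obtain ⟨t, ht, htx⟩ := hS.exists_covec_ne (hW hx) hx0
  rw [hv.vecSpan_eq, Submodule.span_le]
  rintro _ ⟨r, hr, rfl⟩
  have hpath := hS.connected t ht r hr
  clear hr
  induction hpath with
  | refl => exact hstep t ht x hx htx
  | tail _ hab ha => exact hstep _ hab.1 _ ha hab.2

end IsIrreducibleSystem

/-- The matrix `φ s (v t)` with `s, t` in `S` becomes skew-symmetric when its rows are scaled
suitably. -/
def IsSkewSymmetrizable (S : Set (V ≃ₗ[K] V)) (v : (V ≃ₗ[K] V) → V)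
    (φ : (V ≃ₗ[K] V) → Dual K V) : Prop :=
  ∃ μ : (V ≃ₗ[K] V) → K, (∀ s ∈ S, μ s ≠ 0) ∧
    ∀ s ∈ S, ∀ t ∈ S, μ s * φ s (v t) = -(μ t * φ t (v s))

theorem IsSkewSymmetrizable.mono (h : IsSkewSymmetrizable T v φ) (hS : S ⊆ T) :
    IsSkewSymmetrizable S v φ := by
  obtain ⟨μ, hμ0, hμ⟩ := h
  exact ⟨μ, fun s hs => hμ0 s (hS hs), fun s hs t ht => hμ s (hS hs) t (hS ht)⟩

theorem IsIrreducibleSystem.isSkewSymmetrizable (hS : IsIrreducibleSystem S v φ)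
    (h : PreservesSymplecticForm (commutatorAction (Subgroup.closure S))) :
    IsSkewSymmetrizable S v φ := by
  have hv := hS.presentation
  obtain ⟨B, hBalt, hBnd, hBinv⟩ := h
  have hmem : ∀ s ∈ S, v s ∈ commutatorSpace (Subgroup.closure S) := fun s hs => by
    rw [hv.commutatorSpace_eq]; exact hv.vec_mem hs
  have hprop : ∀ s, ∀ hs : s ∈ S, ∃ μ : K, μ ≠ 0 ∧ ∀ y, B ⟨v s, hmem s hs⟩ y = μ * φ s y := by
    intro s hs
    set u : commutatorSpace (Subgroup.closure S) := ⟨v s, hmem s hs⟩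
    obtain ⟨g, hg, hgs⟩ := exists_mem_commutatorAction (Subgroup.subset_closure hs)
    have hgx : ∀ x, g x = x + φ s x • u := fun x => by
      ext; rw [hgs, (hv s hs).apply]; rfl
    have hsymm : ∀ x y : commutatorSpace (Subgroup.closure S),
        φ s x * B u y = φ s y * B u x := by
      intro x y
      have hinv := hBinv g hg x y
      simp only [hgx, map_add, map_smul, LinearMap.add_apply, LinearMap.smul_apply, smul_eq_mul,
        hBalt u] at hinv
      linear_combination hinv + φ s y * LinearMap.IsAlt.neg hBalt x u
    obtain ⟨t, ht, hst⟩ := hS.exists_apply_vec_ne hs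
    have hform : ∀ y : commutatorSpace (Subgroup.closure S),
        B u y = B u ⟨v t, hmem t ht⟩ / φ s (v t) * φ s y := fun y => by
      field_simp
      linear_combination hsymm ⟨v t, hmem t ht⟩ y
    refine ⟨_, fun h0 => (hv s hs).vec_ne (congrArg Subtype.val (hBnd.1 u fun y => ?_)), hform⟩
    rw [hform, h0, zero_mul]
  choose! μ hμ0 hμ using hprop
  refine ⟨μ, hμ0, fun s hs t ht => ?_⟩
  rw [← hμ s hs ⟨v t, hmem t ht⟩, ← hμ t ht ⟨v s, hmem s hs⟩, LinearMap.IsAlt.neg hBalt]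

theorem isSkewSymmetrizable_of_forall_card_le_five (hv : IsPresentation T v φ) (hd : IsDense T)
    (h : ∀ A : Finset (V ≃ₗ[K] V), ↑A ⊆ T → A.card ≤ 5 → IsSkewSymmetrizable (A : Set _) v φ) :
    IsSkewSymmetrizable T v φ := by
  classical
  obtain rfl | ⟨t₀, ht₀⟩ := T.eq_empty_or_nonempty
  · exact ⟨0, by simp, by simp⟩
  choose! r hrT hr₀ hrt using fun t (ht : t ∈ T) => hv.exists_link hd ht₀ ht
  -- The value at `t` of any scaling of `{t₀, t, r t}` normalised by the value `1` at `t₀`.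
  let μ : (V ≃ₗ[K] V) → K := fun t =>
    φ (r t) (v t) * φ t₀ (v (r t)) / (φ t (v (r t)) * φ (r t) (v t₀))
  have hμ : ∀ s ∈ T, ∀ t ∈ T, μ s ≠ 0 ∧ μ s * φ s (v t) = -(μ t * φ t (v s)) := by
    intro s hs t ht
    let A : Finset (V ≃ₗ[K] V) := {t₀, s, t, r s, r t}
    have hAT : ↑A ⊆ T := by
      simp only [A, Finset.coe_insert, Finset.coe_singleton, Set.insert_subset_iff,
        Set.singleton_subset_iff]
      exact ⟨ht₀, hs, ht, hrT s hs, hrT t ht⟩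
    obtain ⟨ν, hν0, hν⟩ := h A hAT Finset.card_le_five
    have hμν : ∀ u ∈ T, u ∈ A → r u ∈ A → μ u = ν u / ν t₀ := by
      intro u hu huA hruA
      have h₁ := hν u huA (r u) hruA
      have h₂ := hν t₀ (by simp [A]) (r u) hruA
      have := hr₀ u hu
      have := hrt u hu
      have := hν0 t₀ (by simp [A])
      have := hν0 _ hruA
      simp only [μ]
      rw [div_eq_div_iff (by positivity) (by positivity)]
      apply mul_left_cancel₀ this
      linear_combination φ (r u) (v u) * ν (r u) * h₂ - φ (r u) (v t₀) * ν (r u) * h₁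
    have h₀ := hν0 t₀ (by simp [A])
    rw [hμν s hs (by simp [A]) (by simp [A]), hμν t ht (by simp [A]) (by simp [A])]
    refine ⟨div_ne_zero (hν0 s (by simp [A])) h₀, ?_⟩
    have := hν s (by simp [A]) t (by simp [A])
    field_simp
    exact this
  exact ⟨μ, fun s hs => (hμ s hs s hs).1, fun s hs t ht => (hμ s hs t ht).2⟩

section Forms

variable {ι : Type*} {u : ι → V} {χ : ι → Dual K V}

theorem exists_isAlt_of_skew (hspan : Submodule.span K (Set.range u) = ⊤)
    (hself : ∀ i, χ i (u i) = 0) (hskew : ∀ i j, χ i (u j) = -χ j (u i)) :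
    ∃ B : LinearMap.BilinForm K V, B.IsAlt ∧ ∀ i, B (u i) = χ i := by
  have hsurj : LinearMap.range (Finsupp.linearCombination K u) = ⊤ := by
    rw [Finsupp.range_linearCombination, hspan]
  obtain ⟨C, hC⟩ := LinearMap.exists_rightInverse_of_surjective _ hsurj
  let B : LinearMap.BilinForm K V := Finsupp.linearCombination K χ ∘ₗ C
  have hpair : ∀ (a : ι →₀ K) (j : ι),
      Finsupp.linearCombination K χ a (u j) = -χ j (Finsupp.linearCombination K u a) := by
    intro a j
    induction a using Finsupp.induction_linear with
    | zero => simp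
    | add a b ha hb => simp only [map_add, LinearMap.add_apply, ha, hb, neg_add]
    | single i c => simp [hskew i j]
  have hB_right : ∀ x j, B x (u j) = -χ j x := fun x j => by
    rw [LinearMap.comp_apply, hpair]
    exact congrArg (-χ j ·) (LinearMap.congr_fun hC x)
  have hB_left : ∀ i, B (u i) = χ i := fun i =>
    LinearMap.ext_on_range hspan fun j => by rw [hB_right, hskew i j]
  have hB_skew : ∀ x y, B x y = -B y x := fun x y => by
    have : B x = -LinearMap.flip B x :=
      LinearMap.ext_on_range hspan fun j => by simp [hB_right, hB_left]
    simpa using LinearMap.congr_fun this y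
  refine ⟨B, fun x => ?_, hB_left⟩
  induction (hspan ▸ Submodule.mem_top : x ∈ Submodule.span K (Set.range u))
    using Submodule.span_induction with
  | mem y hy => obtain ⟨i, rfl⟩ := hy; rw [hB_left, hself]
  | zero => simp
  | add a b _ _ ha hb => simp [ha, hb, hB_skew a b]
  | smul c a _ ha => simp [ha]

end Forms

theorem IsPresentation.vecSpan_eq_top [Nontrivial V] (hv : IsPresentation T v φ)
    (hd : IsDense T) : vecSpan T = ⊤ := by
  by_contra hne
  obtain ⟨ψ, hψ, hψT⟩ := Submodule.exists_le_ker_of_lt_top _ (lt_top_iff_ne_top.2 hne)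
  obtain ⟨x, hx⟩ := exists_ne (0 : V)
  obtain ⟨t, ht, -, hψt⟩ := hv.exists_covec_ne_and_apply_vec_ne hd hx hψ
  exact hψt (hψT (hv.vec_mem ht))

theorem apply_apply_of_mem_closure {B : LinearMap.BilinForm K V}
    (hB : ∀ t ∈ T, ∀ x y, B (t x) (t y) = B x y) {g : V ≃ₗ[K] V} (hg : g ∈ Subgroup.closure T)
    (x y : V) : B (g x) (g y) = B x y := by
  induction hg using Subgroup.closure_induction generalizing x y with
  | mem t ht => exact hB t ht x y
  | one => rfl
  | mul a b _ _ ha hb => rw [LinearEquiv.mul_apply, LinearEquiv.mul_apply, ha, hb]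
  | inv a _ ha =>
    have hax : ∀ z, a (a⁻¹ z) = z := a.apply_symm_apply
    rw [← ha, hax, hax]

theorem IsSkewSymmetrizable.preservesSymplecticForm [Nontrivial V] (h : IsSkewSymmetrizable T v φ)
    (hv : IsPresentation T v φ) (hd : IsDense T) :
    PreservesSymplecticForm (Subgroup.closure T) := by
  obtain ⟨μ, hμ0, hμ⟩ := h
  have hspan : Submodule.span K (Set.range fun t : T => v t) = ⊤ := by
    rw [← Set.image_eq_range, ← hv.vecSpan_eq, hv.vecSpan_eq_top hd]
  obtain ⟨B, hBalt, hB⟩ := exists_isAlt_of_skew (χ := fun t : T => μ t • φ t) hspan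
    (fun t => by simp [(hv t t.2).apply_self]) (fun s t => by simpa using hμ s s.2 t t.2)
  have hB_left : ∀ t ∈ T, ∀ x, B (v t) x = μ t * φ t x := fun t ht x => by
    rw [hB ⟨t, ht⟩]; rfl
  have hB_right : ∀ t ∈ T, ∀ x, B x (v t) = -(μ t * φ t x) := fun t ht x => by
    rw [← LinearMap.IsAlt.neg hBalt, hB_left t ht]
  refine ⟨B, hBalt, hBalt.isRefl.nondegenerate_iff_separatingLeft.2 fun x hx => ?_, fun g hg =>
    apply_apply_of_mem_closure (fun t ht x y => ?_) hg⟩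
  · by_contra hx0
    obtain ⟨ψ, hψ⟩ : ∃ ψ : Dual K V, ψ x ≠ 0 := by
      by_contra! h; exact hx0 ((Module.forall_dual_apply_eq_zero_iff K x).1 h)
    obtain ⟨t, ht, htx, -⟩ := hv.exists_covec_ne_and_apply_vec_ne hd hx0
      (ψ := ψ) (fun h => hψ (by simp [h]))
    have := hB_right t ht x
    rw [hx, zero_eq_neg] at this
    exact mul_ne_zero (hμ0 t ht) htx this
  · simp only [(hv t ht).apply, map_add, map_smul, LinearMap.add_apply, LinearMap.smul_apply,
      smul_eq_mul, hB_left t ht, hB_right t ht, (hv t ht).apply_self]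
    ring

section SumZero

theorem mem_sumZero {m : ℕ} {x : Fin m → K} : x ∈ sumZero K m ↔ ∑ i, x i = 0 := by
  simp [sumZero, LinearMap.sum_apply]

variable [CharP K 2] {m : ℕ}

theorem single_add_single_mem_sumZero (i j : Fin m) :
    Pi.single i 1 + Pi.single j 1 ∈ sumZero K m := by
  simp [mem_sumZero, Finset.sum_add_distrib, CharTwo.add_self_eq_zero]

theorem sumZero_eq_zero_of_forall_dotProduct (hm : Odd m) {x : Fin m → K} (hx : x ∈ sumZero K m)
    (h : ∀ y ∈ sumZero K m, x ⬝ᵥ y = 0) : x = 0 := by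
  have hconst : ∀ i j, x j = x i := fun i j => by
    have := h _ (single_add_single_mem_sumZero i j)
    rw [dotProduct_add, dotProduct_single_one, dotProduct_single_one] at this
    exact (CharTwo.add_eq_zero.1 this).symm
  have hm1 : (m : K) = 1 := natCast_eq_one_of_odd_of_two_eq_zero hm CharTwo.two_eq_zero
  ext i
  simpa [hconst i, hm1] using mem_sumZero.1 hx

theorem dotProduct_self_of_mem_sumZero {x : Fin m → K} (hx : x ∈ sumZero K m) : x ⬝ᵥ x = 0 := by
  simp only [dotProduct, ← sq, ← CharTwo.sum_sq, mem_sumZero.1 hx]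
  exact zero_pow two_ne_zero

end SumZero

theorem HasOddSymmetricType.preservesSymplecticForm {G : Subgroup (V ≃ₗ[K] V)}
    (h : HasOddSymmetricType G) : PreservesSymplecticForm G := by
  obtain ⟨_, m, -, hm, e, he⟩ := h
  let ε : V →ₗ[K] Fin m → K := (sumZero K m).subtype ∘ₗ e
  have hε : ∀ x, ε x ∈ sumZero K m := fun x => (e x).2
  let B : LinearMap.BilinForm K V := (dotProductBilin K K).compl₁₂ ε ε
  have hB : ∀ x y, B x y = ε x ⬝ᵥ ε y := fun _ _ => rfl
  have hBalt : B.IsAlt := fun x => dotProduct_self_of_mem_sumZero (hε x)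
  refine ⟨B, hBalt, hBalt.isRefl.nondegenerate_iff_separatingLeft.2 fun x hx => ?_,
    fun g hg x y => ?_⟩
  · refine e.map_eq_zero_iff.1 (Subtype.ext (sumZero_eq_zero_of_forall_dotProduct hm (hε x) ?_))
    intro y hy
    simpa [hB, ε] using hx (e.symm ⟨y, hy⟩)
  · obtain ⟨σ, hσ⟩ := (he g).1 hg
    have hσ' : ∀ x, ε (g x) ∘ σ = ε x := fun x => funext (hσ x)
    rw [hB, hB, ← hσ' x, ← hσ' y, comp_equiv_dotProduct_comp_equiv]

end SymplecticForms

section Frames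

variable {ι κ : Type*}

/-- The families `e` of vectors and `f` of covectors are dual to each other. The pairs
`(e i, f i)` are the vertices of the frame. -/
structure IsFrame (e : ι → V) (f : ι → Dual K V) : Prop where
  self : ∀ i, f i (e i) = 1
  ne : ∀ i j, i ≠ j → f i (e j) = 0

/-- `t` is the transvection `1 + (e i + c e j) ⊗ (f i + c⁻¹ f j)`; in characteristic two it
interchanges the lines of `e i` and `e j`. -/
structure IsEdge (e : ι → V) (f : ι → Dual K V) (i j : ι) (c : K) (t : V ≃ₗ[K] V) : Prop where
  index_ne : i ≠ j
  gain_ne : c ≠ 0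
  apply : ∀ x, t x = x + (f i + c⁻¹ • f j) x • (e i + c • e j)

/-- `t` is an edge of the frame `e, f`, with unspecified ends. -/
def IsEdgeOf (e : ι → V) (f : ι → Dual K V) (t : V ≃ₗ[K] V) : Prop :=
  ∃ i j c, IsEdge e f i j c t

/-- `s` and `t` are edges of the frame `e, f` that join the same two vertices. -/
def IsParallel (e : ι → V) (f : ι → Dual K V) (s t : V ≃ₗ[K] V) : Prop :=
  ∃ i j c c', IsEdge e f i j c s ∧ IsEdge e f i j c' t

variable {e : ι → V} {f : ι → Dual K V} {i j k l m : ι} {c c' d : K} {p r s t : V ≃ₗ[K] V}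
  {u v w z : V} {φ ψ χ ω : Dual K V}

namespace IsFrame

theorem vec_ne (hF : IsFrame e f) (i : ι) : e i ≠ 0 := fun h => by
  have := hF.self i
  simp [h] at this

theorem covec_ne (hF : IsFrame e f) (i : ι) : f i ≠ 0 := fun h => by
  have := hF.self i
  simp [h] at this

theorem linearIndependent (hF : IsFrame e f) : LinearIndependent K e := by
  rw [linearIndependent_iff']
  intro s g hg i hi
  have := congrArg (f i) hg
  rw [map_sum, Finset.sum_eq_single_of_mem i hi fun j _ hj => by simp [hF.ne i j hj.symm]] at this
  simpa [hF.self] using this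

theorem index_eq (hF : IsFrame e f) {x : V} {a : K} (hx : x = a • e m) (hi : f i x ≠ 0) :
    i = m := by
  by_contra h
  exact hi (by rw [hx, map_smul, hF.ne i m h, smul_zero])

theorem apply_sum [Fintype ι] (hF : IsFrame e f) (a : ι → K) (i : ι) :
    f i (∑ j, a j • e j) = a i := by
  rw [map_sum, Fintype.sum_eq_single i fun j hj => by rw [map_smul, hF.ne i j hj.symm, smul_zero],
    map_smul, hF.self, smul_eq_mul, mul_one]

theorem dual_ext [Finite ι] (hF : IsFrame e f) (h : ∀ i, φ (e i) = ψ (e i))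
    (h0 : ∀ x, (∀ i, f i x = 0) → φ x = ψ x) : φ = ψ := by
  classical
  have := Fintype.ofFinite ι
  ext x
  have hx : ∀ i, f i (x - ∑ j, f j x • e j) = 0 := fun i => by
    rw [map_sub, hF.apply_sum, sub_self]
  simpa [h] using h0 _ hx

theorem edge_apply_edge (hF : IsFrame e f) (hij : i ≠ j) :
    (f i + c'⁻¹ • f j) (e i + c • e j) = 1 + c'⁻¹ * c := by
  simp [hF.self, hF.ne i j hij, hF.ne j i hij.symm]

theorem edge_apply_self [CharP K 2] (hF : IsFrame e f) (hij : i ≠ j) (hc : c ≠ 0) :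
    (f i + c⁻¹ • f j) (e i + c • e j) = 0 := by
  rw [hF.edge_apply_edge hij, inv_mul_cancel₀ hc, CharTwo.add_self_eq_zero]

theorem edge_apply_edge_of_ne (hF : IsFrame e f) (hij : i ≠ j) (hik : i ≠ k) (hjk : j ≠ k) :
    (f i + c'⁻¹ • f k) (e i + c • e j) = 1 := by
  simp [hF.self, hF.ne i j hij, hF.ne k i hik.symm, hF.ne k j hjk.symm]

theorem edge_apply_edge_eq_zero (hF : IsFrame e f) (hik : i ≠ k) (hil : i ≠ l) (hjk : j ≠ k)
    (hjl : j ≠ l) : (f k + c'⁻¹ • f l) (e i + c • e j) = 0 := by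
  simp [hF.ne k i hik.symm, hF.ne l i hil.symm, hF.ne k j hjk.symm, hF.ne l j hjl.symm]

theorem exists_isEdge [CharP K 2] (hF : IsFrame e f) (hij : i ≠ j) (hc : c ≠ 0) :
    ∃ t : V ≃ₗ[K] V, IsEdge e f i j c t :=
  have h := hF.edge_apply_self hij hc
  ⟨LinearEquiv.transvection h, hij, hc, LinearEquiv.transvection.apply h⟩

end IsFrame

namespace IsEdge

theorem isEdgeOf (h : IsEdge e f i j c t) : IsEdgeOf e f t := ⟨i, j, c, h⟩

theorem symm (h : IsEdge e f i j c t) : IsEdge e f j i c⁻¹ t := by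
  have hc := h.gain_ne
  refine ⟨h.index_ne.symm, inv_ne_zero hc, fun x => ?_⟩
  have hf : f j + c⁻¹⁻¹ • f i = c • (f i + c⁻¹ • f j) := by
    rw [smul_add, smul_inv_smul₀ hc, inv_inv, add_comm]
  have he : e j + c⁻¹ • e i = c⁻¹ • (e i + c • e j) := by
    rw [smul_add, inv_smul_smul₀ hc, add_comm]
  rw [h.apply, hf, he, LinearMap.smul_apply, smul_smul, smul_eq_mul, mul_right_comm,
    mul_inv_cancel₀ hc, one_mul]

theorem eq_of_gain (hs : IsEdge e f i j c s) (ht : IsEdge e f i j c t) : s = t := by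
  ext x
  rw [hs.apply, ht.apply]

theorem exists_left (h : IsEdge e f i j c t) (hm : i = m ∨ j = m) :
    ∃ k c', IsEdge e f m k c' t := by
  rcases hm with rfl | rfl
  · exact ⟨_, _, h⟩
  · exact ⟨_, _, h.symm⟩

theorem apply_of_ne (hF : IsFrame e f) (h : IsEdge e f i j c t) (hi : k ≠ i) (hj : k ≠ j) :
    t (e k) = e k := by
  rw [h.apply]
  simp [hF.ne i k hi.symm, hF.ne j k hj.symm]

theorem along [CharP K 2] (hF : IsFrame e f) (h : IsEdge e f i j c t) :
    IsTransvectionAlong t (e i + c • e j) (f i + c⁻¹ • f j) := by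
  refine ⟨hF.edge_apply_self h.index_ne h.gain_ne, fun h0 => ?_, fun h0 => ?_, h.apply⟩
  · have := congrArg (f i) h0
    simp [hF.self, hF.ne i j h.index_ne] at this
  · have := LinearMap.congr_fun h0 (e i)
    simp [hF.self, hF.ne j i h.index_ne.symm] at this

theorem apply_left [CharP K 2] (hF : IsFrame e f) (h : IsEdge e f i j c t) : t (e i) = c • e j := by
  rw [h.apply]
  simp only [LinearMap.add_apply, LinearMap.smul_apply, hF.self, hF.ne j i h.index_ne.symm,
    smul_zero, add_zero, one_smul]
  rw [← add_assoc, ← two_smul K (e i), CharTwo.two_eq_zero, zero_smul, zero_add]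

theorem apply_right [CharP K 2] (hF : IsFrame e f) (h : IsEdge e f i j c t) : t (e j) = c⁻¹ • e i :=
  h.symm.apply_left hF

theorem exists_left_of_apply_ne (hF : IsFrame e f) (h : IsEdge e f i j c t)
    (ht : IsTransvectionAlong t u ψ) (hm : ψ (e m) ≠ 0) : ∃ k c', IsEdge e f m k c' t := by
  refine h.exists_left ?_
  by_contra! hne
  rw [ne_eq, ← ht.apply_eq_self_iff] at hm
  exact hm (h.apply_of_ne hF hne.1.symm hne.2.symm)

theorem eq_right_of_covec_ne (hF : IsFrame e f) (h : IsEdge e f i j c t)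
    (ht : IsTransvectionAlong t u ψ) (hk : f k u ≠ 0) (hki : k ≠ i) : k = j := by
  by_contra hkj
  refine hk (((IsRescaling.refl (e k) (f k)).apply_eq_zero_iff (ht.isRescaling h.apply)).1 ?_)
  simp [hF.ne k i hki, hF.ne k j hkj]

end IsEdge

namespace IsTransvectionAlong

theorem isEdge_of_apply_left [CharP K 2] [Finite ι] (ht : IsTransvectionAlong t (e i + c • e j) φ)
    (hF : IsFrame e f) (hmon : ∀ i, ∃ j, ∃ c : K, t (e i) = c • e j)
    (hfix : ∀ x, (∀ i, f i x = 0) → t x = x) (hij : i ≠ j) (hc : c ≠ 0) (hi : φ (e i) = 1) :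
    IsEdge e f i j c t := by
  have hj : φ (e j) = c⁻¹ := by
    have h0 := ht.apply_self
    rw [map_add, map_smul, hi, smul_eq_mul] at h0
    have h1 := CharTwo.add_eq_zero.1 h0
    exact eq_inv_of_mul_eq_one_right h1.symm
  have hk : ∀ k, k ≠ i → k ≠ j → φ (e k) = 0 := by
    intro k hki hkj
    by_contra hne
    obtain ⟨l, a, hl⟩ := hmon k
    rw [ht.apply] at hl
    have hil : i = l := hF.index_eq hl (by
      simpa [hF.self, hF.ne i k hki.symm, hF.ne i j hij] using hne)
    have hkl : k = l := hF.index_eq hl (by simp [hF.self, hF.ne k i hki, hF.ne k j hkj])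
    exact hki (hkl.trans hil.symm)
  suffices hφ : φ = f i + c⁻¹ • f j from ⟨hij, hc, hφ ▸ ht.apply⟩
  refine hF.dual_ext (fun k => ?_) fun x hx => ?_
  · by_cases hki : k = i
    · subst hki
      simp [hi, hF.self, hF.ne j k hij.symm]
    by_cases hkj : k = j
    · subst hkj
      simp [hj, hF.self, hF.ne i k hij]
    · simp [hk k hki hkj, hF.ne i k (Ne.symm hki), hF.ne j k (Ne.symm hkj)]
  · rw [ht.apply_eq_self_iff.1 (hfix x hx)]
    simp [hx]

theorem isEdgeOf [CharP K 2] [Finite ι] (ht : IsTransvectionAlong t v φ) (hF : IsFrame e f)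
    (hmon : ∀ i, ∃ j, ∃ c : K, t (e i) = c • e j)
    (hfix : ∀ x, (∀ i, f i x = 0) → t x = x) : IsEdgeOf e f t := by
  obtain ⟨i, hi⟩ : ∃ i, φ (e i) ≠ 0 := by
    by_contra! h0
    refine ht.covec_ne (hF.dual_ext h0 fun x hx => ?_)
    exact ht.apply_eq_self_iff.1 (hfix x hx)
  obtain ⟨j, c, hc⟩ := hmon i
  have hc0 : c ≠ 0 := fun h0 => hF.vec_ne i (by
    rw [h0, zero_smul] at hc
    exact t.map_eq_zero_iff.1 hc)
  have hv : φ (e i) • v = e i + c • e j := by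
    rw [← hc, ht.apply, ← add_assoc, ← two_smul K (e i), CharTwo.two_eq_zero, zero_smul, zero_add]
  have ht' := ht.rescale ⟨φ (e i), hi, rfl, rfl⟩
  rw [hv] at ht'
  have hij : i ≠ j := by
    rintro rfl
    have h0 := ht'.apply_self
    have hone : (φ (e i))⁻¹ • φ (e i) = 1 := by rw [smul_eq_mul, inv_mul_cancel₀ hi]
    rw [map_add, map_smul, LinearMap.smul_apply, hone, smul_eq_mul, mul_one] at h0
    exact ht'.vec_ne (by rw [← CharTwo.add_eq_zero.1 h0, one_smul, ← two_smul K (e i),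
      CharTwo.two_eq_zero, zero_smul])
  exact (ht'.isEdge_of_apply_left hF hmon hfix hij hc0 (by simp [hi])).isEdgeOf

end IsTransvectionAlong

section Uniqueness

variable (hF : IsFrame e f) (hvs : IsTransvectionAlong s v φ) (hvt : IsTransvectionAlong t u ψ)

include hF hvs hvt

theorem IsEdgeOf.exists_common (hs : IsEdgeOf e f s) (ht : IsEdgeOf e f t) (h : ψ v ≠ 0) :
    ∃ i j k c c', IsEdge e f i j c s ∧ IsEdge e f i k c' t := by
  obtain ⟨i, j, c, hs⟩ := hs
  obtain ⟨_, _, _, ht⟩ := ht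
  have hψ : ψ (e i + c • e j) ≠ 0 := by
    rwa [ne_eq, (IsRescaling.refl u ψ).apply_eq_zero_iff (hvs.isRescaling hs.apply)]
  by_cases hi : ψ (e i) = 0
  · have hj : ψ (e j) ≠ 0 := fun hj => hψ (by simp [hi, hj])
    obtain ⟨k, c', ht⟩ := ht.exists_left_of_apply_ne hF hvt hj
    exact ⟨j, i, k, _, _, hs.symm, ht⟩
  · obtain ⟨k, c', ht⟩ := ht.exists_left_of_apply_ne hF hvt hi
    exact ⟨i, j, k, _, _, hs, ht⟩

theorem IsEdge.apply_mul_apply_eq_one (hs : IsEdge e f i j c s) (ht : IsEdge e f i k c' t)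
    (hjk : j ≠ k) : ψ v * φ u = 1 := by
  rw [← (hvt.isRescaling ht.apply).apply_mul_apply (hvs.isRescaling hs.apply),
    hF.edge_apply_edge_of_ne hs.index_ne ht.index_ne hjk,
    hF.edge_apply_edge_of_ne ht.index_ne hs.index_ne hjk.symm, mul_one]

theorem IsEdgeOf.isParallel_of_mul_ne_one (hs : IsEdgeOf e f s) (ht : IsEdgeOf e f t)
    (h0 : ψ v ≠ 0) (h1 : ψ v * φ u ≠ 1) : IsParallel e f s t := by
  obtain ⟨i, j, k, c, c', hs, ht⟩ := hs.exists_common hF hvs hvt ht h0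
  by_cases hjk : j = k
  · exact ⟨i, j, c, c', hs, hjk ▸ ht⟩
  · exact absurd (hs.apply_mul_apply_eq_one hF hvs hvt ht hjk) h1

theorem IsEdge.eq_of_apply_eq_zero [CharP K 2] (hs : IsEdge e f i j c s) (ht : IsEdge e f i k c' t)
    (h : ψ v = 0) : s = t := by
  have hpair := ((hvt.isRescaling ht.apply).apply_eq_zero_iff (hvs.isRescaling hs.apply)).2 h
  by_cases hjk : j = k
  · subst hjk
    rw [hF.edge_apply_edge hs.index_ne, CharTwo.add_eq_zero] at hpair
    obtain rfl : c = c' := by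
      rw [← mul_one c', hpair, mul_inv_cancel_left₀ ht.gain_ne]
    exact hs.eq_of_gain ht
  · rw [hF.edge_apply_edge_of_ne hs.index_ne ht.index_ne hjk] at hpair
    exact absurd hpair one_ne_zero

theorem IsEdge.eq_or_eq_of_apply_ne (hs : IsEdge e f i j c s) (ht : IsEdge e f k l c' t)
    (hik : i ≠ k) (hjk : j ≠ k) (h : ψ v ≠ 0) : l = i ∨ l = j := by
  by_contra! hne
  refine h (((hvt.isRescaling ht.apply).apply_eq_zero_iff (hvs.isRescaling hs.apply)).1 ?_)
  exact hF.edge_apply_edge_eq_zero hik hne.1.symm hjk hne.2.symm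

theorem IsEdge.triple_eq_one (hvp : IsTransvectionAlong p w χ) (hs : IsEdge e f i j c s)
    (ht : IsEdge e f i k c' t) (hp : IsEdge e f i l d p) (hjk : j ≠ k) (hkl : k ≠ l) (hjl : j ≠ l) :
    φ u * ψ w * χ v = 1 := by
  rw [← (hvs.isRescaling hs.apply).apply_mul_apply_mul_apply (hvt.isRescaling ht.apply)
    (hvp.isRescaling hp.apply), hF.edge_apply_edge_of_ne ht.index_ne hs.index_ne hjk.symm,
    hF.edge_apply_edge_of_ne hp.index_ne ht.index_ne hkl.symm,
    hF.edge_apply_edge_of_ne hs.index_ne hp.index_ne hjl, mul_one, mul_one]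

theorem IsEdgeOf.isParallel_of_triple_ne [CharP K 2] (hvp : IsTransvectionAlong p w χ)
    (hvr : IsTransvectionAlong r z ω) (hs : IsEdgeOf e f s) (ht : IsEdgeOf e f t)
    (hp : IsEdgeOf e f p) (hr : IsEdgeOf e f r) (hst : ψ v ≠ 0) (hsp : χ v ≠ 0) (htp : χ u ≠ 0)
    (hrs : ω v = 0) (hrt : ω u = 0) (hrp : ω w ≠ 0)
    (hasym : φ u * ψ w * χ v ≠ ψ v * φ w * χ u) : IsParallel e f s t := by
  obtain ⟨i, j, k, c, c', hs, ht⟩ := hs.exists_common hF hvs hvt ht hst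
  by_cases hjk : j = k
  · exact ⟨i, j, c, c', hs, hjk ▸ ht⟩
  obtain ⟨m, a, b, x, y, hp, hr⟩ := hp.exists_common hF hvp hvr hr hrp
  have hφu : φ u ≠ 0 := right_ne_zero_of_mul_eq_one
    (hs.apply_mul_apply_eq_one hF hvs hvt ht hjk)
  have hms : ∀ l x, ¬ IsEdge e f m l x s := fun l x h => by
    obtain rfl := h.eq_of_apply_eq_zero hF hvs hvr hr hrs
    exact hφu (((hvs.isRescaling hvr.apply).apply_eq_zero_iff (IsRescaling.refl u ψ)).1 hrt)
  have hmt : ∀ l x, ¬ IsEdge e f m l x t := fun l x h => by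
    obtain rfl := h.eq_of_apply_eq_zero hF hvt hvr hr hrt
    exact hst (((hvt.isRescaling hvr.apply).apply_eq_zero_iff (IsRescaling.refl v φ)).1 hrs)
  have him : i ≠ m := by rintro rfl; exact hms _ _ hs
  have hjm : j ≠ m := by rintro rfl; exact hms _ _ hs.symm
  have hkm : k ≠ m := by rintro rfl; exact hmt _ _ ht.symm
  obtain rfl : a = i := by
    have h1 := hs.eq_or_eq_of_apply_ne hF hvs hvp hp him hjm hsp
    have h2 := ht.eq_or_eq_of_apply_ne hF hvt hvp hp him hkm htp
    grind
  refine absurd ?_ hasym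
  rw [hs.triple_eq_one hF hvs hvt hvp ht hp.symm hjk hkm hjm,
    ht.triple_eq_one hF hvt hvs hvp hs hp.symm (Ne.symm hjk) hjm hkm]

end Uniqueness

section Parallel

variable [CharP K 2]

theorem IsEdge.apply_apply (hF : IsFrame e f) (hs : IsEdge e f i j c s) (ht : IsEdge e f i j c' t)
    (x : V) : s (t x) = x + ((c' / c - 1) * f i x) • e i + ((c / c' - 1) * f j x) • e j := by
  have hc := hs.gain_ne
  have hc' := ht.gain_ne
  have htwo : (2 : K) = 0 := CharTwo.two_eq_zero
  have hst : s (t x) = x + (f i x + c⁻¹ * f j x + (f i x + c'⁻¹ * f j x) * (c' * c⁻¹)) • e i +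
      ((f i x + c⁻¹ * f j x) * c + (f i x + c'⁻¹ * f j x) * c) • e j := by
    rw [ht.apply, map_add, map_smul, map_add, map_smul, hs.apply_left hF, hs.apply_right hF,
      hs.apply]
    simp only [LinearMap.add_apply, LinearMap.smul_apply, smul_eq_mul]
    module
  rw [hst]
  congr 3
  · field_simp
    linear_combination (f j x + c * f i x) * htwo
  · field_simp
    linear_combination (c' * c * f i x + c' * f j x) * htwo

variable {e' : κ → V} {f' : κ → Dual K V} {i' j' : κ} {d' a : K}

theorem div_ne_div_of_ne (hc : c ≠ 0) (hc' : c' ≠ 0) (h : c ≠ c') : c / c' ≠ c' / c := by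
  rw [ne_eq, div_eq_div_iff hc' hc, ← sq, ← sq, CharTwo.sq_inj]
  exact h

theorem IsEdge.eq_smul_of_apply_apply (hF : IsFrame e f) (hs : IsEdge e f i j c s)
    (ht : IsEdge e f i j c' t) (hcc : c ≠ c') {x : V} (hx : s (t x) = (c' / c) • x) :
    x = f i x • e i := by
  have hij := hs.index_ne
  have hg := hs.apply_apply hF ht x
  rw [hx] at hg
  have h1 : c' / c - 1 ≠ 0 := fun h => hcc (eq_of_div_eq_one (sub_eq_zero.1 h)).symm
  have hfj : f j x = 0 := by
    have := congrArg (f j) hg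
    simp only [map_add, map_smul, smul_eq_mul, hF.self, hF.ne j i hij.symm] at this
    have h2 : (c / c' - c' / c) * f j x = 0 := by linear_combination -this
    exact (mul_eq_zero.1 h2).resolve_left
      (sub_ne_zero.2 (div_ne_div_of_ne hs.gain_ne ht.gain_ne hcc))
  rw [hfj, mul_zero, zero_smul, add_zero, mul_smul, ← sub_eq_iff_eq_add'] at hg
  refine smul_right_injective V h1 (Eq.trans ?_ hg)
  simp only [sub_smul, one_smul]

theorem IsEdge.dual_eq_smul_of_apply_apply (hF : IsFrame e f) (hs : IsEdge e f i j c s)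
    (ht : IsEdge e f i j c' t) (hcc : c ≠ c') (hψ : ∀ x, ψ (s (t x)) = (c' / c) * ψ x) :
    ψ = ψ (e i) • f i := by
  have hij := hs.index_ne
  have hg : ∀ x, (c' / c) * ψ x =
      ψ x + (c' / c - 1) * f i x * ψ (e i) + (c / c' - 1) * f j x * ψ (e j) := fun x => by
    rw [← hψ, hs.apply_apply hF ht]
    simp
  have h1 : c' / c - 1 ≠ 0 := fun h => hcc (eq_of_div_eq_one (sub_eq_zero.1 h)).symm
  have hj : ψ (e j) = 0 := by
    have := hg (e j)
    rw [hF.self, hF.ne i j hij] at this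
    have h2 : (c / c' - c' / c) * ψ (e j) = 0 := by linear_combination -this
    exact (mul_eq_zero.1 h2).resolve_left
      (sub_ne_zero.2 (div_ne_div_of_ne hs.gain_ne ht.gain_ne hcc))
  ext x
  apply mul_left_cancel₀ h1
  rw [LinearMap.smul_apply, smul_eq_mul]
  linear_combination hg x + (c / c' - 1) * f j x * hj

theorem IsEdge.div_eq_or_div_eq (hF : IsFrame e f) (hs : IsEdge e f i j c s)
    (ht : IsEdge e f i j c' t) {x : V} (hx0 : x ≠ 0) (ha : a ≠ 1) (hx : s (t x) = a • x) :
    a = c' / c ∨ a = c / c' := by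
  have hij := hs.index_ne
  have hg := hs.apply_apply hF ht x
  rw [hx] at hg
  by_contra! hne
  have hfi : f i x = 0 := by
    have := congrArg (f i) hg
    simp only [map_add, map_smul, smul_eq_mul, hF.self, hF.ne i j hij] at this
    have h2 : (a - c' / c) * f i x = 0 := by linear_combination this
    exact (mul_eq_zero.1 h2).resolve_left (sub_ne_zero.2 hne.1)
  have hfj : f j x = 0 := by
    have := congrArg (f j) hg
    simp only [map_add, map_smul, smul_eq_mul, hF.self, hF.ne j i hij.symm] at this
    have h2 : (a - c / c') * f j x = 0 := by linear_combination this
    exact (mul_eq_zero.1 h2).resolve_left (sub_ne_zero.2 hne.2)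
  simp only [hfi, hfj, mul_zero, zero_smul, add_zero] at hg
  have h3 : (a - 1) • x = 0 := by rw [sub_smul, hg, one_smul, sub_self]
  exact (smul_eq_zero.1 h3).elim (fun h => ha (sub_eq_zero.1 h)) hx0

theorem IsEdge.isRescaling_of_div_eq (hF : IsFrame e f) (hF' : IsFrame e' f')
    (hs : IsEdge e f i j c s) (ht : IsEdge e f i j c' t) (hcc : c ≠ c')
    (hs' : IsEdge e' f' i' j' d s) (ht' : IsEdge e' f' i' j' d' t) (hdiv : d' / d = c' / c) :
    IsRescaling (e i) (f i) (e' i') (f' i') := by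
  have he := hs.eq_smul_of_apply_apply hF ht hcc (x := e' i') (by
    rw [ht'.apply_left hF', map_smul, hs'.apply_right hF', smul_smul, ← div_eq_mul_inv, hdiv])
  have hf := hs.dual_eq_smul_of_apply_apply hF ht hcc (ψ := f' i') fun x => by
    rw [hs'.apply_apply hF' ht', ← hdiv]
    simp only [map_add, map_smul, smul_eq_mul, hF'.self, hF'.ne i' j' hs'.index_ne]
    ring
  have hone : f' i' (e i) * f i (e' i') = 1 := by
    rw [← hF'.self i']
    conv_rhs => rw [hf]
    simp
  refine ⟨f i (e' i'), right_ne_zero_of_mul_eq_one hone, he, ?_⟩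
  rwa [← eq_inv_of_mul_eq_one_left hone]

theorem IsParallel.exists_isRescaling (hF : IsFrame e f) (hF' : IsFrame e' f')
    (hs : IsEdge e f i j c s) (ht : IsEdge e f i j c' t) (hst : s ≠ t)
    (h : IsParallel e' f' s t) : ∃ m, IsRescaling (e i) (f i) (e' m) (f' m) := by
  obtain ⟨i', j', d, d', hs', ht'⟩ := h
  have hcc : c ≠ c' := by rintro rfl; exact hst (hs.eq_of_gain ht)
  have hdd : d ≠ d' := by rintro rfl; exact hst (hs'.eq_of_gain ht')
  have hd : d' / d ≠ 1 := fun h => hdd (eq_of_div_eq_one h).symm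
  have hi' : s (t (e' i')) = (d' / d) • e' i' := by
    rw [ht'.apply_left hF', map_smul, hs'.apply_right hF', smul_smul, ← div_eq_mul_inv]
  rcases hs.div_eq_or_div_eq hF ht (hF'.vec_ne i') hd hi' with hdiv | hdiv
  · exact ⟨i', hs.isRescaling_of_div_eq hF hF' ht hcc hs' ht' hdiv⟩
  · refine ⟨j', hs.isRescaling_of_div_eq hF hF' ht hcc hs'.symm ht'.symm ?_⟩
    rw [inv_div_inv, ← inv_div d' d, hdiv, inv_div]

end Parallel

end Frames

section MonomialFrames

variable {ι κ : Type*}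
  {G H : Subgroup (V ≃ₗ[K] V)} {W N : Submodule K V} {e : ι → V} {f : ι → Dual K V}
  {i j k l : ι} {c : K} {p r s t : V ≃ₗ[K] V}

theorem IsTransvectionAlong.det_eq_one [FiniteDimensional K V] {v : V} {φ : Dual K V}
    (h : IsTransvectionAlong t v φ) : LinearMap.det (t : V →ₗ[K] V) = 1 := by
  have hmap : (t : V →ₗ[K] V) = LinearMap.transvection φ v := by
    ext x
    simp [LinearMap.transvection.apply, h.apply]
  rw [hmap, LinearMap.transvection.det, h.apply_self, add_zero]

theorem isFrame_basis (b : Basis ι K V) : IsFrame b b.coord :=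
  ⟨fun i => by simp, fun i j hij => by simp [Finsupp.single_eq_of_ne hij]⟩

theorem IsEdge.isMonomialElement [FiniteDimensional K V] [CharP K 2] {d a : ℕ}
    {b : Basis (Fin d) K V} {i j : Fin d} (h : IsEdge b b.coord i j c t) (hc : c ^ a = 1) :
    IsMonomialElement b a t := by
  have hF := isFrame_basis b
  refine ⟨(h.along hF).det_eq_one, Equiv.swap i j,
    fun k => if k = i then c else if k = j then c⁻¹ else 1, fun k => ?_, fun k => ?_⟩
  · dsimp only
    split_ifs
    · exact hc
    · rw [inv_pow, hc, inv_one]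
    · exact one_pow _
  · dsimp only
    by_cases h1 : k = i
    · subst h1
      simp [h.apply_left hF]
    by_cases h2 : k = j
    · subst h2
      simp [h1, h.apply_right hF]
    · rw [if_neg h1, if_neg h2, Equiv.swap_apply_of_ne_of_ne h1 h2, one_smul,
        h.apply_of_ne hF h1 h2]

theorem exists_isFrame_of_isCompl (h : IsCompl W N) (b : Basis ι K W) :
    ∃ f : ι → Dual K V, IsFrame (fun i => (b i : V)) f ∧
      (∀ i (w : W), f i w = b.coord i w) ∧ ∀ x, (∀ i, f i x = 0) ↔ x ∈ N := by
  have hf : ∀ i (w : W), (b.coord i ∘ₗ W.projectionOnto N h) w = b.coord i w := fun i w => by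
    rw [LinearMap.comp_apply, Submodule.projectionOnto_apply_left]
  refine ⟨fun i => b.coord i ∘ₗ W.projectionOnto N h, ⟨fun i => ?_, fun i j hij => ?_⟩, hf,
    fun x => ?_⟩
  · rw [hf, (isFrame_basis b).self]
  · rw [hf, (isFrame_basis b).ne i j hij]
  · rw [← Submodule.projectionOnto_apply_eq_zero_iff h, ← b.forall_coord_eq_zero_iff]
    rfl

theorem IsEdge.of_restrict (h : IsCompl W N) {b : Basis ι K W}
    (hf : ∀ i (w : W), f i w = b.coord i w) (hf0 : ∀ i, ∀ x ∈ N, f i x = 0) {t : W ≃ₗ[K] W}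
    (ht : IsEdge b b.coord i j c t) {g : V ≃ₗ[K] V} (hg : ∀ w, (t w : V) = g w)
    (hgN : ∀ x ∈ N, g x = x) : IsEdge (fun i => (b i : V)) f i j c g := by
  refine ⟨ht.index_ne, ht.gain_ne, fun x => ?_⟩
  obtain ⟨w, hw, y, hy, rfl⟩ := Submodule.mem_sup.1 (h.sup_eq_top ▸ Submodule.mem_top : x ∈ W ⊔ N)
  lift w to W using hw
  rw [map_add, ← hg, hgN y hy, ht.apply]
  simp only [Submodule.coe_add, Submodule.coe_smul, LinearMap.add_apply, LinearMap.smul_apply,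
    map_add, hf, hf0 _ y hy, smul_zero, add_zero]
  abel

theorem exists_basis_of_restrict_top (hW : W = ⊤) {d a : ℕ} {b : Basis (Fin d) K W}
    (hb : ∀ g, g ∈ restrict G W ↔ IsMonomialElement b a g) :
    ∃ b' : Basis (Fin d) K V, ∀ g, g ∈ G ↔ IsMonomialElement b' a g := by
  subst hW
  let θ : (⊤ : Submodule K V) ≃ₗ[K] V := Submodule.topEquiv
  refine ⟨b.map θ, fun g => ?_⟩
  let h : (⊤ : Submodule K V) ≃ₗ[K] (⊤ : Submodule K V) := (θ.trans g).trans θ.symm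
  have hθ : ∀ w, θ (h w) = g (θ w) := fun w => θ.apply_symm_apply _
  have hmem : g ∈ G ↔ h ∈ restrict G ⊤ := by
    refine ⟨fun hg => ⟨g, hg, hθ⟩, ?_⟩
    rintro ⟨g', hg', hh⟩
    have hgg' : g = g' := by
      ext x
      exact (hθ (θ.symm x)).symm.trans (hh (θ.symm x))
    rwa [hgg']
  have hdet : LinearMap.det (h : (⊤ : Submodule K V) →ₗ[K] (⊤ : Submodule K V)) =
      LinearMap.det (g : V →ₗ[K] V) := LinearMap.det_conj (g : V →ₗ[K] V) θ.symm
  rw [hmem, hb, IsMonomialElement, IsMonomialElement, hdet]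
  refine and_congr_right fun _ => exists_congr fun σ => exists_congr fun c =>
    and_congr_right fun _ => forall_congr' fun i => ?_
  rw [Basis.map_apply, Basis.map_apply, ← hθ, ← LinearEquiv.map_smul θ, θ.injective.eq_iff]

/-- `e, f` is a frame of which all transvections in `G` are edges. -/
structure IsFrameFor (G : Subgroup (V ≃ₗ[K] V)) (e : ι → V) (f : ι → Dual K V) : Prop where
  isFrame : IsFrame e f
  isEdgeOf : ∀ t ∈ G, ∀ u ψ, IsTransvectionAlong t u ψ → IsEdgeOf e f t

theorem IsFrameFor.mono (h : IsFrameFor G e f) (hH : H ≤ G) : IsFrameFor H e f :=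
  ⟨h.isFrame, fun t ht => h.isEdgeOf t (hH ht)⟩

/-- `G` contains all edges of the frame `e, f` whose gain is an `a`-th root of unity. -/
def ContainsRootEdges (G : Subgroup (V ≃ₗ[K] V)) (a : ℕ) (e : ι → V) (f : ι → Dual K V) : Prop :=
  ∀ ⦃i j⦄ ⦃c : K⦄, i ≠ j → c ^ a = 1 → ∃ g ∈ G, IsEdge e f i j c g

theorem apply_eq_self_of_mem_closure {S : Set (V ≃ₗ[K] V)} {x : V} (hx : ∀ t ∈ S, t x = x)
    {g : V ≃ₗ[K] V} (hg : g ∈ Subgroup.closure S) : g x = x :=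
  (Subgroup.closure_le (MulAction.stabilizer (V ≃ₗ[K] V) x)).2 hx hg

section System

variable [FiniteDimensional K V] {S : Set (V ≃ₗ[K] V)} {v : (V ≃ₗ[K] V) → V}
  {φ : (V ≃ₗ[K] V) → Dual K V}

theorem IsIrreducibleSystem.isCompl (hS : IsIrreducibleSystem S v φ) :
    IsCompl (vecSpan S) (covecSpan S).dualCoannihilator := by
  have hV : vecSpan S ⊓ (covecSpan S).dualCoannihilator = ⊥ :=
    zeroLeftKernel_iff.1 hS.nondegenerate.1
  have hVdual : covecSpan S ⊓ (vecSpan S).dualAnnihilator = ⊥ := by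
    rw [Submodule.eq_bot_iff]
    rintro ψ ⟨hψ, hψ'⟩
    exact hS.nondegenerate.2 ψ hψ fun x hx => (Submodule.mem_dualAnnihilator ψ).1 hψ' x hx
  refine IsCompl.of_eq hV (Submodule.eq_top_of_finrank_eq ?_)
  have hsum := Submodule.finrank_sup_add_finrank_inf_eq (vecSpan S) (covecSpan S).dualCoannihilator
  have hsum_dual :=
    Submodule.finrank_sup_add_finrank_inf_eq (covecSpan S) (vecSpan S).dualAnnihilator
  rw [hV, finrank_bot] at hsum
  rw [hVdual, finrank_bot] at hsum_dual
  have hcoann := Subspace.finrank_add_finrank_dualCoannihilator_eq (covecSpan S)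
  have hann := Subspace.finrank_add_finrank_dualAnnihilator_eq (vecSpan S)
  have hle := Submodule.finrank_le (vecSpan S ⊔ (covecSpan S).dualCoannihilator)
  have hle_dual := Submodule.finrank_le (covecSpan S ⊔ (vecSpan S).dualAnnihilator)
  rw [Subspace.dual_finrank_eq] at hle_dual
  omega

theorem IsIrreducibleSystem.exists_isFrameFor (hS : IsIrreducibleSystem S v φ)
    (h : HasMonomialType (commutatorAction (Subgroup.closure S))) :
    ∃ (d a : ℕ) (e : Fin d → V) (f : Fin d → Dual K V), d = finrank K (vecSpan S) ∧ 1 < a ∧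
      a ∣ Nat.card K - 1 ∧ IsFrameFor (Subgroup.closure S) e f ∧
      ContainsRootEdges (Subgroup.closure S) a e f ∧
      (vecSpan S = ⊤ → ∃ b : Basis (Fin d) K V,
        ∀ g, g ∈ Subgroup.closure S ↔ IsMonomialElement b a g) := by
  have hv := hS.presentation
  obtain ⟨_, d, -, a, ha, hadvd, b, hb⟩ := h
  have hWS := hv.commutatorSpace_eq
  have hcompl := hS.isCompl
  rw [← hWS] at hcompl
  obtain ⟨f, hF, hf, hf0⟩ := exists_isFrame_of_isCompl hcompl b
  have hfix : ∀ x ∈ (covecSpan S).dualCoannihilator, ∀ g ∈ Subgroup.closure S, g x = x := by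
    intro x hx g hg
    rw [Submodule.mem_dualCoannihilator, hv.forall_covecSpan_iff] at hx
    exact apply_eq_self_of_mem_closure (fun t ht => (hv t ht).apply_eq_self_iff.2 (hx t ht)) hg
  refine ⟨d, a, fun i => b i, f, ?_, ha, hadvd, ⟨hF, fun t ht u ψ htu => ?_⟩,
    fun i j c hij hca => ?_, fun htop => exists_basis_of_restrict_top (hWS.trans htop) hb⟩
  · rw [← hWS, finrank_eq_card_basis b, Fintype.card_fin]
  · refine htu.isEdgeOf hF (fun i => ?_) fun x hx => hfix x ((hf0 x).1 hx) t ht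
    obtain ⟨g, hg, hgt⟩ := exists_mem_commutatorAction ht
    obtain ⟨-, σ, c, -, hc⟩ := (hb g).1 hg
    exact ⟨σ i, c i, by rw [← hgt (b i), hc]; rfl⟩
  · obtain ⟨t, ht⟩ := (isFrame_basis b).exists_isEdge hij
      (IsUnit.of_pow_eq_one hca (by omega)).ne_zero
    obtain ⟨g, hg, hgt⟩ := (hb t).2 (ht.isMonomialElement hca)
    exact ⟨g, hg, ht.of_restrict hcompl hf (fun i x hx => (hf0 x).2 hx i) hgt
      fun x hx => hfix x hx g hg⟩

end System

section CommonVertex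

theorem exists_orderOf_eq [Finite K] {a : ℕ} (ha : a ∣ Nat.card K - 1) :
    ∃ c : K, orderOf c = a := by
  obtain ⟨g, hg⟩ := IsCyclic.exists_ofOrder_eq_natCard (α := Kˣ)
  have hcard : Nat.card Kˣ = Nat.card K - 1 := Nat.card_units K
  obtain ⟨m, hm⟩ := ha
  have hpos : 0 < Nat.card Kˣ := Nat.card_pos
  have hm0 : m ≠ 0 := by
    rintro rfl
    omega
  refine ⟨((g ^ m : Kˣ) : K), ?_⟩
  rw [orderOf_units, orderOf_pow_of_dvd hm0 (by rw [hg, hcard, hm]; exact Dvd.intro_left a rfl),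
    hg, hcard, hm, Nat.mul_div_cancel _ (Nat.pos_of_ne_zero hm0)]

variable [CharP K 2] {e' : κ → V} {f' : κ → Dual K V}

theorem IsEdge.isParallel_of_gain_ne (hF : IsFrame e f) (hF' : IsFrame e' f')
    (hs : IsEdge e f i j 1 s) (ht : IsEdge e f i j c t) (hs' : IsEdgeOf e' f' s)
    (ht' : IsEdgeOf e' f' t) (hc1 : c ≠ 1) (hc : c ^ 2 + c + 1 ≠ 0) : IsParallel e' f' s t := by
  have hc0 := ht.gain_ne
  refine hs'.isParallel_of_mul_ne_one hF' (hs.along hF) (ht.along hF) ht' ?_ ?_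
  · rw [hF.edge_apply_edge hs.index_ne, mul_one, ne_eq, CharTwo.add_eq_zero, eq_comm, inv_eq_one]
    · exact hc1
  · rw [hF.edge_apply_edge hs.index_ne, hF.edge_apply_edge hs.index_ne, inv_one, one_mul, mul_one]
    intro h
    field_simp at h
    exact hc (by linear_combination h)

theorem IsEdge.isParallel_of_path (hF : IsFrame e f) (hF' : IsFrame e' f')
    (hs : IsEdge e f i j 1 s) (ht : IsEdge e f i j c t) (hp : IsEdge e f j k 1 p)
    (hr : IsEdge e f k l 1 r) (hs' : IsEdgeOf e' f' s) (ht' : IsEdgeOf e' f' t)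
    (hp' : IsEdgeOf e' f' p) (hr' : IsEdgeOf e' f' r) (hc1 : c ≠ 1) (hik : i ≠ k) (hil : i ≠ l)
    (hjl : j ≠ l) : IsParallel e' f' s t := by
  have hc0 := ht.gain_ne
  have hij := hs.index_ne
  have hjk := hp.index_ne
  have hkl := hr.index_ne
  refine hs'.isParallel_of_triple_ne hF' (hs.along hF) (ht.along hF) (hp.along hF) (hr.along hF)
    ht' hp' hr' ?_ ?_ ?_ ?_ ?_ ?_ ?_
  · rw [hF.edge_apply_edge hij, mul_one, ne_eq, CharTwo.add_eq_zero, eq_comm, inv_eq_one]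
    · exact hc1
  · simp [hF.self, hF.ne j i hij.symm, hF.ne k i hik.symm, hF.ne k j hjk.symm]
  · simp [hF.self, hF.ne j i hij.symm, hF.ne k i hik.symm, hF.ne k j hjk.symm, hc0]
  · exact hF.edge_apply_edge_eq_zero hik hil hjk hjl
  · exact hF.edge_apply_edge_eq_zero hik hil hjk hjl
  · simp [hF.self, hF.ne k j hjk.symm, hF.ne l j hjl.symm, hF.ne l k hkl.symm]
  · simp only [map_add, LinearMap.add_apply, LinearMap.smul_apply, map_smul, hF.self,
      hF.ne i j hij, hF.ne j i hij.symm, hF.ne i k hik, hF.ne k i hik.symm, hF.ne j k hjk,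
      hF.ne k j hjk.symm, smul_eq_mul, inv_one, one_smul]
    intro h
    field_simp at h
    have hsq : (c - 1) ^ 2 = 0 := by
      linear_combination -h + (1 - c) * CharTwo.two_eq_zero (R := K)
    exact hc1 (sub_eq_zero.1 (pow_eq_zero_iff two_ne_zero |>.1 hsq))

theorem ContainsRootEdges.exists_common_vertex [Finite K] {d a : ℕ} {e : Fin d → V}
    {f : Fin d → Dual K V} (hG : ContainsRootEdges G a e f) (hF : IsFrame e f) (hd : 2 ≤ d)
    (ha : 1 < a) (hadvd : a ∣ Nat.card K - 1) (h : a ≠ 3 ∨ 4 ≤ d) :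
    ∃ i, ∀ (d' : ℕ) (e' : Fin d' → V) (f' : Fin d' → Dual K V), IsFrameFor G e' f' →
      ∃ m, IsRescaling (e i) (f i) (e' m) (f' m) := by
  obtain ⟨c, hc⟩ := exists_orderOf_eq hadvd
  have hca : c ^ a = 1 := hc ▸ pow_orderOf_eq_one c
  have hc1 : c ≠ 1 := by
    rintro rfl
    rw [orderOf_one] at hc
    omega
  have hne : ∀ {m n : ℕ} (hm : m < d) (hn : n < d), m ≠ n → (⟨m, hm⟩ : Fin d) ≠ ⟨n, hn⟩ :=
    fun _ _ hmn h => hmn (Fin.mk.inj h)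
  have h01 := hne (by omega) (by omega) zero_ne_one
  obtain ⟨s, hsG, hs⟩ := hG h01 (one_pow a)
  obtain ⟨t, htG, ht⟩ := hG h01 hca
  have hst : s ≠ t := by
    rintro rfl
    have := (hs.apply_left hF).symm.trans (ht.apply_left hF)
    exact hc1 (smul_left_injective K (hF.vec_ne _) this).symm
  refine ⟨⟨0, by omega⟩, fun d' e' f' hF' =>
    IsParallel.exists_isRescaling hF hF'.isFrame hs ht hst ?_⟩
  have hs' := hF'.isEdgeOf s hsG _ _ (hs.along hF)
  have ht' := hF'.isEdgeOf t htG _ _ (ht.along hF)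
  by_cases ha3 : a = 3
  · have hd4 : 4 ≤ d := h.resolve_left (not_not.2 ha3)
    have h3 : 3 < d := hd4
    have h2 : 2 < d := by omega
    obtain ⟨p, hpG, hp⟩ := hG (hne (m := 1) (by omega) h2 (by norm_num)) (one_pow a)
    obtain ⟨r, hrG, hr⟩ := hG (hne h2 h3 (by norm_num)) (one_pow a)
    exact hs.isParallel_of_path hF hF'.isFrame ht hp hr hs' ht'
      (hF'.isEdgeOf p hpG _ _ (hp.along hF)) (hF'.isEdgeOf r hrG _ _ (hr.along hF)) hc1
      (hne _ _ (by norm_num)) (hne _ _ (by norm_num)) (hne _ _ (by norm_num))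
  · refine hs.isParallel_of_gain_ne hF hF'.isFrame ht hs' ht' hc1 fun h1 => ?_
    have hc3 := orderOf_dvd_of_pow_eq_one (show c ^ 3 = 1 by linear_combination (c - 1) * h1)
    rw [hc] at hc3
    rcases (Nat.dvd_prime Nat.prime_three).1 hc3 with h4 | h4 <;> omega

end CommonVertex

end MonomialFrames

section Gluing

variable {ι κ : Type*} {T : Set (V ≃ₗ[K] V)} {e₀ y y' : V} {f₀ z z' : Dual K V} {r t : V ≃ₗ[K] V}

/-- The edge `t` at the vertex `(e₀, f₀)` has the other end `(y, z)`, which is scaled in such a way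
that `t = 1 + (e₀ + y) ⊗ (f₀ + z)`. -/
structure IsSpoke (e₀ : V) (f₀ : Dual K V) (t : V ≃ₗ[K] V) (y : V) (z : Dual K V) : Prop where
  covec_apply : z e₀ = 0
  apply_vec : f₀ y = 0
  apply : ∀ x, t x = x + (f₀ + z) x • (e₀ + y)

theorem IsSpoke.unique (h₀ : f₀ e₀ = 1) (h : IsSpoke e₀ f₀ t y z) (h' : IsSpoke e₀ f₀ t y' z') :
    y = y' ∧ z = z' := by
  have heq : ∀ x, (f₀ + z) x • (e₀ + y) = (f₀ + z') x • (e₀ + y') := fun x =>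
    add_left_cancel ((h.apply x).symm.trans (h'.apply x))
  obtain rfl : y = y' := by simpa [h₀, h.covec_apply, h'.covec_apply] using heq e₀
  refine ⟨rfl, ?_⟩
  ext x
  simpa [h₀, h.apply_vec] using congrArg f₀ (heq x)

section LocalFrame

variable {e : ι → V} {f : ι → Dual K V} {e' : κ → V} {f' : κ → Dual K V} {i j m : ι}
  {i' j' : κ} {c : K}

theorem IsEdge.exists_of_isRescaling (hF : IsFrame e f) (hF' : IsFrame e' f')
    (h : IsEdge e f i j c t) (hi : IsRescaling (e i) (f i) (e' i') (f' i'))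
    (hj : IsRescaling (e j) (f j) (e' j') (f' j')) : ∃ c', IsEdge e' f' i' j' c' t := by
  have hij : i' ≠ j' := by
    rintro rfl
    have := (hi.apply_eq_zero_iff hj).2 (hF.ne i j h.index_ne)
    exact one_ne_zero ((hF'.self i').symm.trans this)
  obtain ⟨a, ha, hie, hif⟩ := hi.symm
  obtain ⟨b, hb, hje, hjf⟩ := hj.symm
  have hc := h.gain_ne
  refine ⟨a⁻¹ * b * c, hij, mul_ne_zero (mul_ne_zero (inv_ne_zero ha) hb) hc, fun x => ?_⟩
  have hvec : e i + c • e j = a • (e' i' + (a⁻¹ * b * c) • e' j') := by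
    rw [hie, hje, smul_add, smul_smul, smul_smul]
    congr 2
    field_simp
  have hcovec : f i + c⁻¹ • f j = a⁻¹ • (f' i' + (a⁻¹ * b * c)⁻¹ • f' j') := by
    rw [hif, hjf, smul_add, smul_smul, smul_smul]
    congr 2
    field_simp
  rw [h.apply, hvec, hcovec, LinearMap.smul_apply, smul_smul, smul_eq_mul, mul_right_comm,
    inv_mul_cancel₀ ha, one_mul]

theorem IsEdge.exists_isSpoke (hF : IsFrame e f) (hm : IsRescaling e₀ f₀ (e m) (f m))
    (h : IsEdge e f m j c t) : ∃ y z, IsSpoke e₀ f₀ t y z ∧ IsRescaling y z (e j) (f j) := by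
  obtain ⟨a, ha, he, hf⟩ := hm.symm
  have hc := h.gain_ne
  refine ⟨(a * c) • e j, (a * c)⁻¹ • f j, ⟨?_, ?_, fun x => ?_⟩,
    IsRescaling.symm ⟨a * c, mul_ne_zero ha hc, rfl, rfl⟩⟩
  · simp [he, hF.ne j m h.index_ne.symm]
  · simp [hf, hF.ne m j h.index_ne]
  · rw [h.apply, he, hf, mul_inv, mul_smul, mul_smul, ← smul_add, ← smul_add, LinearMap.smul_apply,
      smul_smul, smul_eq_mul, mul_right_comm, inv_mul_cancel₀ ha, one_mul]

theorem IsSpoke.exists_isEdge (hF : IsFrame e f) (hm : IsRescaling e₀ f₀ (e m) (f m))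
    (h : IsSpoke e₀ f₀ t y z) (ht : IsEdgeOf e f t) :
    ∃ k c, IsEdge e f m k c t ∧ IsRescaling y z (e k) (f k) := by
  have h₀ : f₀ e₀ = 1 := by rw [← hm.apply_self, hF.self]
  obtain ⟨i, j, c, hij⟩ := ht
  obtain ⟨k, c', hk⟩ : ∃ k c', IsEdge e f m k c' t := by
    refine hij.exists_left ?_
    by_contra! hne
    have hfix := hij.apply_of_ne hF hne.1.symm hne.2.symm
    obtain ⟨a, ha, he, -⟩ := hm
    have hsum : a • (e₀ + y) = 0 := by
      simpa [he, h.apply, h₀, h.covec_apply, ha] using hfix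
    have := congrArg f₀ ((smul_eq_zero.1 hsum).resolve_left ha)
    simp [h₀, h.apply_vec] at this
  obtain ⟨y', z', h', hres⟩ := hk.exists_isSpoke hF hm
  obtain ⟨rfl, rfl⟩ := h.unique h₀ h'
  exact ⟨k, c', hk, hres⟩

theorem IsSpoke.exists_adjacent (hF : IsFrame e f) (hm : IsRescaling e₀ f₀ (e m) (f m))
    (hr : IsSpoke e₀ f₀ r y z) (hre : IsEdgeOf e f r) (hte : IsEdgeOf e f t) {u : V}
    {ψ : Dual K V} (htu : IsTransvectionAlong t u ψ) (hψ : ψ (e₀ + y) ≠ 0)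
    (ht : ∀ y z, ¬ IsSpoke e₀ f₀ t y z) :
    ∃ k l c y₁ z₁, IsEdge e f k l c t ∧ IsSpoke y z t y₁ z₁ ∧ IsRescaling y z (e k) (f k) ∧
      IsRescaling y₁ z₁ (e l) (f l) ∧ l ≠ m := by
  obtain ⟨i, j, c, hij⟩ := hte
  have hmt : ∀ l c, ¬ IsEdge e f m l c t := fun l c hl => by
    obtain ⟨y, z, h, -⟩ := hl.exists_isSpoke hF hm
    exact ht y z h
  have hψm : ψ (e m) = 0 := by
    by_contra hne
    obtain ⟨l, c, hl⟩ := hij.exists_left_of_apply_ne hF htu hne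
    exact hmt l c hl
  obtain ⟨k, -, -, hk⟩ := hr.exists_isEdge hF hm hre
  have hψk : ψ (e k) ≠ 0 := by
    obtain ⟨a, -, he, -⟩ := hm.symm
    obtain ⟨b, -, hy, -⟩ := hk.symm
    intro h0
    exact hψ (by rw [he, hy, map_add, map_smul, map_smul, hψm, h0, smul_zero, smul_zero, add_zero])
  obtain ⟨l, c', hl⟩ := hij.exists_left_of_apply_ne hF htu hψk
  obtain ⟨y₁, z₁, h₁, hres⟩ := hl.exists_isSpoke hF hk
  refine ⟨k, l, c', y₁, z₁, hl, h₁, hk, hres, ?_⟩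
  rintro rfl
  exact hmt _ _ hl.symm

end LocalFrame

theorem exists_isFrame_of_isRescaling_or {P : V → Dual K V → Prop}
    (hself : ∀ y z, P y z → z y = 1)
    (hpair : ∀ y z y' z', P y z → P y' z' → IsRescaling y z y' z' ∨ z y' = 0) :
    ∃ I : Set (V × Dual K V), IsFrame (fun p : I => p.1.1) (fun p : I => p.1.2) ∧
      ∀ y z, P y z → ∃ p : I, IsRescaling y z p.1.1 p.1.2 := by
  let R : Setoid {p : V × Dual K V // P p.1 p.2} :=
    { r := fun p q => IsRescaling p.1.1 p.1.2 q.1.1 q.1.2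
      iseqv := ⟨fun p => .refl p.1.1 p.1.2, .symm, .trans⟩ }
  refine ⟨Set.range fun q : Quotient R => q.out.1, ⟨?_, ?_⟩, fun y z h => ?_⟩
  · rintro ⟨_, q, rfl⟩
    exact hself _ _ q.out.2
  · rintro ⟨_, q, rfl⟩ ⟨_, q', rfl⟩ hne
    refine (hpair _ _ _ _ q.out.2 q'.out.2).resolve_left fun h => hne ?_
    have hqq' : q = q' := by
      rw [← Quotient.out_eq q, ← Quotient.out_eq q', Quotient.sound (s := R) h]
    simp only [hqq']
  · exact ⟨⟨_, ⟦⟨(y, z), h⟩⟧, rfl⟩, (Quotient.mk_out (s := R) ⟨(y, z), h⟩ : _).symm⟩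

/-- Any three elements of `T` are edges of a common frame through the vertex `(e₀, f₀)`. -/
def HasLocalFrames (T : Set (V ≃ₗ[K] V)) (e₀ : V) (f₀ : Dual K V) : Prop :=
  ∀ t₁ ∈ T, ∀ t₂ ∈ T, ∀ t₃ ∈ T, ∃ (d : ℕ) (e : Fin d → V) (f : Fin d → Dual K V) (m : Fin d),
    IsFrame e f ∧ IsRescaling e₀ f₀ (e m) (f m) ∧ IsEdgeOf e f t₁ ∧ IsEdgeOf e f t₂ ∧
      IsEdgeOf e f t₃

/-- `(y, z)` is the vertex `(e₀, f₀)` or the other end of an edge in `T` at that vertex. These are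
the vertices, up to scalars, of the frame that is glued from the local frames. -/
def IsVertex (T : Set (V ≃ₗ[K] V)) (e₀ : V) (f₀ : Dual K V) (y : V) (z : Dual K V) : Prop :=
  (y = e₀ ∧ z = f₀) ∨ ∃ t ∈ T, IsSpoke e₀ f₀ t y z

namespace HasLocalFrames

variable (hloc : HasLocalFrames T e₀ f₀)
include hloc

theorem exists_isSpoke (ht : t ∈ T) (h : t e₀ ≠ e₀) : ∃ y z, IsSpoke e₀ f₀ t y z := by
  obtain ⟨d, e, f, m, hF, hm, ⟨i, j, c, hij⟩, -, -⟩ := hloc t ht t ht t ht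
  obtain ⟨k, c', hk⟩ := hij.exists_left (m := m) (by
    by_contra! hne
    have hfix := hij.apply_of_ne hF hne.1.symm hne.2.symm
    obtain ⟨a, ha, he, -⟩ := hm
    rw [he, map_smul] at hfix
    exact h (smul_right_injective V ha hfix))
  obtain ⟨y, z, hyz, -⟩ := hk.exists_isSpoke hF hm
  exact ⟨y, z, hyz⟩

theorem isRescaling_or_apply_eq_zero (h : IsVertex T e₀ f₀ y z) (h' : IsVertex T e₀ f₀ y' z') :
    IsRescaling y z y' z' ∨ z y' = 0 := by
  rcases h with ⟨rfl, rfl⟩ | ⟨s, hs, hys⟩ <;> rcases h' with ⟨rfl, rfl⟩ | ⟨t, ht, hyt⟩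
  · exact .inl (.refl _ _)
  · exact .inr hyt.apply_vec
  · exact .inr hys.covec_apply
  · obtain ⟨d, e, f, m, hF, hm, hse, hte, -⟩ := hloc s hs t ht t ht
    obtain ⟨k, -, -, hk⟩ := hys.exists_isEdge hF hm hse
    obtain ⟨l, -, -, hl⟩ := hyt.exists_isEdge hF hm hte
    by_cases hkl : k = l
    · subst hkl
      exact .inl (hk.trans hl.symm)
    · exact .inr ((hk.symm.apply_eq_zero_iff hl.symm).2 (hF.ne k l hkl))

theorem apply_self (h₀ : f₀ e₀ = 1) (h : IsVertex T e₀ f₀ y z) : z y = 1 := by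
  rcases h with ⟨hy, hz⟩ | ⟨t, ht, hyt⟩
  · rw [hy, hz, h₀]
  · obtain ⟨d, e, f, m, hF, hm, hte, -, -⟩ := hloc t ht t ht t ht
    obtain ⟨k, -, -, hk⟩ := hyt.exists_isEdge hF hm hte
    rw [← hk.apply_self, hF.self]

theorem exists_isEdge_of_isSpoke (ht : t ∈ T) (h : IsSpoke e₀ f₀ t y z) :
    ∃ (d : ℕ) (e : Fin d → V) (f : Fin d → Dual K V) (i j : Fin d) (c : K), IsEdge e f i j c t ∧
      IsFrame e f ∧ (∃ y z, IsVertex T e₀ f₀ y z ∧ IsRescaling y z (e i) (f i)) ∧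
      ∃ y z, IsVertex T e₀ f₀ y z ∧ IsRescaling y z (e j) (f j) := by
  obtain ⟨d, e, f, m, hF, hm, hte, -, -⟩ := hloc t ht t ht t ht
  obtain ⟨k, c, hk, hres⟩ := h.exists_isEdge hF hm hte
  exact ⟨d, e, f, m, k, c, hk, hF, ⟨e₀, f₀, .inl ⟨rfl, rfl⟩, hm⟩, y, z, .inr ⟨t, ht, h⟩, hres⟩

theorem exists_isEdge {v : (V ≃ₗ[K] V) → V} {φ : (V ≃ₗ[K] V) → Dual K V}
    (hv : IsPresentation T v φ) (hd : IsDense T) (h₀ : f₀ e₀ = 1) (ht : t ∈ T) :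
    ∃ (d : ℕ) (e : Fin d → V) (f : Fin d → Dual K V) (i j : Fin d) (c : K), IsEdge e f i j c t ∧
      IsFrame e f ∧ (∃ y z, IsVertex T e₀ f₀ y z ∧ IsRescaling y z (e i) (f i)) ∧
      ∃ y z, IsVertex T e₀ f₀ y z ∧ IsRescaling y z (e j) (f j) := by
  by_cases htA : ∃ y z, IsSpoke e₀ f₀ t y z
  · obtain ⟨y, z, h⟩ := htA
    exact hloc.exists_isEdge_of_isSpoke ht h
  push Not at htA
  have he₀ : e₀ ≠ 0 := by
    rintro rfl
    simp at h₀
  have hspoke {s : V ≃ₗ[K] V} (hs : s ∈ T) (hse : φ s e₀ ≠ 0) : ∃ y z, IsSpoke e₀ f₀ s y z :=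
    hloc.exists_isSpoke hs (mt (hv s hs).apply_eq_self_iff.1 hse)
  obtain ⟨r, hr, hre, htr⟩ := hv.exists_covec_ne_and_apply_vec_ne hd he₀ (hv t ht).covec_ne
  obtain ⟨y, z, hy⟩ := hspoke hr hre
  have hty : φ t (e₀ + y) ≠ 0 := by
    obtain ⟨a, ha, hsum, -⟩ := (hv r hr).isRescaling hy.apply
    rw [hsum, map_smul]
    exact smul_ne_zero ha htr
  have hself : z y = 1 := hloc.apply_self h₀ (.inr ⟨r, hr, hy⟩)
  -- A third transvection `w` detects the far end of `t`, provided that it moves `e₀`.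
  obtain ⟨y₁, z₁, h₁, hz₁⟩ : ∃ y₁ z₁, IsSpoke y z t y₁ z₁ ∧ z₁ ≠ 0 := by
    obtain ⟨d, e, f, m, hF, hm, hte, hre, -⟩ := hloc t ht r hr t ht
    obtain ⟨k, l, c, y₁, z₁, -, h₁, -, hl, -⟩ := hy.exists_adjacent hF hm hre hte (hv t ht) hty htA
    refine ⟨y₁, z₁, h₁, ?_⟩
    rintro rfl
    simpa [hF.self] using hl.apply_self
  obtain ⟨w, hw, hwe, hzw⟩ := hv.exists_covec_ne_and_apply_vec_ne hd he₀ hz₁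
  obtain ⟨y₂, z₂, hy₂⟩ := hspoke hw hwe
  obtain ⟨d, e, f, m, hF, hm, hte, hre, i, j, c, hwij⟩ := hloc t ht r hr w hw
  obtain ⟨k, l, c₁, y₁', z₁', hkl, h₁', hk, hl, hlm⟩ :=
    hy.exists_adjacent hF hm hre hte (hv t ht) hty htA
  obtain ⟨rfl, rfl⟩ := h₁.unique hself h₁'
  obtain ⟨p, c₂, hp, hres⟩ := hy₂.exists_isEdge hF hm ⟨i, j, c, hwij⟩
  have hlw : f l (v w) ≠ 0 := by
    obtain ⟨b, hb, -, hfl⟩ := hl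
    rw [hfl]
    exact smul_ne_zero (inv_ne_zero hb) hzw
  obtain rfl := hp.eq_right_of_covec_ne hF (hv w hw) hlw hlm
  exact ⟨d, e, f, k, l, c₁, hkl, hF, ⟨y, z, .inr ⟨r, hr, hy⟩, hk⟩, y₂, z₂, .inr ⟨w, hw, hy₂⟩, hres⟩

theorem exists_isFrame {v : (V ≃ₗ[K] V) → V} {φ : (V ≃ₗ[K] V) → Dual K V}
    (hv : IsPresentation T v φ) (hd : IsDense T) (h₀ : f₀ e₀ = 1) :
    ∃ (I : Set (V × Dual K V)) (e : I → V) (f : I → Dual K V), IsFrame e f ∧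
      ∀ t ∈ T, IsEdgeOf e f t := by
  obtain ⟨I, hF, hI⟩ := exists_isFrame_of_isRescaling_or
    (fun _ _ => hloc.apply_self h₀) (fun _ _ _ _ => hloc.isRescaling_or_apply_eq_zero)
  refine ⟨I, _, _, hF, fun t ht => ?_⟩
  obtain ⟨d, e, f, i, j, c, h, hF', ⟨y, z, hyz, hi⟩, y', z', hyz', hj⟩ :=
    hloc.exists_isEdge hv hd h₀ ht
  obtain ⟨p, hp⟩ := hI y z hyz
  obtain ⟨q, hq⟩ := hI y' z' hyz'
  exact ⟨p, q, h.exists_of_isRescaling hF' hF (hi.symm.trans hp) (hj.symm.trans hq)⟩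

end HasLocalFrames

theorem IsFrame.exists_basis [FiniteDimensional K V] {e : ι → V} {f : ι → Dual K V}
    (hF : IsFrame e f) (hspan : ⊤ ≤ Submodule.span K (Set.range e)) :
    ∃ (n : ℕ) (b : Basis (Fin n) K V), ∀ t, IsEdgeOf e f t → IsEdgeOf b b.coord t := by
  have hfin : Finite ι := hF.linearIndependent.finite
  let σ := Finite.equivFin ι
  let b := (Basis.mk hF.linearIndependent hspan).reindex σ
  have hb i : b (σ i) = e i := by simp [b]
  have hcoord i : b.coord (σ i) = f i :=
    b.ext fun k => by
      obtain ⟨j, rfl⟩ := σ.surjective k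
      rcases eq_or_ne i j with rfl | hij
      · rw [Basis.coord_apply, b.repr_self_apply, if_pos rfl, hb, hF.self]
      · rw [Basis.coord_apply, b.repr_self_apply, if_neg (σ.injective.ne hij.symm), hb,
          hF.ne i j hij]
  refine ⟨_, b, fun t ⟨i, j, c, h⟩ => ⟨σ i, σ j, ?_⟩⟩
  exact h.exists_of_isRescaling hF (isFrame_basis b) (by rw [hb, hcoord]; exact .refl _ _)
    (by rw [hb, hcoord]; exact .refl _ _)

theorem HasLocalFrames.exists_basis [FiniteDimensional K V] [Nontrivial V]
    (hloc : HasLocalFrames T e₀ f₀) {v : (V ≃ₗ[K] V) → V} {φ : (V ≃ₗ[K] V) → Dual K V}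
    (hv : IsPresentation T v φ) (hd : IsDense T) (h₀ : f₀ e₀ = 1) :
    ∃ (n : ℕ) (b : Basis (Fin n) K V), ∀ t ∈ T, IsEdgeOf b b.coord t := by
  obtain ⟨I, e, f, hF, hT⟩ := hloc.exists_isFrame hv hd h₀
  have hspan : ⊤ ≤ Submodule.span K (Set.range e) := by
    rw [← hv.vecSpan_eq_top hd, hv.vecSpan_eq, Submodule.span_le]
    rintro _ ⟨t, ht, rfl⟩
    obtain ⟨i, j, c, h⟩ := hT t ht
    obtain ⟨a, -, hvt, -⟩ := ((hv t ht).isRescaling h.apply).symm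
    rw [hvt]
    exact Submodule.smul_mem _ _ (Submodule.add_mem _ (Submodule.subset_span ⟨i, rfl⟩)
      (Submodule.smul_mem _ _ (Submodule.subset_span ⟨j, rfl⟩)))
  obtain ⟨n, b, hb⟩ := hF.exists_basis hspan
  exact ⟨n, b, fun t ht => hb t (hT t ht)⟩

end Gluing

section MonomialGroups

variable {G : Subgroup (V ≃ₗ[K] V)} {T : Set (V ≃ₗ[K] V)} {g g' r s t : V ≃ₗ[K] V}

section MonomialElement

variable {n a : ℕ} {b b' : Basis (Fin n) K V}

theorem IsMonomialElement.mul (h : IsMonomialElement b a g) (h' : IsMonomialElement b a g') :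
    IsMonomialElement b a (g * g') := by
  obtain ⟨hdet, σ, c, hc, hg⟩ := h
  obtain ⟨hdet', σ', c', hc', hg'⟩ := h'
  refine ⟨?_, σ * σ', fun i => c' i * c (σ' i), fun i => ?_, fun i => ?_⟩
  · rw [show ((g * g' : V ≃ₗ[K] V) : V →ₗ[K] V) = (g : V →ₗ[K] V) * g' from rfl, map_mul, hdet,
      hdet', one_mul]
  · rw [mul_pow, hc, hc', one_mul]
  · rw [LinearEquiv.mul_apply, hg', map_smul, hg, smul_smul, Equiv.Perm.mul_apply]

theorem IsMonomialElement.inv (h : IsMonomialElement b a g) : IsMonomialElement b a g⁻¹ := by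
  obtain ⟨hdet, σ, c, hc, hg⟩ := h
  have hc0 i : c i ≠ 0 := fun h0 => b.ne_zero i (g.map_eq_zero_iff.1 (by rw [hg, h0, zero_smul]))
  refine ⟨?_, σ⁻¹, fun i => (c (σ⁻¹ i))⁻¹, fun i => ?_, fun i => ?_⟩
  · have hmul := LinearEquiv.det_symm_mul_det g
    rwa [hdet, mul_one] at hmul
  · rw [inv_pow, hc, inv_one]
  · refine g.symm_apply_eq.2 ?_
    rw [map_smul, hg, inv_smul_smul₀ (hc0 _), Equiv.Perm.coe_inv, Equiv.apply_symm_apply]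

/-- The group `M_n(a)` of the monomial elements with respect to the basis `b`. -/
def monomialGroup (b : Basis (Fin n) K V) (a : ℕ) : Subgroup (V ≃ₗ[K] V) where
  carrier := {g | IsMonomialElement b a g}
  one_mem' := ⟨LinearMap.det_id, 1, 1, fun _ => one_pow a, fun _ => (one_smul K _).symm⟩
  mul_mem' := .mul
  inv_mem' := .inv

theorem IsMonomialElement.conj (E : V ≃ₗ[K] V) (h : IsMonomialElement b a g) :
    IsMonomialElement (b.map E) a (E * g * E⁻¹) := by
  obtain ⟨hdet, σ, c, hc, hg⟩ := h
  refine ⟨?_, σ, c, hc, fun i => ?_⟩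
  · rw [← hdet]
    exact LinearMap.det_conj (g : V →ₗ[K] V) E
  · rw [Basis.map_apply, Basis.map_apply, LinearEquiv.mul_apply, LinearEquiv.mul_apply,
      show E⁻¹ (E (b i)) = b i from E.symm_apply_apply _, hg, map_smul]

theorem det_eq_prod_of_apply_eq_smul {c : Fin n → K} {g : V →ₗ[K] V}
    (hg : ∀ i, g (b i) = c i • b i) : LinearMap.det g = ∏ i, c i := by
  have hdiag : LinearMap.toMatrix b b g = Matrix.diagonal c := by
    ext i j
    rw [LinearMap.toMatrix_apply, hg, map_smul, Finsupp.smul_apply, Basis.repr_self_apply,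
      Matrix.diagonal_apply]
    rcases eq_or_ne i j with rfl | hij
    · simp
    · simp [hij, hij.symm]
  rw [← LinearMap.det_toMatrix b, hdiag, Matrix.det_diagonal]

theorem natCard_monomialGroup_le [Finite K] [FiniteDimensional K V] :
    Nat.card (monomialGroup b a) ≤ Nat.card (monomialGroup b' a) := by
  have : Finite V := Module.finite_of_finite K
  have : Finite (V ≃ₗ[K] V) := Finite.of_injective (fun g => (g : V → V)) DFunLike.coe_injective
  let E := b.equiv b' (Equiv.refl _)
  have hE : b.map E = b' := Basis.eq_of_apply_eq fun i => by simp [E]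
  refine Nat.card_le_card_of_injective (β := monomialGroup b' a)
    (fun g => ⟨E * g * E⁻¹, hE ▸ g.2.conj E⟩) fun g g' h => ?_
  exact Subtype.ext (mul_left_cancel (mul_right_cancel (congrArg Subtype.val h)))

theorem monomialGroup_eq_of_le [Finite K] [FiniteDimensional K V]
    (h : monomialGroup b a ≤ monomialGroup b' a) : monomialGroup b a = monomialGroup b' a := by
  have : Finite V := Module.finite_of_finite K
  have : Finite (V ≃ₗ[K] V) := Finite.of_injective (fun g => (g : V → V)) DFunLike.coe_injective
  exact Subgroup.eq_of_le_of_card_ge h natCard_monomialGroup_le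

end MonomialElement

section Edges

variable {ι : Type*} {b : Basis ι K V} {i j k l : ι} {c c' c'' : K}

/-- `G` contains the edge of the basis `b` from `i` to `j` with gain `c`. -/
def ContainsEdge (G : Subgroup (V ≃ₗ[K] V)) (b : Basis ι K V) (i j : ι) (c : K) : Prop :=
  ∃ g ∈ G, IsEdge b b.coord i j c g

theorem ContainsEdge.symm (h : ContainsEdge G b i j c) : ContainsEdge G b j i c⁻¹ := by
  obtain ⟨g, hg, h⟩ := h
  exact ⟨g, hg, h.symm⟩

variable [CharP K 2]

theorem isEdge_of_apply (hij : i ≠ j) (hc : c ≠ 0) (hi : t (b i) = c • b j)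
    (hj : t (b j) = c⁻¹ • b i) (hne : ∀ k, k ≠ i → k ≠ j → t (b k) = b k) :
    IsEdge b b.coord i j c t := by
  have hF := isFrame_basis b
  obtain ⟨p, hp⟩ := hF.exists_isEdge hij hc
  suffices t = p from this ▸ hp
  refine LinearEquiv.toLinearMap_injective (b.ext fun k => ?_)
  rw [LinearEquiv.coe_coe, LinearEquiv.coe_coe]
  by_cases hki : k = i
  · rw [hki, hi, hp.apply_left hF]
  by_cases hkj : k = j
  · rw [hkj, hj, hp.apply_right hF]
  rw [hne k hki hkj, hp.apply_of_ne hF hki hkj]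

theorem IsEdge.conj (hs : IsEdge b b.coord i j c s) (ht : IsEdge b b.coord j k c' t)
    (hik : i ≠ k) : IsEdge b b.coord i k (c * c') (t * s * t) := by
  have hF := isFrame_basis b
  have hij := hs.index_ne
  have hjk := ht.index_ne
  have hc' := ht.gain_ne
  refine isEdge_of_apply hik (mul_ne_zero hs.gain_ne hc') ?_ ?_ fun l hli hlk => ?_ <;>
    rw [LinearEquiv.mul_apply, LinearEquiv.mul_apply]
  · rw [ht.apply_of_ne hF hij hik, hs.apply_left hF, map_smul, ht.apply_left hF, smul_smul]
  · rw [ht.apply_right hF, map_smul, hs.apply_right hF, map_smul, map_smul,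
      ht.apply_of_ne hF hij hik, smul_smul, mul_inv_rev]
  · rcases eq_or_ne l j with rfl | hlj
    · rw [ht.apply_left hF, map_smul, hs.apply_of_ne hF hik.symm hjk.symm, map_smul,
        ht.apply_right hF, smul_inv_smul₀ hc']
    · rw [ht.apply_of_ne hF hlj hlk, hs.apply_of_ne hF hli hlj, ht.apply_of_ne hF hlj hlk]

theorem IsEdge.mul_mul (hr : IsEdge b b.coord i j c r) (hs : IsEdge b b.coord i j c' s)
    (ht : IsEdge b b.coord i j c'' t) : IsEdge b b.coord i j (c * c'⁻¹ * c'') (r * s * t) := by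
  have hF := isFrame_basis b
  refine isEdge_of_apply hr.index_ne
    (mul_ne_zero (mul_ne_zero hr.gain_ne (inv_ne_zero hs.gain_ne)) ht.gain_ne) ?_ ?_
    fun l hli hlj => ?_ <;> rw [LinearEquiv.mul_apply, LinearEquiv.mul_apply]
  · rw [ht.apply_left hF, map_smul, hs.apply_right hF, map_smul, map_smul, hr.apply_left hF,
      smul_smul, smul_smul, mul_comm, mul_comm c'']
    congr 1
    ring
  · rw [ht.apply_right hF, map_smul, hs.apply_left hF, map_smul, map_smul, hr.apply_right hF,
      smul_smul, smul_smul, mul_inv, mul_inv, inv_inv]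
    congr 1
    ring
  · rw [ht.apply_of_ne hF hli hlj, hs.apply_of_ne hF hli hlj, hr.apply_of_ne hF hli hlj]

theorem ContainsEdge.trans (h : ContainsEdge G b i j c) (h' : ContainsEdge G b j k c')
    (hik : i ≠ k) : ContainsEdge G b i k (c * c') := by
  obtain ⟨g, hg, h⟩ := h
  obtain ⟨g', hg', h'⟩ := h'
  exact ⟨g' * g * g', G.mul_mem (G.mul_mem hg' hg) hg', h.conj h' hik⟩

theorem ContainsEdge.mul_inv_mul (h : ContainsEdge G b i j c) (h' : ContainsEdge G b i j c')
    (h'' : ContainsEdge G b i j c'') : ContainsEdge G b i j (c * c'⁻¹ * c'') := by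
  obtain ⟨g, hg, h⟩ := h
  obtain ⟨g', hg', h'⟩ := h'
  obtain ⟨g'', hg'', h''⟩ := h''
  exact ⟨g * g' * g'', G.mul_mem (G.mul_mem hg hg') hg'', h.mul_mul h' h''⟩

theorem ContainsEdge.of_one {I : Set ι} (h1 : I.Pairwise (ContainsEdge G b · · 1))
    (h : ContainsEdge G b i j c) (hi : i ∈ I) (hj : j ∈ I) (hk : k ∈ I) (hl : l ∈ I)
    (hkl : k ≠ l) : ContainsEdge G b k l c := by
  have hright {i j k} (hj : j ∈ I) (hk : k ∈ I) (hik : i ≠ k) (h : ContainsEdge G b i j c) :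
      ContainsEdge G b i k c := by
    rcases eq_or_ne j k with rfl | hjk
    · exact h
    · simpa using h.trans (h1 hj hk hjk) hik
  have hswap {i j} (hi : i ∈ I) (hj : j ∈ I) (hij : i ≠ j) (h : ContainsEdge G b i j c) :
      ContainsEdge G b j i c := by
    simpa using (h1 hj hi hij.symm).mul_inv_mul h.symm (h1 hj hi hij.symm)
  rcases eq_or_ne i k with rfl | hik
  · exact hright hj hl hkl h
  · exact hright hi hl hkl (hswap hi hk hik (hright hj hk hik h))

theorem exists_subgroup_containsEdge_iff {I : Set ι} (h1 : I.Pairwise (ContainsEdge G b · · 1)) :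
    ∃ H : Subgroup Kˣ, I.Pairwise fun i j => ∀ c : Kˣ, ContainsEdge G b i j c ↔ c ∈ H := by
  let H : Subgroup Kˣ :=
    { carrier := {c | I.Pairwise (ContainsEdge G b · · c)}
      one_mem' := h1
      mul_mem' := fun {c c'} h h' i hi j hj hij => by
        simpa using (h hi hj hij).mul_inv_mul (h1 hi hj hij) (h' hi hj hij)
      inv_mem' := fun {c} h i hi j hj hij => by
        simpa using (h1 hi hj hij).mul_inv_mul (h hi hj hij) (h1 hi hj hij) }
  exact ⟨H, fun i hi j hj hij c =>
    ⟨fun h k hk l hl hkl => h.of_one h1 hi hj hk hl hkl, fun h => h hi hj hij⟩⟩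

theorem exists_basis_containsEdge_one {o : ι} {I : Set ι}
    (h : ∀ i ∈ I, i ≠ o → ∃ c, ContainsEdge G b o i c) :
    ∃ b' : Basis ι K V, (∀ i j c t, IsEdge b b.coord i j c t → ∃ c', IsEdge b' b'.coord i j c' t) ∧
      I.Pairwise (ContainsEdge G b' · · 1) := by
  classical
  have hF := isFrame_basis b
  choose c hc using h
  let w : ι → Kˣ := fun i =>
    if hi : i ∈ I ∧ i ≠ o then Units.mk0 (c i hi.1 hi.2) (hc i hi.1 hi.2).choose_spec.2.gain_ne
    else 1
  let b' := b.unitsSMul w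
  have hF' := isFrame_basis b'
  have hres i : IsRescaling (b i) (b.coord i) (b' i) (b'.coord i) :=
    ⟨w i, (w i).ne_zero, Basis.unitsSMul_apply i, by
      rw [Basis.coord_unitsSMul, Units.smul_def, Units.val_inv_eq_inv_val]⟩
  have hstar i (hi : i ∈ I) (hio : i ≠ o) : ContainsEdge G b' o i 1 := by
    obtain ⟨g, hg, hge⟩ := hc i hi hio
    obtain ⟨c', hge'⟩ := hge.exists_of_isRescaling hF hF' (hres o) (hres i)
    have hgo : c' • b' i = b' i := by
      rw [← hge'.apply_left hF', Basis.unitsSMul_apply, Basis.unitsSMul_apply]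
      simp [w, hi, hio, hge.apply_left hF, Units.smul_def]
    obtain rfl : c' = 1 := smul_left_injective K (b'.ne_zero i) (hgo.trans (one_smul K _).symm)
    exact ⟨g, hg, hge'⟩
  refine ⟨b', fun i j c t ht => ht.exists_of_isRescaling hF hF' (hres i) (hres j),
    fun i hi j hj hij => ?_⟩
  by_cases hio : i = o
  · exact hio ▸ hstar j hj (hio ▸ hij.symm)
  by_cases hjo : j = o
  · simpa [hjo] using (hstar i hi hio).symm
  simpa using (hstar i hi hio).symm.trans (hstar j hj hjo) hij

end Edges

section RootEdges

variable [CharP K 2] {n a : ℕ} {b : Basis (Fin n) K V}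

theorem ContainsRootEdges.exists_apply_eq_perm (hG : ContainsRootEdges G a b b.coord)
    (τ : Equiv.Perm (Fin n)) : ∃ p ∈ G, IsMonomialElement b a p ∧ ∀ i, p (b i) = b (τ i) := by
  have hF := isFrame_basis b
  have : FiniteDimensional K V := b.finiteDimensional_of_finite
  induction τ using Equiv.Perm.swap_induction_on with
  | one => exact ⟨1, one_mem _, (monomialGroup b a).one_mem, fun i => rfl⟩
  | swap_mul τ i j hij ih =>
    obtain ⟨p, hp, hpb, hpτ⟩ := ih
    obtain ⟨t, ht, hij⟩ := hG hij (one_pow a)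
    refine ⟨t * p, mul_mem ht hp, (hij.isMonomialElement (one_pow a)).mul hpb, fun k => ?_⟩
    rw [LinearEquiv.mul_apply, hpτ, Equiv.Perm.mul_apply]
    by_cases hi : τ k = i
    · rw [hi, Equiv.swap_apply_left, hij.apply_left hF, one_smul]
    by_cases hj : τ k = j
    · rw [hj, Equiv.swap_apply_right, hij.apply_right hF, inv_one, one_smul]
    · rw [Equiv.swap_apply_of_ne_of_ne hi hj, hij.apply_of_ne hF hi hj]

theorem ContainsRootEdges.exists_apply_eq_smul (hG : ContainsRootEdges G a b b.coord)
    {c : Fin n → K} (hc : ∀ i, c i ^ a = 1) {o : Fin n} {s : Finset (Fin n)} (ho : o ∉ s) :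
    ∃ q ∈ G, (∀ i ∈ s, q (b i) = c i • b i) ∧ (∀ i ∉ s, i ≠ o → q (b i) = b i) ∧
      q (b o) = (∏ i ∈ s, c i)⁻¹ • b o := by
  have hF := isFrame_basis b
  induction s using Finset.induction_on with
  | empty => exact ⟨1, one_mem _, by simp, fun i _ _ => rfl, by simp⟩
  | insert k s hk ih =>
    rw [Finset.mem_insert, not_or] at ho
    obtain ⟨hok, hos⟩ := ho
    obtain ⟨q, hq, hqs, hqne, hqo⟩ := ih hos
    obtain ⟨t, ht, htk⟩ := hG hok (hc k)
    obtain ⟨p, hp, hpk⟩ := hG hok (one_pow a)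
    have htp {i} (hi : i ≠ o) (hik : i ≠ k) : t (p (b i)) = b i := by
      rw [hpk.apply_of_ne hF hi hik, htk.apply_of_ne hF hi hik]
    refine ⟨t * p * q, mul_mem (mul_mem ht hp) hq, fun i hi => ?_, fun i hi hio => ?_, ?_⟩ <;>
      rw [LinearEquiv.mul_apply, LinearEquiv.mul_apply]
    · rcases Finset.mem_insert.1 hi with rfl | hi
      · rw [hqne _ hk (Ne.symm hok), hpk.apply_right hF, inv_one, one_smul, htk.apply_left hF]
      · rw [hqs i hi, map_smul, map_smul,
          htp (ne_of_mem_of_not_mem hi hos) (ne_of_mem_of_not_mem hi hk)]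
    · rw [Finset.mem_insert, not_or] at hi
      rw [hqne i hi.2 hio, htp hio hi.1]
    · rw [hqo, map_smul, map_smul, hpk.apply_left hF, one_smul, htk.apply_right hF, smul_smul,
        Finset.prod_insert hk, mul_inv_rev]

theorem ContainsRootEdges.mem_of_apply_eq_smul (hG : ContainsRootEdges G a b b.coord)
    {c : Fin n → K} (hc : ∀ i, c i ^ a = 1) (hdet : LinearMap.det (g : V →ₗ[K] V) = 1)
    (hg : ∀ i, g (b i) = c i • b i) : g ∈ G := by
  have hprod : ∏ i, c i = 1 := by rw [← det_eq_prod_of_apply_eq_smul hg, hdet]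
  rcases isEmpty_or_nonempty (Fin n) with hn | ⟨⟨o⟩⟩
  · have hg1 : g = 1 := LinearEquiv.toLinearMap_injective (b.ext fun i => hn.elim i)
    exact hg1 ▸ one_mem _
  obtain ⟨q, hq, hqne, -, hqo⟩ := hG.exists_apply_eq_smul hc (Finset.notMem_erase o Finset.univ)
  have hqo' : q (b o) = c o • b o := by
    have hmul := Finset.mul_prod_erase Finset.univ c (Finset.mem_univ o)
    rw [hqo, eq_inv_of_mul_eq_one_left (hmul.trans hprod)]
  have hgq : g = q := by
    refine LinearEquiv.toLinearMap_injective (b.ext fun i => ?_)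
    rw [LinearEquiv.coe_coe, LinearEquiv.coe_coe, hg]
    rcases eq_or_ne i o with rfl | hi
    · exact hqo'.symm
    · exact (hqne i (Finset.mem_erase.2 ⟨hi, Finset.mem_univ i⟩)).symm
  exact hgq ▸ hq

theorem ContainsRootEdges.mem_of_isMonomialElement (hG : ContainsRootEdges G a b b.coord)
    (hg : IsMonomialElement b a g) : g ∈ G := by
  obtain ⟨-, σ, c, hc, hgb⟩ := id hg
  obtain ⟨p, hp, hpb, hpσ⟩ := hG.exists_apply_eq_perm σ⁻¹
  refine (mul_mem_cancel_left hp).1 (hG.mem_of_apply_eq_smul hc (hpb.mul hg).1 fun i => ?_)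
  rw [LinearEquiv.mul_apply, hgb, map_smul, hpσ, Equiv.Perm.coe_inv, Equiv.symm_apply_apply]

end RootEdges

section DenseEdges

theorem mem_iff_pow_natCard_eq_one [Finite K] (H : Subgroup Kˣ) (x : Kˣ) :
    x ∈ H ↔ x ^ Nat.card H = 1 := by
  have hle : H ≤ rootsOfUnity (Nat.card H) K := fun y hy =>
    congrArg Subtype.val (pow_card_eq_one' (x := (⟨y, hy⟩ : H)))
  have : NeZero (Nat.card H) := ⟨Nat.card_pos.ne'⟩
  rw [← mem_rootsOfUnity, ← Subgroup.eq_of_le_of_card_ge hle (card_rootsOfUnity _ _)]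

variable {n : ℕ} {b : Basis (Fin n) K V}
  {v : (V ≃ₗ[K] V) → V} {φ : (V ≃ₗ[K] V) → Dual K V}

theorem exists_isEdge_of_ne (hv : IsPresentation T v φ) (hd : IsDense T)
    (hb : ∀ t ∈ T, IsEdgeOf b b.coord t) {i j : Fin n} (hij : i ≠ j) :
    ∃ t ∈ T, ∃ c, IsEdge b b.coord i j c t := by
  have hF := isFrame_basis b
  obtain ⟨t, ht, hi, hj⟩ :=
    hv.exists_covec_ne_and_apply_vec_ne hd (hF.vec_ne i) (hF.covec_ne j)
  obtain ⟨_, _, _, h⟩ := hb t ht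
  obtain ⟨k, c, hk⟩ := h.exists_left_of_apply_ne hF (hv t ht) hi
  suffices j = k from ⟨t, ht, c, this ▸ hk⟩
  by_contra hjk
  obtain ⟨x, -, hvt, -⟩ := ((hv t ht).isRescaling hk.apply).symm
  refine hj ?_
  rw [hvt, map_smul, map_add, map_smul, hF.ne j i hij.symm, hF.ne j k hjk]
  simp

variable [CharP K 2]

theorem exists_isEdge_gain_ne_one (hv : IsPresentation T v φ) (hd : IsDense T) [Nontrivial V]
    (hb : ∀ t ∈ T, IsEdgeOf b b.coord t) : ∃ t ∈ T, ∃ i j c, IsEdge b b.coord i j c t ∧ c ≠ 1 := by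
  have hF := isFrame_basis b
  obtain ⟨o⟩ := b.index_nonempty
  have hsum i : b.coord i (∑ j, b j) = 1 := by
    rw [map_sum, Fintype.sum_eq_single i fun j hj => hF.ne i j hj.symm, hF.self]
  have hne : ∑ j, b j ≠ 0 := fun h0 => by
    have := hsum o
    simp [h0] at this
  obtain ⟨t, ht, hφ, -⟩ := hv.exists_covec_ne_and_apply_vec_ne hd hne (hF.covec_ne o)
  obtain ⟨i, j, c, hij⟩ := hb t ht
  refine ⟨t, ht, i, j, c, hij, ?_⟩
  rintro rfl
  obtain ⟨x, -, -, hφt⟩ := ((hv t ht).isRescaling hij.apply).symm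
  refine hφ ?_
  rw [hφt, LinearMap.smul_apply, LinearMap.add_apply, LinearMap.smul_apply, hsum, hsum, inv_one,
    one_smul, CharTwo.add_self_eq_zero, smul_zero]

variable [Finite K]

theorem closure_eq_monomialGroup (H : Subgroup Kˣ)
    (hT : ∀ t ∈ T, ∃ i j, ∃ c ∈ H, IsEdge b b.coord i j (c : K) t)
    (hH : ∀ i j, i ≠ j → ∀ c ∈ H, ContainsEdge (Subgroup.closure T) b i j (c : K)) :
    Subgroup.closure T = monomialGroup b (Nat.card H) := by
  have : FiniteDimensional K V := b.finiteDimensional_of_finite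
  have hroot (c : Kˣ) : c ∈ H ↔ (c : K) ^ Nat.card H = 1 := by
    rw [mem_iff_pow_natCard_eq_one, Units.ext_iff, Units.val_pow_eq_pow_val, Units.val_one]
  refine le_antisymm ((Subgroup.closure_le _).2 fun t ht => ?_) fun g hg => ?_
  · obtain ⟨i, j, c, hc, h⟩ := hT t ht
    exact h.isMonomialElement ((hroot c).1 hc)
  · refine ContainsRootEdges.mem_of_isMonomialElement (fun i j c hij hc => ?_) hg
    lift c to Kˣ using IsUnit.of_pow_eq_one hc Nat.card_pos.ne'
    exact hH i j hij c ((hroot c).2 hc)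

theorem hasMonomialType_closure_of_isEdge {H : Subgroup Kˣ} (hbot : H ≠ ⊥)
    (hn : 2 ≤ finrank K V) (hT : ∀ t ∈ T, ∃ i j, ∃ c ∈ H, IsEdge b b.coord i j (c : K) t)
    (hH : ∀ i j, i ≠ j → ∀ c ∈ H, ContainsEdge (Subgroup.closure T) b i j (c : K)) :
    HasMonomialType (Subgroup.closure T) := by
  refine ⟨inferInstance, n, by rwa [finrank_eq_card_basis b, Fintype.card_fin] at hn, Nat.card H,
    (Subgroup.one_lt_card_iff_ne_bot H).2 hbot, ?_, b, fun g => ?_⟩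
  · rw [← Nat.card_units]
    exact Subgroup.card_subgroup_dvd_card H
  · rw [closure_eq_monomialGroup H hT hH]
    rfl

theorem hasMonomialType_closure [Nontrivial V] (hv : IsPresentation T v φ) (hd : IsDense T)
    (hn : 2 ≤ finrank K V) (hb : ∀ t ∈ T, IsEdgeOf b b.coord t) :
    HasMonomialType (Subgroup.closure T) := by
  obtain ⟨o⟩ := b.index_nonempty
  obtain ⟨b', hbb', h1⟩ := exists_basis_containsEdge_one (G := Subgroup.closure T) (o := o)
    (I := Set.univ) fun i _ hi => by
      obtain ⟨t, ht, c, h⟩ := exists_isEdge_of_ne hv hd hb hi.symm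
      exact ⟨c, t, Subgroup.subset_closure ht, h⟩
  have hb' : ∀ t ∈ T, IsEdgeOf b' b'.coord t := fun t ht => by
    obtain ⟨i, j, c, h⟩ := hb t ht
    exact ⟨i, j, hbb' i j c t h⟩
  obtain ⟨H, hH⟩ := exists_subgroup_containsEdge_iff h1
  have hgain {t i j} {c : Kˣ} (ht : t ∈ T) (h : IsEdge b' b'.coord i j c t) : c ∈ H :=
    (hH trivial trivial h.index_ne c).1 ⟨t, Subgroup.subset_closure ht, h⟩
  refine hasMonomialType_closure_of_isEdge (H := H) (b := b') ?_ hn (fun t ht => ?_)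
    fun i j hij c hc => (hH trivial trivial hij c).2 hc
  · rintro rfl
    obtain ⟨t, ht, i, j, c, h, hc⟩ := exists_isEdge_gain_ne_one hv hd hb'
    lift c to Kˣ using h.gain_ne.isUnit
    exact hc (congrArg Units.val (Subgroup.mem_bot.1 (hgain ht h)))
  · obtain ⟨i, j, c, h⟩ := hb' t ht
    lift c to Kˣ using h.gain_ne.isUnit
    exact ⟨i, j, c, hgain ht h, h⟩

end DenseEdges

end MonomialGroups

section LocalToGlobal

variable {S S' T : Set (V ≃ₗ[K] V)} {v : (V ≃ₗ[K] V) → V} {φ : (V ≃ₗ[K] V) → Dual K V} {N : ℕ}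

/-- Condition (b) of the theorem for the subsets of `T` with at most `N` elements. -/
def IsLocallyStandard (T : Set (V ≃ₗ[K] V)) (N : ℕ) : Prop :=
  ∀ S ⊆ T, S.encard ≤ N → 2 ≤ finrank K (commutatorSpace (Subgroup.closure S)) →
    IsIrreducibleGroup (commutatorAction (Subgroup.closure S)) →
      HasMonomialType (commutatorAction (Subgroup.closure S)) ∨
        HasOddSymmetricType (commutatorAction (Subgroup.closure S))

/-- `S` is an irreducible system in `T` such that every irreducible system in `T` that contains `S`
and has at most `N` elements generates a group of monomial type. -/
structure IsMonomialSeed (T : Set (V ≃ₗ[K] V)) (v : (V ≃ₗ[K] V) → V)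
    (φ : (V ≃ₗ[K] V) → Dual K V) (N : ℕ) (S : Set (V ≃ₗ[K] V)) : Prop where
  subset : S ⊆ T
  isIrreducibleSystem : IsIrreducibleSystem S v φ
  hasMonomialType : ∀ S' ⊆ T, S ⊆ S' → IsIrreducibleSystem S' v φ → S'.encard ≤ N →
    HasMonomialType (commutatorAction (Subgroup.closure S'))

theorem IsMonomialSeed.extend (h : IsMonomialSeed T v φ N S) (hS' : S' ⊆ T) (hSS' : S ⊆ S')
    (hirr : IsIrreducibleSystem S' v φ) : IsMonomialSeed T v φ N S' :=
  ⟨hS', hirr, fun S'' h₁ h₂ => h.hasMonomialType S'' h₁ (hSS'.trans h₂)⟩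

theorem IsPresentation.exists_finset_finrank_vecSpan_eq [FiniteDimensional K V]
    (hv : IsPresentation T v φ) {m : ℕ} (hm : m ≤ finrank K (vecSpan T)) :
    ∃ A : Finset (V ≃ₗ[K] V), ↑A ⊆ T ∧ A.card = m ∧
      finrank K (vecSpan (A : Set (V ≃ₗ[K] V))) = m := by
  have hspan {A : Finset (V ≃ₗ[K] V)} (hAT : ↑A ⊆ T)
      (hA : LinearIndepOn K v (A : Set (V ≃ₗ[K] V))) :
      finrank K (vecSpan (A : Set (V ≃ₗ[K] V))) = A.card := by
    rw [(hv.mono hAT).vecSpan_eq, Set.image_eq_range]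
    exact (finrank_span_eq_card hA).trans (Fintype.card_coe A)
  obtain ⟨B, hBT, -, hTB, hB⟩ := exists_linearIndepOn_extension (linearIndepOn_empty K v)
    (Set.empty_subset T)
  have hBfin : B.Finite := hB.linearIndependent.finite
  lift B to Finset (V ≃ₗ[K] V) using hBfin
  have hcard : m ≤ B.card := by
    rw [← hspan hBT hB]
    refine hm.trans (Submodule.finrank_mono ?_)
    rwa [hv.vecSpan_eq, (hv.mono hBT).vecSpan_eq, Submodule.span_le]
  obtain ⟨A, hAB, rfl⟩ := Finset.exists_subset_card_eq hcard
  have hAB' : (A : Set (V ≃ₗ[K] V)) ⊆ B := Finset.coe_subset.2 hAB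
  exact ⟨A, hAB'.trans hBT, rfl, hspan (hAB'.trans hBT) (hB.mono hAB')⟩

variable [FiniteDimensional K V]

theorem IsLocallyStandard.hasMonomialType_or (h : IsLocallyStandard T N)
    (hS : IsIrreducibleSystem S v φ) (hST : S ⊆ T) (hcard : S.encard ≤ N) :
    HasMonomialType (commutatorAction (Subgroup.closure S)) ∨
      HasOddSymmetricType (commutatorAction (Subgroup.closure S)) :=
  h S hST hcard hS.two_le_finrank hS.isIrreducibleGroup

section Seed

variable [Nontrivial V] (hv : IsPresentation T v φ) (hd : IsDense T)
  (hN : IsLocallyNondegenerate T N)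
include hv hd hN

theorem exists_isIrreducibleSystem_superset (A : Finset (V ≃ₗ[K] V)) (hA : ↑A ⊆ T)
    (hcard : 2 + 6 * A.card ≤ N) :
    ∃ S ⊆ T, ↑A ⊆ S ∧ IsIrreducibleSystem S v φ ∧ S.encard ≤ (2 + 6 * A.card : ℕ) := by
  obtain ⟨x, hx⟩ := exists_ne (0 : V)
  obtain ⟨ψ, hψ⟩ := exists_ne (0 : Dual K V)
  obtain ⟨t, ht, -⟩ := hv.exists_covec_ne_and_apply_vec_ne hd hx hψ
  obtain ⟨S₀, hS₀T, -, hS₀, hcard₀⟩ := exists_isIrreducibleSystem_mem hv hd hN (by omega) ht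
  have hcard₁ : S₀.encard + (6 * A.card : ℕ) ≤ (2 + 6 * A.card : ℕ) := by
    rw [Nat.cast_add]
    gcongr
    exact hcard₀
  obtain ⟨S, hST, -, hAS, hS, hcard₂⟩ := hS₀.exists_extend hv hd hN hS₀T A hA
    (hcard₁.trans (by exact_mod_cast hcard))
  exact ⟨S, hST, hAS, hS, hcard₂.trans hcard₁⟩

theorem IsLocallyStandard.charP_two (h : IsLocallyStandard T N) (h2N : 2 ≤ N) : CharP K 2 := by
  obtain ⟨S, hST, -, hS, hcard⟩ := exists_isIrreducibleSystem_superset hv hd hN ∅ (by simp) h2N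
  exact (h.hasMonomialType_or hS hST (hcard.trans (by exact_mod_cast h2N))).elim (·.1) (·.1)

theorem IsLocallyStandard.exists_isMonomialSeed (h : IsLocallyStandard T N) (h56N : 56 ≤ N)
    (hsymp : ¬ PreservesSymplecticForm (Subgroup.closure T)) :
    ∃ S, IsMonomialSeed T v φ N S ∧ min 4 (finrank K V) ≤ finrank K (vecSpan S) ∧
      S.encard ≤ 56 := by
  classical
  obtain ⟨A, hAT, hA5, hA⟩ : ∃ A : Finset (V ≃ₗ[K] V), ↑A ⊆ T ∧ A.card ≤ 5 ∧
      ¬ IsSkewSymmetrizable (A : Set (V ≃ₗ[K] V)) v φ := by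
    by_contra! hskew
    exact hsymp ((isSkewSymmetrizable_of_forall_card_le_five hv hd hskew).preservesSymplecticForm
      hv hd)
  obtain ⟨B, hBT, hB4, hB⟩ := hv.exists_finset_finrank_vecSpan_eq (m := min 4 (finrank K V))
    (by rw [hv.vecSpan_eq_top hd, finrank_top]; exact min_le_right _ _)
  have hcardAB : 2 + 6 * (A ∪ B).card ≤ 56 := by
    have := Finset.card_union_le A B
    omega
  obtain ⟨S, hST, hABS, hS, hcard⟩ := exists_isIrreducibleSystem_superset hv hd hN (A ∪ B)
    (by rw [Finset.coe_union]; exact Set.union_subset hAT hBT) (hcardAB.trans h56N)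
  rw [Finset.coe_union, Set.union_subset_iff] at hABS
  refine ⟨S, ⟨hST, hS, fun S' hS'T hSS' hS' hS'N => ?_⟩, ?_,
    hcard.trans (by exact_mod_cast hcardAB)⟩
  · exact (h.hasMonomialType_or hS' hS'T hS'N).resolve_right fun hodd =>
      hA ((hS'.isSkewSymmetrizable hodd.preservesSymplecticForm).mono (hABS.1.trans hSS'))
  · rw [← hB]
    exact Submodule.finrank_mono (vecSpan_mono hABS.2)

omit [Nontrivial V] in
theorem IsMonomialSeed.hasLocalFrames (h : IsMonomialSeed T v φ N S) (hcard : S.encard + 18 ≤ N)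
    {e₀ : V} {f₀ : Dual K V}
    (hvert : ∀ (d : ℕ) (e : Fin d → V) (f : Fin d → Dual K V),
      IsFrameFor (Subgroup.closure S) e f → ∃ m, IsRescaling e₀ f₀ (e m) (f m)) :
    HasLocalFrames T e₀ f₀ := by
  classical
  intro t₁ ht₁ t₂ ht₂ t₃ ht₃
  have hcard₃ : S.encard + (6 * ({t₁, t₂, t₃} : Finset (V ≃ₗ[K] V)).card : ℕ) ≤ N := by
    refine le_trans ?_ hcard
    gcongr
    have := Finset.card_le_three (a := t₁) (b := t₂) (c := t₃)
    exact_mod_cast (by omega : 6 * _ ≤ 18)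
  obtain ⟨S', hS'T, hSS', htS', hS', hcard'⟩ := h.isIrreducibleSystem.exists_extend hv hd hN
    h.subset {t₁, t₂, t₃} (by simp [Set.insert_subset_iff, ht₁, ht₂, ht₃]) hcard₃
  obtain ⟨d, a, e, f, -, -, -, hF, -, -⟩ := hS'.exists_isFrameFor
    (h.hasMonomialType S' hS'T hSS' hS' (hcard'.trans hcard₃))
  obtain ⟨m, hm⟩ := hvert d e f (hF.mono (Subgroup.closure_mono hSS'))
  have hedge {t : V ≃ₗ[K] V} (ht : t ∈ ({t₁, t₂, t₃} : Finset (V ≃ₗ[K] V))) : IsEdgeOf e f t :=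
    hF.isEdgeOf t (Subgroup.subset_closure (htS' ht)) _ _ (hv t (hS'T (htS' ht)))
  exact ⟨d, e, f, m, hF.isFrame, hm, hedge (by simp), hedge (by simp), hedge (by simp)⟩

theorem IsMonomialSeed.hasMonomialType_closure [Finite K] [CharP K 2] (hn : 2 ≤ finrank K V)
    (h : IsMonomialSeed T v φ N S) (hcard : S.encard + 18 ≤ N) {d a : ℕ} {e : Fin d → V}
    {f : Fin d → Dual K V} (hd2 : 2 ≤ d) (ha : 1 < a) (hadvd : a ∣ Nat.card K - 1)
    (hF : IsFrame e f) (hG : ContainsRootEdges (Subgroup.closure S) a e f)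
    (had : a ≠ 3 ∨ 4 ≤ d) : HasMonomialType (Subgroup.closure T) := by
  obtain ⟨i, hi⟩ := hG.exists_common_vertex hF hd2 ha hadvd had
  obtain ⟨n, b, hb⟩ := (h.hasLocalFrames hv hd hN hcard hi).exists_basis hv hd (hF.self i)
  exact TransvectionGroups.hasMonomialType_closure hv hd hn hb

theorem IsMonomialSeed.hasMonomialType_closure_of_eq_monomialGroup [Finite K] [CharP K 2]
    (hn : 2 ≤ finrank K V) (h : IsMonomialSeed T v φ N S) (hcard : S.encard + 24 ≤ N)
    (htop : vecSpan S = ⊤) {d : ℕ} {b : Basis (Fin d) K V} (h3 : 3 ∣ Nat.card K - 1)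
    (hb : Subgroup.closure S = monomialGroup b 3) : HasMonomialType (Subgroup.closure T) := by
  have hdn : d = finrank K V := by rw [finrank_eq_card_basis b, Fintype.card_fin]
  by_cases hTS : T ⊆ Subgroup.closure S
  · rw [le_antisymm ((Subgroup.closure_le _).2 hTS) (Subgroup.closure_mono h.subset), hb]
    exact ⟨inferInstance, d, hdn ▸ hn, 3, by norm_num, h3, b, fun _ => Iff.rfl⟩
  obtain ⟨t, ht, htS⟩ := Set.not_subset.1 hTS
  have hcard' : S.encard + 6 + 18 ≤ N := by
    rw [add_assoc]
    exact hcard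
  obtain ⟨S', hS'T, hSS', htS', hS', hcardS'⟩ := h.isIrreducibleSystem.exists_extend_mem hv hd hN
    h.subset ht (le_self_add.trans hcard')
  have hseed := h.extend hS'T hSS' hS'
  have hcardS'18 : S'.encard + 18 ≤ N := (add_le_add_left hcardS' 18).trans hcard'
  obtain ⟨d', a', e', f', hd', ha', hadvd', hF', hG', hbasis⟩ := hS'.exists_isFrameFor
    (hseed.hasMonomialType S' hS'T le_rfl hS' (le_self_add.trans hcardS'18))
  have htop' : vecSpan S' = ⊤ := eq_top_iff.2 (htop ▸ vecSpan_mono hSS')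
  obtain ⟨b', hb'⟩ := hbasis htop'
  obtain rfl : d' = d := by rw [hd', hdn, htop', finrank_top]
  refine hseed.hasMonomialType_closure hv hd hN hn hcardS'18 (hdn ▸ hn) ha' hadvd' hF'.isFrame hG'
    (.inl ?_)
  rintro rfl
  have hle : monomialGroup b 3 ≤ monomialGroup b' 3 := fun g hg =>
    (hb' g).1 (Subgroup.closure_mono hSS' (hb ▸ hg))
  have htb' : t ∈ monomialGroup b' 3 := (hb' t).1 (Subgroup.subset_closure htS')
  rw [← monomialGroup_eq_of_le hle, ← hb] at htb'
  exact htS htb'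

end Seed

theorem hasMonomialType_closure_of_isLocallyStandard [Finite K] (hn : 2 ≤ finrank K V)
    (hT : ∀ t ∈ T, IsTransvection t) (hd : IsDense T)
    (hsymp : ¬ PreservesSymplecticForm (Subgroup.closure T)) (h80N : 80 ≤ N)
    (hN : IsLocallyNondegenerate T N) (h : IsLocallyStandard T N) :
    HasMonomialType (Subgroup.closure T) := by
  have : Nontrivial V := finrank_pos_iff.1 (two_pos.trans_le hn)
  obtain ⟨v, φ, hv⟩ := exists_isPresentation hT
  have : CharP K 2 := h.charP_two hv hd hN (by omega)
  obtain ⟨S, hS, hdim, hcard⟩ := h.exists_isMonomialSeed hv hd hN (by omega) hsymp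
  have hcardN {k : ℕ} (hk : k ≤ 24) : S.encard + k ≤ N :=
    (add_le_add_left hcard _).trans (by exact_mod_cast (by omega : 56 + k ≤ N))
  have hirr := hS.isIrreducibleSystem
  obtain ⟨d, a, e, f, rfl, ha, hadvd, hF, hG, hbasis⟩ := hirr.exists_isFrameFor
    (hS.hasMonomialType S hS.subset le_rfl hirr (by simpa using hcardN (Nat.zero_le _)))
  by_cases had : a ≠ 3 ∨ 4 ≤ finrank K (vecSpan S)
  · exact hS.hasMonomialType_closure hv hd hN hn (hcardN (by norm_num)) (by omega) ha hadvd
      hF.isFrame hG had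
  · obtain ⟨rfl, hlt⟩ : a = 3 ∧ finrank K (vecSpan S) < 4 := by simpa using had
    have htop : vecSpan S = ⊤ := Submodule.eq_top_of_finrank_eq
      (le_antisymm (Submodule.finrank_le _) (by omega))
    obtain ⟨b, hb⟩ := hbasis htop
    exact hS.hasMonomialType_closure_of_eq_monomialGroup hv hd hN hn (hcardN le_rfl) htop hadvd
      (Subgroup.ext hb)

end LocalToGlobal

section EdgesOfABasis

variable {S T : Set (V ≃ₗ[K] V)}

section Nondegeneracy

theorem flip_injective_iff_of_finrank_eq {U W : Type*} [AddCommGroup U] [Module K U]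
    [FiniteDimensional K U] [AddCommGroup W] [Module K W] [FiniteDimensional K W]
    (h : finrank K U = finrank K W) (B : U →ₗ[K] W →ₗ[K] K) :
    Function.Injective B.flip ↔ Function.Injective B := by
  have hdim : finrank K U = finrank K (W →ₗ[K] K) := h.trans Subspace.dual_finrank_eq.symm
  rw [LinearMap.flip_injective_iff₁, LinearMap.injective_iff_surjective_of_finrank_eq_finrank hdim]

theorem isNondegenerate_of_finrank_eq [FiniteDimensional K V]
    (h : finrank K (vecSpan S) = finrank K (covecSpan S)) (hw : IsWeaklyNondegenerate S) :
    IsNondegenerate S := by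
  let π : covecSpan S →ₗ[K] vecSpan S →ₗ[K] K :=
    (vecSpan S).dualRestrict ∘ₗ (covecSpan S).subtype
  have hright : ZeroRightKernel S ↔ Function.Injective π := by
    rw [injective_iff_map_eq_zero]
    exact ⟨fun hS ψ hψ => Subtype.ext (hS ψ ψ.2 fun x hx => LinearMap.congr_fun hψ ⟨x, hx⟩),
      fun hπ ψ hψ h0 => congrArg Subtype.val (hπ ⟨ψ, hψ⟩ (LinearMap.ext fun x => h0 x x.2))⟩
  have hleft : ZeroLeftKernel S ↔ Function.Injective π.flip := by
    rw [injective_iff_map_eq_zero]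
    exact ⟨fun hS x hx => Subtype.ext (hS x x.2 fun ψ hψ => LinearMap.congr_fun hx ⟨ψ, hψ⟩),
      fun hπ x hx h0 => congrArg Subtype.val (hπ ⟨x, hx⟩ (LinearMap.ext fun ψ => h0 ψ ψ.2))⟩
  have hiff := flip_injective_iff_of_finrank_eq (K := K) (U := covecSpan S) (W := vecSpan S)
    h.symm π
  rw [IsWeaklyNondegenerate, hleft, hright, hiff, or_self] at hw
  rw [IsNondegenerate, hleft, hright, hiff]
  exact ⟨hw, hw⟩

variable {ι : Type*} {b : Basis ι K V}

/-- The bijection from `V*` to `V` that inverts all coordinates with respect to the basis `b` and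
its dual basis, with the convention `0⁻¹ = 0`. -/
noncomputable def coordInv [Finite ι] (b : Basis ι K V) : Dual K V ≃ V :=
  ((b.constr K).symm.toEquiv.trans (Equiv.inv (ι → K))).trans b.equivFun.symm.toEquiv

theorem coord_coordInv [Finite ι] (ψ : Dual K V) (i : ι) :
    b.coord i (coordInv b ψ) = (ψ (b i))⁻¹ := by
  rw [Basis.coord_apply, ← b.equivFun_apply]
  exact congrFun (b.equivFun.apply_symm_apply _) i

theorem IsEdge.apply_vec_eq_zero_iff [Finite ι] [CharP K 2] {i j : ι} {c : K} {t : V ≃ₗ[K] V}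
    {u : V} {χ : Dual K V} (h : IsEdge b b.coord i j c t) (ht : IsTransvectionAlong t u χ)
    (ψ : Dual K V) : ψ u = 0 ↔ χ (coordInv b ψ) = 0 := by
  have hr := ht.isRescaling h.apply
  rw [← (IsRescaling.refl u ψ).apply_eq_zero_iff hr,
    ← hr.apply_eq_zero_iff (IsRescaling.refl (coordInv b ψ) 0)]
  simp only [map_add, map_smul, LinearMap.add_apply, LinearMap.smul_apply, coord_coordInv,
    smul_eq_mul]
  rw [CharTwo.add_eq_zero, CharTwo.add_eq_zero, ← mul_inv, inv_inj]

theorem finrank_vecSpan_eq_finrank_covecSpan [Finite ι] [Finite K] [CharP K 2]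
    (hT : ∀ t ∈ T, IsTransvection t) (hb : ∀ t ∈ T, IsEdgeOf b b.coord t) :
    finrank K (vecSpan T) = finrank K (covecSpan T) := by
  have : FiniteDimensional K V := b.finiteDimensional_of_finite
  obtain ⟨v, φ, hv⟩ := exists_isPresentation hT
  have hmem ψ : ψ ∈ (vecSpan T).dualAnnihilator ↔
      coordInv b ψ ∈ (covecSpan T).dualCoannihilator := by
    rw [Submodule.mem_dualAnnihilator, Submodule.mem_dualCoannihilator, hv.forall_vecSpan_iff,
      hv.forall_covecSpan_iff]
    refine forall₂_congr fun t ht => ?_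
    obtain ⟨i, j, c, h⟩ := hb t ht
    exact h.apply_vec_eq_zero_iff (hv t ht) ψ
  have hcard := Nat.card_congr ((coordInv b).subtypeEquiv hmem)
  rw [Module.natCard_eq_pow_finrank (K := K) (V := (vecSpan T).dualAnnihilator),
    Module.natCard_eq_pow_finrank (K := K) (V := (covecSpan T).dualCoannihilator)] at hcard
  have hfinrank := Nat.pow_right_injective Finite.one_lt_card hcard
  have hV := Subspace.finrank_add_finrank_dualAnnihilator_eq (vecSpan T)
  have hV' := Subspace.finrank_add_finrank_dualCoannihilator_eq (covecSpan T)
  omega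

end Nondegeneracy

theorem HasMonomialType.exists_isEdgeOf [FiniteDimensional K V]
    (h : HasMonomialType (Subgroup.closure T)) (hT : ∀ t ∈ T, IsTransvection t) :
    ∃ (n : ℕ) (b : Basis (Fin n) K V), ∀ t ∈ T, IsEdgeOf b b.coord t := by
  obtain ⟨_, n, -, a, -, -, b, hb⟩ := h
  obtain ⟨v, φ, hv⟩ := exists_isPresentation hT
  refine ⟨n, b, fun t ht => (hv t ht).isEdgeOf (isFrame_basis b) (fun i => ?_) fun x hx => ?_⟩
  · obtain ⟨-, σ, c, -, hc⟩ := (hb t).1 (Subgroup.subset_closure ht)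
    exact ⟨σ i, c i, hc i⟩
  · have hx0 : x = 0 := b.ext_elem fun i => (hx i).trans (by simp)
    rw [hx0, map_zero]

end EdgesOfABasis

section Components

variable {S : Set (V ≃ₗ[K] V)} {G : Subgroup (V ≃ₗ[K] V)}

theorem apply_mem_of_mem_closure [FiniteDimensional K V] {U : Submodule K V}
    (hU : ∀ t ∈ S, ∀ x ∈ U, t x ∈ U) {g : V ≃ₗ[K] V} (hg : g ∈ Subgroup.closure S) {x : V}
    (hx : x ∈ U) : g x ∈ U := by
  induction hg using Subgroup.closure_induction generalizing x with
  | mem t ht => exact hU t ht x hx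
  | one => exact hx
  | mul _ _ _ _ ha hb => exact ha (hb hx)
  | inv a _ ha =>
    have hmap : U.map (a : V →ₗ[K] V) = U :=
      Submodule.eq_of_le_of_finrank_eq (Submodule.map_le_iff_le_comap.2 fun _ => ha)
        (LinearEquiv.finrank_map_eq a U)
    obtain ⟨y, hy, rfl⟩ := hmap.symm ▸ hx
    exact (a.symm_apply_apply y).symm ▸ hy

theorem commutatorSpace_le_of_isIrreducibleGroup (hG : IsIrreducibleGroup (commutatorAction G))
    {U : Submodule K V} (hU : ∀ g ∈ G, ∀ x ∈ U, g x ∈ U) {y : V} (hyU : y ∈ U)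
    (hy : y ∈ commutatorSpace G) (hy0 : y ≠ 0) : commutatorSpace G ≤ U := by
  refine Submodule.comap_subtype_eq_top.1 ((hG.2 (U.comap (commutatorSpace G).subtype)
    ?_).resolve_left fun hbot => ?_)
  · rintro h ⟨g, hg, hgh⟩ w hw
    rw [Submodule.mem_comap, Submodule.subtype_apply, hgh]
    exact hU g hg w hw
  · have hmem : (⟨y, hy⟩ : commutatorSpace G) ∈ U.comap (commutatorSpace G).subtype := hyU
    rw [hbot, Submodule.mem_bot] at hmem
    exact hy0 (congrArg Subtype.val hmem)

theorem finrank_le_one_of_isIrreducibleGroup (hG : IsIrreducibleGroup G) {x : V} (hx : x ≠ 0)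
    (hfix : ∀ g ∈ G, g x = x) : finrank K V ≤ 1 := by
  have hspan : Submodule.span K {x} = ⊤ := by
    refine (hG.2 _ fun g hg w hw => ?_).resolve_left (mt Submodule.span_singleton_eq_bot.1 hx)
    obtain ⟨c, rfl⟩ := Submodule.mem_span_singleton.1 hw
    rwa [map_smul, hfix g hg]
  rw [← finrank_top, ← hspan, finrank_span_singleton hx]

variable {ι : Type*} {b : Basis ι K V}

theorem IsEdge.apply_mem_of_mem_iff {i j : ι} {c : K} {t : V ≃ₗ[K] V}
    (h : IsEdge b b.coord i j c t) {I : Set ι} (hij : i ∈ I ↔ j ∈ I) {x : V}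
    (hx : ∀ k ∉ I, b.coord k x = 0) : ∀ k ∉ I, b.coord k (t x) = 0 := by
  intro k hk
  have hF := isFrame_basis b
  rw [h.apply, map_add, hx k hk, zero_add, map_smul, smul_eq_zero, or_iff_not_imp_right]
  intro hne
  have hi : i ∉ I := fun hi => hne (by
    rw [map_add, map_smul, hF.ne k i fun h => hk (h ▸ hi), hF.ne k j fun h => hk (h ▸ hij.1 hi),
      smul_zero, add_zero])
  rw [LinearMap.add_apply, LinearMap.smul_apply, hx i hi, hx j (mt hij.2 hi), smul_zero, add_zero]

variable [CharP K 2]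

theorem ContainsEdge.exists_trans {o i j : ι} {c : K} (ho : i = o ∨ ∃ a, ContainsEdge G b o i a)
    (h : ContainsEdge G b i j c) : j = o ∨ ∃ a, ContainsEdge G b o j a := by
  rcases eq_or_ne j o with hj | hj
  · exact .inl hj
  · rcases ho with rfl | ⟨a, ha⟩
    · exact .inr ⟨c, h⟩
    · exact .inr ⟨_, ha.trans h hj.symm⟩

theorem exists_component [FiniteDimensional K V] (hb : ∀ t ∈ S, IsEdgeOf b b.coord t)
    (hirr : IsIrreducibleGroup (commutatorAction (Subgroup.closure S))) :
    ∃ (o : ι) (I : Set ι), I.Nontrivial ∧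
      (∀ i ∈ I, i ≠ o → ∃ c, ContainsEdge (Subgroup.closure S) b o i c) ∧
      ∀ t ∈ S, ∀ i j c, IsEdge b b.coord i j c t → i ∈ I := by
  have hF := isFrame_basis b
  obtain ⟨t₀, ht₀⟩ : S.Nonempty := by
    by_contra! hS
    subst hS
    exact Submodule.nontrivial_iff_ne_bot.1 hirr.1
      (le_bot_iff.1 (commutatorSpace_closure_le (by simp)))
  obtain ⟨o, j, c, h₀⟩ := hb t₀ ht₀
  let I : Set ι := {i | i = o ∨ ∃ c, ContainsEdge (Subgroup.closure S) b o i c}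
  have hj : j ∈ I := .inr ⟨c, t₀, Subgroup.subset_closure ht₀, h₀⟩
  have hstep {t i j c} (ht : t ∈ S) (h : IsEdge b b.coord i j c t) : i ∈ I ↔ j ∈ I :=
    ⟨fun hi => ContainsEdge.exists_trans hi ⟨t, Subgroup.subset_closure ht, h⟩,
      fun hj => ContainsEdge.exists_trans hj ⟨t, Subgroup.subset_closure ht, h.symm⟩⟩
  let U : Submodule K V := ⨅ k ∉ I, LinearMap.ker (b.coord k)
  have hU x : x ∈ U ↔ ∀ k ∉ I, b.coord k x = 0 := by simp [U]
  have hmem {t i j c} (ht : t ∈ S) (h : IsEdge b b.coord i j c t) :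
      c • b j - b i ∈ commutatorSpace (Subgroup.closure S) :=
    h.apply_left hF ▸ apply_sub_mem_commutatorSpace (Subgroup.subset_closure ht) (b i)
  have hcoord {t i j c} (h : IsEdge b b.coord i j c t) : b.coord i (c • b j - b i) ≠ 0 := by
    rw [map_sub, map_smul, hF.self, hF.ne i j h.index_ne, smul_zero, zero_sub]
    exact neg_ne_zero.2 one_ne_zero
  have hle : commutatorSpace (Subgroup.closure S) ≤ U := by
    refine commutatorSpace_le_of_isIrreducibleGroup hirr
      (fun g hg x => apply_mem_of_mem_closure (fun t ht x hx => ?_) hg) ?_ (hmem ht₀ h₀) ?_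
    · obtain ⟨i, j, c, h⟩ := hb t ht
      exact (hU _).2 (h.apply_mem_of_mem_iff (hstep ht h) ((hU _).1 hx))
    · refine (hU _).2 fun k hk => ?_
      rw [map_sub, map_smul, hF.ne k j fun h => hk (h ▸ hj), hF.ne k o fun h => hk (.inl h),
        smul_zero, sub_zero]
    · exact fun hzero => hcoord h₀ (by rw [hzero, map_zero])
  refine ⟨o, I, ⟨o, .inl rfl, j, hj, h₀.index_ne⟩, fun i hi hio => hi.resolve_left hio,
    fun t ht i j c h => ?_⟩
  by_contra hi
  exact hcoord h ((hU _).1 (hle (hmem ht h)) i hi)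

end Components

section GainFrames

variable {S : Set (V ≃ₗ[K] V)}

theorem restrict_closure {W : Submodule K V}
    (hW : ∀ t ∈ S, ∃ h : W ≃ₗ[K] W, ∀ w, (h w : V) = t w) :
    restrict (Subgroup.closure S) W =
      Subgroup.closure {h : W ≃ₗ[K] W | ∃ t ∈ S, ∀ w, (h w : V) = t w} := by
  refine le_antisymm ?_ ((Subgroup.closure_le _).2 fun h ⟨t, ht, hth⟩ =>
    ⟨t, Subgroup.subset_closure ht, hth⟩)
  rintro h ⟨g, hg, hgh⟩
  suffices ∃ h' ∈ Subgroup.closure {h : W ≃ₗ[K] W | ∃ t ∈ S, ∀ w, (h w : V) = t w},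
      ∀ w, (h' w : V) = g w by
    obtain ⟨h', hh', hgh'⟩ := this
    obtain rfl : h = h' := LinearEquiv.ext fun w => Subtype.ext ((hgh w).trans (hgh' w).symm)
    exact hh'
  clear hgh h
  induction hg using Subgroup.closure_induction with
  | mem t ht =>
    obtain ⟨h, hth⟩ := hW t ht
    exact ⟨h, Subgroup.subset_closure ⟨t, ht, hth⟩, hth⟩
  | one => exact ⟨1, one_mem _, fun w => rfl⟩
  | mul a b _ _ iha ihb =>
    obtain ⟨a', ha', haa'⟩ := iha
    obtain ⟨b', hb', hbb'⟩ := ihb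
    exact ⟨a' * b', mul_mem ha' hb', fun w => by
      rw [LinearEquiv.mul_apply, LinearEquiv.mul_apply, haa', hbb']⟩
  | inv a _ iha =>
    obtain ⟨a', ha', haa'⟩ := iha
    have hinv w : a' (a'⁻¹ w) = w := a'.apply_symm_apply w
    exact ⟨a'⁻¹, inv_mem ha', fun w => by
      rw [← a.injective.eq_iff, ← haa', hinv]
      exact (a.apply_symm_apply _).symm⟩

theorem commutatorAction_closure (S : Set (V ≃ₗ[K] V)) :
    commutatorAction (Subgroup.closure S) = Subgroup.closure
      {h : commutatorSpace (Subgroup.closure S) ≃ₗ[K] commutatorSpace (Subgroup.closure S) |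
        ∃ t ∈ S, ∀ w, (h w : V) = t w} :=
  restrict_closure fun _ ht =>
    (exists_mem_commutatorAction (Subgroup.subset_closure ht)).imp fun _ => And.right

/-- The elements of `S` are edges of the frame `e, f` with gains in `H`, and the group generated by
`S` contains all edges of the frame with gains in `H`. -/
structure IsGainFrame {ι : Type*} (S : Set (V ≃ₗ[K] V)) (e : ι → V) (f : ι → Dual K V)
    (H : Subgroup Kˣ) : Prop where
  isFrame : IsFrame e f
  exists_isEdge : ∀ t ∈ S, ∃ i j, ∃ c ∈ H, IsEdge e f i j (c : K) t
  exists_mem : ∀ i j, i ≠ j → ∀ c ∈ H, ∃ g ∈ Subgroup.closure S, IsEdge e f i j (c : K) g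

theorem exists_isGainFrame [FiniteDimensional K V] [CharP K 2] {ι : Type*} [Finite ι]
    {b : Basis ι K V} (hb : ∀ t ∈ S, IsEdgeOf b b.coord t)
    (hirr : IsIrreducibleGroup (commutatorAction (Subgroup.closure S))) :
    ∃ m, 2 ≤ m ∧ ∃ (e : Fin m → V) (f : Fin m → Dual K V) (H : Subgroup Kˣ),
      IsGainFrame S e f H := by
  obtain ⟨o, I, hI, ho, hSI⟩ := exists_component hb hirr
  obtain ⟨b', hbb', h1⟩ := exists_basis_containsEdge_one ho
  obtain ⟨H, hH⟩ := exists_subgroup_containsEdge_iff h1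
  have hF := isFrame_basis b'
  let p := Finite.equivFin I
  have hp i j (hij : i ≠ j) : (p.symm i : ι) ≠ p.symm j :=
    fun h => hij (p.symm.injective (Subtype.ext h))
  refine ⟨Nat.card I, ?_, fun i => b' (p.symm i), fun i => b'.coord (p.symm i), H,
    ⟨fun i => hF.self _, fun i j hij => hF.ne _ _ (hp i j hij)⟩, fun t ht => ?_,
    fun i j hij c hc => ?_⟩
  · have := hI.coe_sort
    exact Finite.one_lt_card
  · obtain ⟨i, j, c, h⟩ := hb t ht
    have hi := hSI t ht i j c h
    have hj := hSI t ht j i c⁻¹ h.symm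
    obtain ⟨c', h'⟩ := hbb' i j c t h
    lift c' to Kˣ using h'.gain_ne.isUnit
    refine ⟨p ⟨i, hi⟩, p ⟨j, hj⟩, c', ?_, ?_, h'.gain_ne, fun x => ?_⟩
    · exact (hH hi hj h'.index_ne c').1 ⟨t, Subgroup.subset_closure ht, h'⟩
    · exact fun heq => h'.index_ne (congrArg Subtype.val (p.injective heq))
    · simp only [p.symm_apply_apply, h'.apply x]
  · obtain ⟨g, hg, h⟩ := (hH (p.symm i).2 (p.symm j).2 (hp i j hij) c).2 hc
    exact ⟨g, hg, hij, h.gain_ne, h.apply⟩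

variable {ι : Type*} {e : ι → V} {f : ι → Dual K V} {H : Subgroup Kˣ}

theorem IsGainFrame.commutatorSpace_le (h : IsGainFrame S e f H) :
    commutatorSpace (Subgroup.closure S) ≤ Submodule.span K (Set.range e) := by
  refine commutatorSpace_closure_le fun t ht x => ?_
  obtain ⟨i, j, c, -, hedge⟩ := h.exists_isEdge t ht
  have he k : e k ∈ Submodule.span K (Set.range e) := Submodule.subset_span ⟨k, rfl⟩
  rw [hedge.apply, add_sub_cancel_left]
  exact Submodule.smul_mem _ _ (Submodule.add_mem _ (he i) (Submodule.smul_mem _ _ (he j)))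

variable [CharP K 2]

theorem IsGainFrame.smul_sub_mem (h : IsGainFrame S e f H) {i j : ι} (hij : i ≠ j) {c : Kˣ}
    (hc : c ∈ H) : (c : K) • e j - e i ∈ commutatorSpace (Subgroup.closure S) := by
  obtain ⟨g, hg, hedge⟩ := h.exists_mem i j hij c hc
  rw [← hedge.apply_left h.isFrame]
  exact apply_sub_mem_commutatorSpace hg (e i)

theorem IsGainFrame.commutatorSpace_eq [Nontrivial ι] (h : IsGainFrame S e f H) (hH : H ≠ ⊥) :
    commutatorSpace (Subgroup.closure S) = Submodule.span K (Set.range e) := by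
  refine le_antisymm h.commutatorSpace_le (Submodule.span_le.2 ?_)
  rintro _ ⟨j, rfl⟩
  obtain ⟨c, hc, hc1⟩ := H.bot_or_exists_ne_one.resolve_left hH
  obtain ⟨i, hij⟩ := exists_ne j
  have hdiff := Submodule.sub_mem _ (h.smul_sub_mem hij hc) (h.smul_sub_mem hij H.one_mem)
  rw [sub_sub_sub_cancel_right, ← sub_smul, Units.val_one] at hdiff
  exact (Submodule.smul_mem_iff _ (sub_ne_zero.2 (Units.val_eq_one.not.2 hc1))).1 hdiff

theorem IsGainFrame.hasMonomialType [Finite K] {m : ℕ} {e : Fin m → V} {f : Fin m → Dual K V}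
    (h : IsGainFrame S e f H) (hH : H ≠ ⊥)
    (hd : 2 ≤ finrank K (commutatorSpace (Subgroup.closure S))) (hm : 2 ≤ m) :
    HasMonomialType (commutatorAction (Subgroup.closure S)) := by
  have : Nontrivial (Fin m) := Fin.nontrivial_iff_two_le.2 hm
  let b : Basis (Fin m) K (commutatorSpace (Subgroup.closure S)) :=
    (Basis.span h.isFrame.linearIndependent).map
      (LinearEquiv.ofEq _ _ (h.commutatorSpace_eq hH).symm)
  have hb i : (b i : V) = e i :=
    congrArg Subtype.val (Basis.span_apply h.isFrame.linearIndependent i)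
  have hf i w : b.coord i w = f i w := by
    suffices b.coord i = f i ∘ₗ Submodule.subtype _ from LinearMap.congr_fun this w
    refine b.ext fun j => ?_
    rw [LinearMap.comp_apply, Submodule.subtype_apply, hb]
    rcases eq_or_ne i j with rfl | hij
    · rw [(isFrame_basis b).self, h.isFrame.self]
    · rw [(isFrame_basis b).ne i j hij, h.isFrame.ne i j hij]
  have hedge {i j} {c : K} {t} {g : commutatorSpace (Subgroup.closure S) ≃ₗ[K]
      commutatorSpace (Subgroup.closure S)} (ht : IsEdge e f i j c t)
      (hg : ∀ w, (g w : V) = t w) : IsEdge b b.coord i j c g :=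
    ⟨ht.index_ne, ht.gain_ne, fun w => Subtype.ext (by simp [hg, ht.apply, hf, hb])⟩
  rw [commutatorAction_closure]
  refine hasMonomialType_closure_of_isEdge (b := b) hH hd ?_ fun i j hij c hc => ?_
  · rintro g ⟨t, ht, htg⟩
    obtain ⟨i, j, c, hc, h'⟩ := h.exists_isEdge t ht
    exact ⟨i, j, c, hc, hedge h' htg⟩
  · obtain ⟨g, hg, h'⟩ := h.exists_mem i j hij c hc
    obtain ⟨g', hg', hgg'⟩ := exists_mem_commutatorAction hg
    exact ⟨g', commutatorAction_closure S ▸ hg', hedge h' hgg'⟩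

end GainFrames

section Symmetric

variable {S : Set (V ≃ₗ[K] V)} {ι : Type*} {e : ι → V} {f : ι → Dual K V}

theorem IsFrame.sum_smul_eq_self [Fintype ι] (hF : IsFrame e f) {x : V}
    (hx : x ∈ Submodule.span K (Set.range e)) : ∑ i, f i x • e i = x := by
  obtain ⟨a, rfl⟩ := (Submodule.mem_span_range_iff_exists_fun K).1 hx
  simp only [hF.apply_sum]

variable [CharP K 2]

theorem IsEdge.apply_swap [DecidableEq ι] (hF : IsFrame e f) {i j : ι} {t : V ≃ₗ[K] V}
    (h : IsEdge e f i j 1 t) (x : V) (k : ι) : f (Equiv.swap i j k) (t x) = f k x := by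
  have hij := h.index_ne
  have happly l : f l (t x) = f l x + (f i x + f j x) * (f l (e i) + f l (e j)) := by
    rw [h.apply, inv_one, one_smul, one_smul, map_add, map_smul, map_add, LinearMap.add_apply,
      smul_eq_mul]
  rw [happly]
  rcases eq_or_ne k i with rfl | hki
  · rw [Equiv.swap_apply_left, hF.self, hF.ne j k hij.symm, zero_add, mul_one, add_comm,
      CharTwo.add_cancel_right]
  rcases eq_or_ne k j with rfl | hkj
  · rw [Equiv.swap_apply_right, hF.self, hF.ne i k hij, add_zero, mul_one,
      CharTwo.add_cancel_left]
  · rw [Equiv.swap_apply_of_ne_of_ne hki hkj, hF.ne k i hki, hF.ne k j hkj, add_zero, mul_zero,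
      add_zero]

namespace IsGainFrame

theorem exists_perm (h : IsGainFrame S e f ⊥) {g : V ≃ₗ[K] V} (hg : g ∈ Subgroup.closure S) :
    ∃ σ : Equiv.Perm ι, ∀ x i, f (σ i) (g x) = f i x := by
  classical
  induction hg using Subgroup.closure_induction with
  | mem t ht =>
    obtain ⟨i, j, c, hc, hedge⟩ := h.exists_isEdge t ht
    obtain rfl := Subgroup.mem_bot.1 hc
    exact ⟨Equiv.swap i j, hedge.apply_swap h.isFrame⟩
  | one => exact ⟨1, fun x i => rfl⟩
  | mul a b _ _ ha hb =>
    obtain ⟨σ, hσ⟩ := ha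
    obtain ⟨τ, hτ⟩ := hb
    exact ⟨σ * τ, fun x i => (hσ (b x) (τ i)).trans (hτ x i)⟩
  | inv a _ ha =>
    obtain ⟨σ, hσ⟩ := ha
    refine ⟨σ⁻¹, fun x i => ?_⟩
    have hinv : a (a⁻¹ x) = x := a.apply_symm_apply x
    rw [← hσ, hinv, ← Equiv.Perm.mul_apply, mul_inv_cancel, Equiv.Perm.one_apply]

theorem exists_mem_perm [Finite ι] (h : IsGainFrame S e f ⊥) (σ : Equiv.Perm ι) :
    ∃ g ∈ Subgroup.closure S, ∀ x i, f (σ i) (g x) = f i x := by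
  classical
  induction σ using Equiv.Perm.swap_induction_on with
  | one => exact ⟨1, one_mem _, fun x i => rfl⟩
  | swap_mul σ i j hij ih =>
    obtain ⟨g, hg, hσ⟩ := ih
    obtain ⟨t, ht, hedge⟩ := h.exists_mem i j hij 1 (one_mem _)
    exact ⟨t * g, mul_mem ht hg, fun x k =>
      (hedge.apply_swap h.isFrame (g x) (σ k)).trans (hσ x k)⟩

theorem sum_eq_zero [Fintype ι] (h : IsGainFrame S e f ⊥) {x : V}
    (hx : x ∈ commutatorSpace (Subgroup.closure S)) : ∑ i, f i x = 0 := by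
  suffices commutatorSpace (Subgroup.closure S) ≤ LinearMap.ker (∑ i, f i) by
    simpa [LinearMap.sum_apply] using this hx
  refine commutatorSpace_closure_le fun t ht y => ?_
  obtain ⟨σ, hσ⟩ := h.exists_perm (Subgroup.subset_closure ht)
  rw [LinearMap.mem_ker, map_sub, sub_eq_zero, LinearMap.sum_apply, LinearMap.sum_apply,
    ← Equiv.sum_comp σ]
  exact Finset.sum_congr rfl fun i _ => hσ y i

theorem sum_smul_mem [Fintype ι] {H : Subgroup Kˣ} (h : IsGainFrame S e f H) {a : ι → K}
    (ha : ∑ i, a i = 0) : ∑ i, a i • e i ∈ commutatorSpace (Subgroup.closure S) := by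
  rcases isEmpty_or_nonempty ι with _ | ⟨⟨o⟩⟩
  · simp
  have hsum : ∑ i, a i • e i = ∑ i, a i • (e i - e o) := by
    simp only [smul_sub, Finset.sum_sub_distrib, ← Finset.sum_smul, ha, zero_smul, sub_zero]
  rw [hsum]
  refine Submodule.sum_mem _ fun i _ => Submodule.smul_mem _ _ ?_
  rcases eq_or_ne o i with rfl | hoi
  · rw [sub_self]
    exact Submodule.zero_mem _
  · simpa using h.smul_sub_mem hoi H.one_mem

variable {m : ℕ} {e : Fin m → V} {f : Fin m → Dual K V}

theorem exists_linearEquiv (h : IsGainFrame S e f ⊥) :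
    ∃ E : commutatorSpace (Subgroup.closure S) ≃ₗ[K] sumZero K m,
      ∀ w i, (E w : Fin m → K) i = f i w := by
  let E : commutatorSpace (Subgroup.closure S) →ₗ[K] sumZero K m :=
    (LinearMap.pi f ∘ₗ Submodule.subtype _).codRestrict _
      fun w => mem_sumZero.2 (h.sum_eq_zero w.2)
  have hE w i : (E w : Fin m → K) i = f i w := rfl
  refine ⟨LinearEquiv.ofBijective E ⟨fun w w' hw => Subtype.ext ?_, fun y => ?_⟩, hE⟩
  · rw [← h.isFrame.sum_smul_eq_self (h.commutatorSpace_le w.2),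
      ← h.isFrame.sum_smul_eq_self (h.commutatorSpace_le w'.2)]
    simp only [← hE, hw]
  · exact ⟨⟨_, h.sum_smul_mem (mem_sumZero.1 y.2)⟩,
      Subtype.ext (funext fun i => h.isFrame.apply_sum _ i)⟩

theorem mem_commutatorAction_iff (h : IsGainFrame S e f ⊥)
    {g : commutatorSpace (Subgroup.closure S) ≃ₗ[K] commutatorSpace (Subgroup.closure S)} :
    g ∈ commutatorAction (Subgroup.closure S) ↔
      ∃ σ : Equiv.Perm (Fin m), ∀ w i, f (σ i) (g w) = f i w := by
  constructor
  · rintro ⟨g', hg', hgg'⟩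
    obtain ⟨σ, hσ⟩ := h.exists_perm hg'
    exact ⟨σ, fun w i => hgg' w ▸ hσ w i⟩
  · rintro ⟨σ, hσ⟩
    obtain ⟨g', hg', hσ'⟩ := h.exists_mem_perm σ
    obtain ⟨k, hk, hkg'⟩ := exists_mem_commutatorAction hg'
    obtain ⟨E, hE⟩ := h.exists_linearEquiv
    suffices g = k from this ▸ hk
    refine LinearEquiv.ext fun w => E.injective (Subtype.ext (funext fun i => ?_))
    obtain ⟨i, rfl⟩ := σ.surjective i
    rw [hE, hE, hσ, hkg', hσ']

theorem odd (h : IsGainFrame S e f ⊥)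
    (hirr : IsIrreducibleGroup (commutatorAction (Subgroup.closure S)))
    (hd : 2 ≤ finrank K (commutatorSpace (Subgroup.closure S))) (hm : m ≠ 0) : Odd m := by
  by_contra hnot
  have : NeZero m := ⟨hm⟩
  obtain ⟨E, hE⟩ := h.exists_linearEquiv
  have hone : (fun _ => 1 : Fin m → K) ∈ sumZero K m := by
    have hm0 : (m : K) = 0 :=
      (CharP.cast_eq_zero_iff K 2 m).2 (Nat.not_odd_iff_even.1 hnot).two_dvd
    simp [mem_sumZero, hm0]
  set x := E.symm ⟨_, hone⟩ with hx
  have hfx i : f i x = 1 := by rw [← hE, hx, E.apply_symm_apply]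
  have hx0 : x ≠ 0 := fun hzero => one_ne_zero (α := K) (by
    rw [← hfx 0, hzero, ZeroMemClass.coe_zero, map_zero])
  have hfix g (hg : g ∈ commutatorAction (Subgroup.closure S)) : g x = x := by
    obtain ⟨σ, hσ⟩ := h.mem_commutatorAction_iff.1 hg
    refine E.injective (Subtype.ext (funext fun i => ?_))
    obtain ⟨i, rfl⟩ := σ.surjective i
    rw [hE, hE, hσ, hfx, hfx]
  exact absurd (finrank_le_one_of_isIrreducibleGroup hirr hx0 hfix) (by lia)

theorem hasOddSymmetricType (h : IsGainFrame S e f ⊥)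
    (hirr : IsIrreducibleGroup (commutatorAction (Subgroup.closure S)))
    (hd : 2 ≤ finrank K (commutatorSpace (Subgroup.closure S))) (hm : 2 ≤ m) :
    HasOddSymmetricType (commutatorAction (Subgroup.closure S)) := by
  have hodd := h.odd hirr hd (by lia)
  obtain ⟨E, hE⟩ := h.exists_linearEquiv
  refine ⟨inferInstance, m, ?_, hodd, E, fun g => ?_⟩
  · obtain ⟨k, rfl⟩ := hodd
    lia
  · simp only [hE, h.mem_commutatorAction_iff]

end IsGainFrame

end Symmetric

section Main

variable [Finite K] [FiniteDimensional K V] {S T : Set (V ≃ₗ[K] V)}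

theorem HasMonomialType.isNondegenerate (h : HasMonomialType (Subgroup.closure T))
    (hT : ∀ t ∈ T, IsTransvection t) (hS : S ⊆ T) (hw : IsWeaklyNondegenerate S) :
    IsNondegenerate S := by
  have : CharP K 2 := h.1
  obtain ⟨n, b, hb⟩ := h.exists_isEdgeOf hT
  exact isNondegenerate_of_finrank_eq (finrank_vecSpan_eq_finrank_covecSpan
    (fun t ht => hT t (hS ht)) fun t ht => hb t (hS ht)) hw

theorem HasMonomialType.hasMonomialType_or_hasOddSymmetricType
    (h : HasMonomialType (Subgroup.closure T)) (hT : ∀ t ∈ T, IsTransvection t) (hS : S ⊆ T)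
    (hd : 2 ≤ finrank K (commutatorSpace (Subgroup.closure S)))
    (hirr : IsIrreducibleGroup (commutatorAction (Subgroup.closure S))) :
    HasMonomialType (commutatorAction (Subgroup.closure S)) ∨
      HasOddSymmetricType (commutatorAction (Subgroup.closure S)) := by
  have : CharP K 2 := h.1
  obtain ⟨n, b, hb⟩ := h.exists_isEdgeOf hT
  obtain ⟨m, hm, e, f, H, hF⟩ := exists_isGainFrame (fun t ht => hb t (hS ht)) hirr
  by_cases hH : H = ⊥
  · subst hH
    exact .inr (hF.hasOddSymmetricType hirr hd hm)
  · exact .inl (hF.hasMonomialType hH hd hm)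

end Main

theorem mainTheorem8_general {K V : Type*} [Field K] [Finite K] [AddCommGroup V] [Module K V]
    [FiniteDimensional K V] (hn : 2 ≤ finrank K V) {N : ℕ} (hN : 80 ≤ N)
    (T : Set (V ≃ₗ[K] V)) (hT : ∀ t ∈ T, IsTransvection t) (hdense : IsDense T)
    (hsymp : ¬ PreservesSymplecticForm (Subgroup.closure T)) :
    HasMonomialType (Subgroup.closure T) ↔
      IsLocallyNondegenerate T N ∧ IsLocallyStandard T N :=
  ⟨fun h => ⟨fun _ hS _ => h.isNondegenerate hT hS,
    fun _ hS _ => h.hasMonomialType_or_hasOddSymmetricType hT hS⟩,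
    fun h => hasMonomialType_closure_of_isLocallyStandard hn hT hdense hsymp hN h.1 h.2⟩

end TransvectionGroups

open TransvectionGroups in
theorem mainTheorem8 {K V : Type*} [Field K] [Finite K] [AddCommGroup V] [Module K V]
    [FiniteDimensional K V] (hn : 2 ≤ Module.finrank K V)
    (T : Set (V ≃ₗ[K] V)) (hT : ∀ t ∈ T, IsTransvection t) (hdense : IsDense T)
    (hsymp : ¬ PreservesSymplecticForm (Subgroup.closure T)) :
    HasMonomialType (Subgroup.closure T) ↔
      ∀ T₀ : Set (V ≃ₗ[K] V), T₀ ⊆ T → T₀.encard ≤ 1000 →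
        (IsWeaklyNondegenerate T₀ → IsNondegenerate T₀) ∧
        (2 ≤ Module.finrank K (commutatorSpace (Subgroup.closure T₀)) →
          IsIrreducibleGroup
            (restrict (Subgroup.closure T₀) (commutatorSpace (Subgroup.closure T₀))) →
          HasMonomialType
              (restrict (Subgroup.closure T₀) (commutatorSpace (Subgroup.closure T₀))) ∨
            HasOddSymmetricType
              (restrict (Subgroup.closure T₀) (commutatorSpace (Subgroup.closure T₀)))) := by
  simpa only [IsLocallyNondegenerate, IsLocallyStandard, ← forall_and, Nat.cast_ofNat] using
    mainTheorem8_general hn (N := 1000) (by norm_num) T hT hdense hsymp
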